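/- Let $n\in\mathbb N$, $n\ge 1$, write $x=(\overline x,x_n)\in\mathbb R^{n-1}\times\mathbb R$, and let $\Omega=\{x\in\mathbb R^n: x_n<\varphi(\overline x)\}$, where $\varphi:\mathbb R^{n-1}\to\mathbb R$ satisfies $|\varphi(\overline x)-\varphi(\overline y)|\le M|\overline x-\overline y|$ for all $\overline x,\overline y\in\mathbb R^{n-1}$, with a constant $M>0$. Put $\rho_n(x)=x_n-\varphi(\overline x)$, $G=\mathbb R^n\setminus\overline\Omega$ and, for $k\in\mathbb Z$, $G_k=\{x\in G:2^{-k-1}<\rho_n(x)\le 2^{-k}\}$. Let $l\in\mathbb N_0$, $p\in[1,\infty[$ and $\phi:]0,\infty[\to]0,\infty[$. Let $(\psi_k)_{k\in\mathbb Z}$ be nonnegative functions in $C^\infty(\mathbb R^n)$ such that: (a) $\sum_{k}\psi_k=1$ on $G$ and $\sum_k\psi_k=0$ on $\mathbb R^n\setminus G$; (b) $G=\bigcup_k\operatorname{supp}\psi_k$, and this covering has multiplicity $2$; (c) $G_k\subset\operatorname{supp}\psi_k\subset G_{k-1}\cup G_k\cup G_{k+1}$ for all $k$; (d) for every multi-index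 $\alpha\in\mathbb N_0^n$ there is $c(\alpha)$ with $|D^\alpha\psi_k(x)|\le c(\alpha)2^{k|\alpha|}$ for all $x\in\mathbb R^n$, $k\in\mathbb Z$. Let $\omega\in C_c^\infty(\mathbb R^n)$ satisfy $\operatorname{supp}\omega\subset\{x\in\overline{B(0,1)}:x_n\ge\frac12\}$, $\int\omega=1$, and $\int\omega(z)z^\alpha\,dz=0$ for $0<|\alpha|\le l$. With $A=16(M+1)$, define for $f\in W^{l,p}(\Omega)$ $$(Tf)(x)=\begin{cases}f(x),&x\in\Omega,\\ \sum_{k\in\mathbb Z}\psi_k(x)f_k(x),&x\in G,\end{cases}\qquad f_k(x)=\int_{\mathbb R^n}f(\overline x-2^{-k}\overline z,\,x_n-A2^{-k}z_n)\,\omega(z)\,dz .$$ (The null set $\partial\Omega$ is irrelevant.) Here $W^{l,p}(\Omega)$ is the space of real- or complex-valued $f\in L^p(\Omega)$ with weak derivatives $D^\alpha f\in L^p(\Omega)$ for all $|\alpha|\le l$. For an open set $U\subset\mathbb R^n$, $\delta\in]0,\infty]$ and $u\in L^p_{loc}(U)$ put $$\|u\|_{M^{\phi,\delta}_p(U)}=\sup_{x\in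 U}\ \sup_{0<r<\delta}\Big(\frac1{\phi(r)}\int_{B_r(x)\cap U}|u|^p\,dy\Big)^{1/p}\in[0,\infty].$$ Then the following statements hold. (i) There exists $c>0$ such that for all $\delta\in]0,\infty]$ and all $f\in W^{l,p}(\Omega)$ one has $Tf\in L^p_{loc}(\mathbb R^n)$ and $$\|Tf\|_{M^{\phi,\delta}_p(\mathbb R^n)}\le c\,\|f\|_{M^{\phi,\delta}_p(\Omega)}.$$ (ii) For every $D>0$ there exists $c>0$ such that for all $\delta\in]0,\infty]$, all $f\in W^{l,p}(\Omega)$ with $\operatorname{supp}f\subset\{x\in\Omega:|\rho_n(x)|<D\}$ (the support being taken relative to $\Omega$: it is the complement in $\Omega$ of the largest open subset of $\Omega$ on which $f=0$ a.e.), and all $\alpha\in\mathbb N_0^n$ with $|\alpha|=l$, the weak derivative $D^\alpha Tf$ exists on $\mathbb R^n$, belongs to $L^p_{loc}(\mathbb R^n)$, and $$\|D^\alpha Tf\|_{M^{\phi,\delta}_p(\mathbb R^n)}\le c\sum_{|\beta|=l}\|D^\beta f\|_{M^{\phi,\delta}_p(\Omega)}.$$ -/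

import Mathlib

noncomputable section

namespace BurenkovMorrey

open MeasureTheory Set
open scoped ENNReal

/-! ### Multi-index derivatives, weak derivatives, Sobolev spaces -/

/-- The `i`-th partial derivative. -/
def partialDeriv {n : ℕ} (i : Fin n) (u : EuclideanSpace ℝ (Fin n) → ℝ) :
    EuclideanSpace ℝ (Fin n) → ℝ :=
  fun x => fderiv ℝ u x (EuclideanSpace.single i 1)

/-- The classical derivative `D^α u = ∂₁^{α₁} ⋯ ∂ₙ^{αₙ} u` (used for smooth `u` only, for which the
order of the differentiations does not matter). -/
def multiDeriv {n : ℕ} (α : Fin n → ℕ) (u : EuclideanSpace ℝ (Fin n) → ℝ) :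
    EuclideanSpace ℝ (Fin n) → ℝ :=
  (List.finRange n).foldr (fun i v => (partialDeriv i)^[α i] v) u

/-- The order `|α| = α₁ + ⋯ + αₙ` of a multi-index. -/
def order {n : ℕ} (α : Fin n → ℕ) : ℕ := ∑ i, α i

/-- `g` is a weak derivative `D^α f` on the open set `Ω`. -/
def IsWeakDeriv {n : ℕ} {𝕜 : Type*} [RCLike 𝕜] (Ω : Set (EuclideanSpace ℝ (Fin n)))
    (α : Fin n → ℕ) (f g : EuclideanSpace ℝ (Fin n) → 𝕜) : Prop :=
  LocallyIntegrableOn f Ω ∧ LocallyIntegrableOn g Ω ∧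
    ∀ η : EuclideanSpace ℝ (Fin n) → ℝ, ContDiff ℝ (⊤ : ℕ∞) η → HasCompactSupport η → tsupport η ⊆ Ω →
      ∫ x in Ω, multiDeriv α η x • f x = ((-1 : ℝ) ^ order α) • ∫ x in Ω, η x • g x

open Classical in
/-- The weak derivative `D^α f` on `Ω` (unique up to null sets); it is set to be `0` if `f` has no
such weak derivative. -/
def weakDeriv {n : ℕ} {𝕜 : Type*} [RCLike 𝕜] (Ω : Set (EuclideanSpace ℝ (Fin n)))
    (α : Fin n → ℕ) (f : EuclideanSpace ℝ (Fin n) → 𝕜) : EuclideanSpace ℝ (Fin n) → 𝕜 :=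
  if h : ∃ g, IsWeakDeriv Ω α f g then h.choose else 0

/-- `f ∈ W^{l,p}(Ω)`. Values of `f` outside `Ω` play no role. -/
def MemSobolev {n : ℕ} {𝕜 : Type*} [RCLike 𝕜] (l : ℕ) (p : ℝ)
    (Ω : Set (EuclideanSpace ℝ (Fin n))) (f : EuclideanSpace ℝ (Fin n) → 𝕜) : Prop :=
  MemLp f (ENNReal.ofReal p) (volume.restrict Ω) ∧
    ∀ α : Fin n → ℕ, order α ≤ l →
      ∃ g, IsWeakDeriv Ω α f g ∧ MemLp g (ENNReal.ofReal p) (volume.restrict Ω)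

/-- `f ∈ L^p_loc(Ω)`. -/
def MemLpLoc {n : ℕ} {𝕜 : Type*} [RCLike 𝕜] (p : ℝ)
    (Ω : Set (EuclideanSpace ℝ (Fin n))) (f : EuclideanSpace ℝ (Fin n) → 𝕜) : Prop :=
  ∀ K ⊆ Ω, IsCompact K → MemLp f (ENNReal.ofReal p) (volume.restrict K)

/-- The support in `Ω` of a function defined almost everywhere: the complement in `Ω` of the largest
open subset of `Ω` on which `f = 0` almost everywhere. -/
def essSupport {n : ℕ} {𝕜 : Type*} [RCLike 𝕜] (Ω : Set (EuclideanSpace ℝ (Fin n)))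
    (f : EuclideanSpace ℝ (Fin n) → 𝕜) : Set (EuclideanSpace ℝ (Fin n)) :=
  {x | x ∈ Ω ∧ ∀ U, IsOpen U → x ∈ U → ¬ ∀ᵐ y ∂(volume.restrict (U ∩ Ω)), f y = 0}

/-- The Morrey norm of `f` on `Ω`, with values in `[0, ∞]`: the supremum over `x ∈ Ω` and
`0 < r < δ` of `(φ(r)⁻¹ ∫_{B_r(x) ∩ Ω} |f|^p)^{1/p}`. -/
def morreyNorm {n : ℕ} {𝕜 : Type*} [RCLike 𝕜] (φ : ℝ → ℝ) (δ : ℝ≥0∞) (p : ℝ)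
    (Ω : Set (EuclideanSpace ℝ (Fin n))) (f : EuclideanSpace ℝ (Fin n) → 𝕜) : ℝ≥0∞ :=
  ⨆ x ∈ Ω, ⨆ (r : ℝ) (_ : 0 < r ∧ ENNReal.ofReal r < δ),
    ((ENNReal.ofReal (φ r))⁻¹ * ∫⁻ y in Metric.ball x r ∩ Ω, ‖f y‖ₑ ^ p) ^ (1 / p)

/-! ### The subgraph of a Lipschitz function and Burenkov's operator -/

/-- The space `ℝⁿ` with `n = m + 1`, whose points are written `x = (x̄, xₙ)`, `x̄ ∈ ℝᵐ`, `xₙ ∈ ℝ`. -/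
abbrev Space (m : ℕ) : Type := EuclideanSpace ℝ (Fin (m + 1))

/-- The first `n - 1` coordinates `x̄` of `x`. -/
def bar {m : ℕ} (x : Space m) : EuclideanSpace ℝ (Fin m) :=
  WithLp.toLp 2 (fun i : Fin m => x i.castSucc)

/-- `ρₙ(x) = xₙ - γ(x̄)`. -/
def rho {m : ℕ} (γ : EuclideanSpace ℝ (Fin m) → ℝ) (x : Space m) : ℝ :=
  x (Fin.last m) - γ (bar x)

/-- The subgraph `Ω = {x : xₙ < γ(x̄)}`. -/
def subgraph {m : ℕ} (γ : EuclideanSpace ℝ (Fin m) → ℝ) : Set (Space m) :=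
  {x | x (Fin.last m) < γ (bar x)}

/-- `G`, the complement of the closure of `Ω`. -/
def exterior {m : ℕ} (γ : EuclideanSpace ℝ (Fin m) → ℝ) : Set (Space m) :=
  (closure (subgraph γ))ᶜ

/-- `G_k = {x ∈ G : 2^{-k-1} < ρₙ(x) ≤ 2^{-k}}`. -/
def layer {m : ℕ} (γ : EuclideanSpace ℝ (Fin m) → ℝ) (k : ℤ) : Set (Space m) :=
  {x | x ∈ exterior γ ∧ (2 : ℝ) ^ (-k - 1) < rho γ x ∧ rho γ x ≤ (2 : ℝ) ^ (-k)}

/-- The partitions of unity `(ψ_k)_{k ∈ ℤ}` on `G` that are admitted in Burenkov's operator. -/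
structure IsPartition {m : ℕ} (γ : EuclideanSpace ℝ (Fin m) → ℝ) (ψ : ℤ → Space m → ℝ) :
    Prop where
  smooth : ∀ k, ContDiff ℝ (⊤ : ℕ∞) (ψ k)
  nonneg : ∀ k x, 0 ≤ ψ k x
  sum_eq_one : ∀ x ∈ exterior γ, HasSum (fun k => ψ k x) 1
  sum_eq_zero : ∀ x ∉ exterior γ, HasSum (fun k => ψ k x) 0
  cover : exterior γ = ⋃ k, tsupport (ψ k)
  /-- The covering by the supports has multiplicity two. -/
  multiplicity : ⨆ x : Space m, {k : ℤ | x ∈ tsupport (ψ k)}.encard = 2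
  layer_subset : ∀ k, layer γ k ⊆ tsupport (ψ k)
  support_subset : ∀ k, tsupport (ψ k) ⊆ layer γ (k - 1) ∪ layer γ k ∪ layer γ (k + 1)
  deriv_bound : ∀ α : Fin (m + 1) → ℕ, ∃ C : ℝ, ∀ (k : ℤ) (x : Space m),
    |multiDeriv α (ψ k) x| ≤ C * (2 : ℝ) ^ (k * (order α : ℤ))

/-- The mollification kernels `ω` that are admitted in Burenkov's operator for smoothness `l`. -/
structure IsKernel {m : ℕ} (l : ℕ) (ω : Space m → ℝ) : Prop where
  smooth : ContDiff ℝ (⊤ : ℕ∞) ω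
  support_subset : tsupport ω ⊆ {x | x ∈ Metric.closedBall 0 1 ∧ 1 / 2 ≤ x (Fin.last m)}
  integral_eq_one : ∫ z, ω z = 1
  moments : ∀ α : Fin (m + 1) → ℕ, 0 < order α → order α ≤ l →
    ∫ z, ω z * ∏ i, z i ^ α i = 0

/-- The anisotropic dilation `z ↦ (z̄, A zₙ)`. -/
def stretch {m : ℕ} (A : ℝ) (z : Space m) : Space m :=
  WithLp.toLp 2 (fun i => if i = Fin.last m then A * z i else z i)

/-- `f_k(x) = ∫ f(x̄ - 2^{-k} z̄, xₙ - A 2^{-k} zₙ) ω(z) dz`. -/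
def mollified {m : ℕ} {𝕜 : Type*} [RCLike 𝕜] (A : ℝ) (ω : Space m → ℝ) (f : Space m → 𝕜)
    (k : ℤ) (x : Space m) : 𝕜 :=
  ∫ z, ω z • f (x - (2 : ℝ) ^ (-k) • stretch A z)

open Classical in
/-- Burenkov's extension operator: `Tf = f` in `Ω`, `Tf = ∑_k ψ_k f_k` in `G`, where `A = 16 (M + 1)`.
On the null set `∂Ω` it is given the value `0`. -/
def burenkovExt {m : ℕ} {𝕜 : Type*} [RCLike 𝕜] (γ : EuclideanSpace ℝ (Fin m) → ℝ) (M : ℝ)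
    (ψ : ℤ → Space m → ℝ) (ω : Space m → ℝ) (f : Space m → 𝕜) (x : Space m) : 𝕜 :=
  if x ∈ subgraph γ then f x
  else if x ∈ exterior γ then ∑' k : ℤ, ψ k x • mollified (16 * (M + 1)) ω f k x
  else 0

end BurenkovMorrey

end

open BurenkovMorrey
open scoped ENNReal

/-! On the layer `G_j` only the `ψ_k` with `|k - j| ≤ 1` are non-zero, and there `f_k(x)` is an
average of `f(x - 2⁻ʲζ)` over shifts `ζ` of bounded length that descend by at least 4 relative to
the Lipschitz graph. Such a shift carries the layer into Ω, to a depth comparable with `2⁻ʲ`.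
Everything rests on an estimate for one fixed `ζ`, `exists_tsum_setLIntegral_shift_le`: the
integrals of `Φ(x - 2⁻ʲζ)` over the pieces `B_r ∩ G_j` sum to at most a constant times the largest
integral of `Φ` over balls of the same radius `r` centred in Ω. For `2⁻ʲ ≤ r` the shifted pieces
stay in a ball of radius comparable with `r` and overlap boundedly often, because the depth
determines `j` up to a bounded error. For `2⁻ʲ > r` only boundedly many layers meet the ball, and
each piece is merely translated. Hölder, Tonelli and Fatou extend the estimate to averages
(`exists_setLIntegral_rpow_le`). Since the radius is kept, the constant involves neither `φ` nor
`δ`, and (i) follows.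

For (ii), the derivative of `Tf` in `G` is the sum, over the splittings of `α` into `a` and `b`, of
`∑_k D^a ψ_k (D^b f)_k`. The term with `a` empty is treated as in (i). If `a` is not empty then `∑_k
D^a ψ_k = 0`, so `(D^b f)_j` may be subtracted from each `(D^b f)_k`. As the moments of `ω` vanish
up to order `l`, mollifications at all scales reproduce the same Taylor polynomial of order less
than `|a|`; the difference is therefore `2^{-j|a|}` times an average of derivatives of order exactly
`l`, and this factor cancels the growth of `D^a ψ_k` (`enorm_moll_sub_moll_le`,
`exists_enorm_bracketSum_le`). Taylor's formula is applied to auxiliary small mollifications of `f`,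
which is why these bounds are lower limits.

It remains to see that `∂Ω` contributes nothing to the distributional derivative. The smooth
functions `∑_{-N≤k<N} ψ_k f_k + (1 - ∑_{-N≤k<N} ψ_k) f_N` on the whole space are differentiated
classically, and the limit is taken against a test function (`integral_listDeriv_smul_ext`). -/

noncomputable section

namespace BurenkovMorrey

open MeasureTheory Set
open scoped ENNReal

/-! ### Derivatives along lists of coordinate directions -/

section ListDeriv

variable {n : ℕ} {V : Type*} [NormedAddCommGroup V] [NormedSpace ℝ V]

/-- The `i`-th partial derivative of a vector-valued function. -/
def coordDeriv (i : Fin n) (u : EuclideanSpace ℝ (Fin n) → V) : EuclideanSpace ℝ (Fin n) → V :=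
  fun x => fderiv ℝ u x (EuclideanSpace.single i 1)

/-- The iterated derivative along the list of coordinate directions `L`. -/
def listDeriv (L : List (Fin n)) (u : EuclideanSpace ℝ (Fin n) → V) :
    EuclideanSpace ℝ (Fin n) → V :=
  L.foldr coordDeriv u

@[simp] lemma listDeriv_nil (u : EuclideanSpace ℝ (Fin n) → V) : listDeriv [] u = u := rfl

lemma listDeriv_cons (i : Fin n) (L : List (Fin n)) (u : EuclideanSpace ℝ (Fin n) → V) :
    listDeriv (i :: L) u = coordDeriv i (listDeriv L u) := rfl

lemma listDeriv_append (L L' : List (Fin n)) (u : EuclideanSpace ℝ (Fin n) → V) :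
    listDeriv (L ++ L') u = listDeriv L (listDeriv L' u) := by
  simp [listDeriv, List.foldr_append]

lemma contDiff_coordDeriv {u : EuclideanSpace ℝ (Fin n) → V} (hu : ContDiff ℝ (⊤ : ℕ∞) u)
    (i : Fin n) : ContDiff ℝ (⊤ : ℕ∞) (coordDeriv i u) := by
  have h : ContDiff ℝ (⊤ : ℕ∞) (fderiv ℝ u) := hu.fderiv_right (by simp)
  exact h.clm_apply contDiff_const

lemma contDiff_listDeriv {u : EuclideanSpace ℝ (Fin n) → V} (hu : ContDiff ℝ (⊤ : ℕ∞) u)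
    (L : List (Fin n)) : ContDiff ℝ (⊤ : ℕ∞) (listDeriv L u) := by
  induction L with
  | nil => exact hu
  | cons i L ih => exact contDiff_coordDeriv ih i

lemma differentiable_of_smooth {u : EuclideanSpace ℝ (Fin n) → V}
    (hu : ContDiff ℝ (⊤ : ℕ∞) u) : Differentiable ℝ u :=
  hu.differentiable (by simp)

lemma coordDeriv_comm {u : EuclideanSpace ℝ (Fin n) → V} (hu : ContDiff ℝ (⊤ : ℕ∞) u)
    (i j : Fin n) : coordDeriv i (coordDeriv j u) = coordDeriv j (coordDeriv i u) := by
  funext x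
  have h : ContDiff ℝ (⊤ : ℕ∞) (fderiv ℝ u) := hu.fderiv_right (by simp)
  have hd : DifferentiableAt ℝ (fderiv ℝ u) x := h.differentiable (by simp) x
  have key : ∀ a b : EuclideanSpace ℝ (Fin n),
      fderiv ℝ (fun y => fderiv ℝ u y a) x b = fderiv ℝ (fderiv ℝ u) x b a := by
    intro a b
    rw [fderiv_clm_apply hd (differentiableAt_const a)]
    simp
  have hs : IsSymmSndFDerivAt ℝ u x :=
    hu.contDiffAt.isSymmSndFDerivAt (by
      rw [minSmoothness_of_isRCLikeNormedField]
      exact WithTop.coe_le_coe.2 le_top)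
  exact (key _ _).trans ((hs _ _).trans (key _ _).symm)

/-- By the symmetry of second derivatives a swap of neighbours is harmless. This links lists, on
which the Leibniz and Taylor formulas are inductions, with multi-indices. -/
lemma listDeriv_perm {u : EuclideanSpace ℝ (Fin n) → V} (hu : ContDiff ℝ (⊤ : ℕ∞) u)
    {L L' : List (Fin n)} (h : L.Perm L') : listDeriv L u = listDeriv L' u := by
  induction h with
  | nil => rfl
  | cons i _ ih => rw [listDeriv_cons, listDeriv_cons, ih]
  | swap i j L =>
    simp only [listDeriv_cons]
    exact coordDeriv_comm (contDiff_listDeriv hu L) _ _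
  | trans _ _ ih₁ ih₂ => exact ih₁.trans ih₂

/-- The list in which the direction `i` occurs `α i` times. -/
def multiList (α : Fin n → ℕ) : List (Fin n) :=
  (List.finRange n).flatMap fun i => List.replicate (α i) i

lemma foldr_replicate_iterate {X Y : Type*} (f : X → Y → Y) (k : ℕ) (i : X) (u : Y) :
    (List.replicate k i).foldr f u = (f i)^[k] u := by
  induction k with
  | zero => rfl
  | succ k ih => rw [List.replicate_succ, List.foldr_cons, ih, Function.iterate_succ_apply']

lemma multiDeriv_eq_listDeriv (α : Fin n → ℕ) (u : EuclideanSpace ℝ (Fin n) → ℝ) :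
    multiDeriv α u = listDeriv (multiList α) u := by
  unfold multiDeriv listDeriv multiList
  induction List.finRange n with
  | nil => rfl
  | cons i l ih =>
    rw [List.flatMap_cons, List.foldr_append, ← ih, List.foldr_cons, foldr_replicate_iterate]
    rfl

lemma count_multiList (α : Fin n → ℕ) (i : Fin n) : (multiList α).count i = α i := by
  unfold multiList
  rw [List.count_flatMap]
  have h : (List.count i ∘ fun j => List.replicate (α j) j) = fun j => if j = i then α j else 0 := by
    funext j
    simp [List.count_replicate]
  rw [h, ← List.ofFn_eq_map, List.sum_ofFn]
  simp

lemma length_eq_sum_count (L : List (Fin n)) : L.length = ∑ i, L.count i := by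
  induction L with
  | nil => simp
  | cons j L ih =>
    simp only [List.length_cons, List.count_cons, Finset.sum_add_distrib, ih]
    simp

lemma length_multiList (α : Fin n → ℕ) : (multiList α).length = order α := by
  rw [length_eq_sum_count]
  simp [count_multiList, order]

lemma order_count (L : List (Fin n)) : order (fun i => L.count i) = L.length :=
  (length_eq_sum_count L).symm

lemma perm_multiList_count (L : List (Fin n)) : L.Perm (multiList fun i => L.count i) := by
  rw [List.perm_iff_count]
  intro i
  rw [count_multiList]

lemma listDeriv_eq_multiDeriv {u : EuclideanSpace ℝ (Fin n) → ℝ} (hu : ContDiff ℝ (⊤ : ℕ∞) u)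
    (L : List (Fin n)) : listDeriv L u = multiDeriv (fun i => L.count i) u := by
  rw [multiDeriv_eq_listDeriv, listDeriv_perm hu (perm_multiList_count L)]

lemma listDeriv_finset_sum {ι : Type*} (s : Finset ι) (u : ι → EuclideanSpace ℝ (Fin n) → V)
    (hu : ∀ k ∈ s, ContDiff ℝ (⊤ : ℕ∞) (u k)) (L : List (Fin n)) :
    listDeriv L (fun x => ∑ k ∈ s, u k x) = fun x => ∑ k ∈ s, listDeriv L (u k) x := by
  induction L with
  | nil => rfl
  | cons i L ih =>
    funext x
    rw [listDeriv_cons, ih]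
    unfold coordDeriv
    rw [fderiv_fun_sum fun k hk => differentiable_of_smooth (contDiff_listDeriv (hu k hk) L) x]
    simp [listDeriv_cons, coordDeriv]

lemma listDeriv_const (c : V) {L : List (Fin n)} (hL : L ≠ []) :
    listDeriv L (fun _ : EuclideanSpace ℝ (Fin n) => c) = fun _ => 0 := by
  induction L with
  | nil => exact absurd rfl hL
  | cons i L ih =>
    rw [listDeriv_cons]
    by_cases h : L = []
    · subst h
      funext x
      simp [coordDeriv]
    · rw [ih h]
      funext x
      simp [coordDeriv]

lemma listDeriv_congr {u v : EuclideanSpace ℝ (Fin n) → V} {x : EuclideanSpace ℝ (Fin n)}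
    (h : u =ᶠ[nhds x] v) (L : List (Fin n)) : listDeriv L u =ᶠ[nhds x] listDeriv L v := by
  induction L with
  | nil => exact h
  | cons i L ih =>
    filter_upwards [ih.fderiv (𝕜 := ℝ)] with y hy
    simp only [listDeriv_cons, coordDeriv, hy]

lemma tsupport_listDeriv_subset (u : EuclideanSpace ℝ (Fin n) → V) (L : List (Fin n)) :
    tsupport (listDeriv L u) ⊆ tsupport u := by
  induction L with
  | nil => exact subset_rfl
  | cons i L ih =>
    refine closure_minimal ?_ (isClosed_tsupport u)
    intro x hx
    refine ih (support_fderiv_subset ℝ (f := listDeriv L u) ?_)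
    intro h0
    apply hx
    simp [listDeriv_cons, coordDeriv, h0]

lemma hasCompactSupport_listDeriv {u : EuclideanSpace ℝ (Fin n) → V} (hu : HasCompactSupport u)
    (L : List (Fin n)) : HasCompactSupport (listDeriv L u) :=
  IsCompact.of_isClosed_subset hu (isClosed_tsupport _) (tsupport_listDeriv_subset u L)

lemma listDeriv_comp_const_sub {u : EuclideanSpace ℝ (Fin n) → V}
    (hu : ContDiff ℝ (⊤ : ℕ∞) u) (x : EuclideanSpace ℝ (Fin n)) (L : List (Fin n)) :
    listDeriv L (fun y => u (x - y)) = fun y => (-1 : ℝ) ^ L.length • listDeriv L u (x - y) := by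
  induction L with
  | nil => simp
  | cons i L ih =>
    funext y
    rw [listDeriv_cons, ih]
    simp only [coordDeriv, listDeriv_cons, List.length_cons]
    have hd : Differentiable ℝ fun y => listDeriv L u (x - y) :=
      (differentiable_of_smooth (contDiff_listDeriv hu L)).comp (differentiable_id.const_sub x)
    have h := ((differentiable_of_smooth (contDiff_listDeriv hu L)) (x - y)).hasFDerivAt.comp y
      ((hasFDerivAt_id y).const_sub x)
    rw [fderiv_fun_const_smul (hd y),
      HasFDerivAt.fderiv (f := fun y => listDeriv L u (x - y)) h]
    simp [pow_succ]

/-- All ways of distributing the entries of a list over two lists. -/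
def splits : List (Fin n) → List (List (Fin n) × List (Fin n))
  | [] => [([], [])]
  | i :: L => ((splits L).map fun q => (i :: q.1, q.2)) ++ ((splits L).map fun q => (q.1, i :: q.2))

lemma length_add_length_of_mem_splits {L : List (Fin n)} {q : List (Fin n) × List (Fin n)}
    (hq : q ∈ splits L) : q.1.length + q.2.length = L.length := by
  induction L generalizing q with
  | nil =>
    simp only [splits, List.mem_singleton] at hq
    simp [hq]
  | cons i L ih =>
    simp only [splits, List.mem_append, List.mem_map] at hq
    rcases hq with ⟨a, ha, rfl⟩ | ⟨a, ha, rfl⟩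
    · have := ih ha
      simp only [List.length_cons]
      omega
    · have := ih ha
      simp only [List.length_cons]
      omega

/-- The pairs in `splits L` whose first component is not empty. -/
def properSplits : List (Fin n) → List (List (Fin n) × List (Fin n))
  | [] => []
  | i :: L => ((splits L).map fun q => (i :: q.1, q.2)) ++
      ((properSplits L).map fun q => (q.1, i :: q.2))

lemma ne_nil_of_mem_properSplits {L : List (Fin n)} {q : List (Fin n) × List (Fin n)}
    (hq : q ∈ properSplits L) : q.1 ≠ [] := by
  induction L generalizing q with
  | nil => simp [properSplits] at hq
  | cons i L ih =>
    simp only [properSplits, List.mem_append, List.mem_map] at hq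
    rcases hq with ⟨a, ha, rfl⟩ | ⟨a, ha, rfl⟩
    · simp
    · have h := ih ha
      exact h

-- Isolates the single Leibniz term without a derivative on the first factor. All other terms will
-- profit from `∑_k D^a ψ_k = 0`.
omit [NormedSpace ℝ V] in
lemma sum_splits (L : List (Fin n)) (φ : List (Fin n) × List (Fin n) → V) :
    ((splits L).map φ).sum = φ ([], L) + ((properSplits L).map φ).sum := by
  induction L generalizing φ with
  | nil => simp [splits, properSplits]
  | cons i L ih =>
    simp only [splits, properSplits, List.map_append, List.sum_append, List.map_map]
    rw [ih (φ ∘ fun q => (q.1, i :: q.2))]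
    simp only [Function.comp_apply]
    abel

lemma length_add_length_of_mem_properSplits {L : List (Fin n)}
    {q : List (Fin n) × List (Fin n)} (hq : q ∈ properSplits L) :
    q.1.length + q.2.length = L.length := by
  induction L generalizing q with
  | nil => simp [properSplits] at hq
  | cons i L ih =>
    simp only [properSplits, List.mem_append, List.mem_map] at hq
    rcases hq with ⟨a, ha, rfl⟩ | ⟨a, ha, rfl⟩
    · have := length_add_length_of_mem_splits ha
      simp only [List.length_cons]
      omega
    · have := ih ha
      simp only [List.length_cons]
      omega

lemma contDiff_list_sum {ι : Type*} (l : List ι) (u : ι → EuclideanSpace ℝ (Fin n) → V)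
    (hu : ∀ k ∈ l, ContDiff ℝ (⊤ : ℕ∞) (u k)) :
    ContDiff ℝ (⊤ : ℕ∞) (fun x => (l.map fun k => u k x).sum) := by
  induction l with
  | nil => simpa using contDiff_const
  | cons a l ih =>
    simp only [List.map_cons, List.sum_cons]
    exact (hu a (by simp)).add (ih fun k hk => hu k (by simp [hk]))

lemma coordDeriv_list_sum {ι : Type*} (l : List ι) (u : ι → EuclideanSpace ℝ (Fin n) → V)
    (hu : ∀ k ∈ l, ContDiff ℝ (⊤ : ℕ∞) (u k)) (i : Fin n) :
    coordDeriv i (fun x => (l.map fun k => u k x).sum) =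
      fun x => (l.map fun k => coordDeriv i (u k) x).sum := by
  induction l with
  | nil =>
    funext x
    simp [coordDeriv]
  | cons a l ih =>
    have hl : ∀ k ∈ l, ContDiff ℝ (⊤ : ℕ∞) (u k) := fun k hk => hu k (by simp [hk])
    funext x
    simp only [List.map_cons, List.sum_cons]
    rw [← congrFun (ih hl) x]
    unfold coordDeriv
    rw [fderiv_fun_add (differentiable_of_smooth (hu a (by simp)) x)
      (differentiable_of_smooth (contDiff_list_sum l u hl) x)]
    rfl

/-- The Leibniz formula. -/
lemma listDeriv_smul {c : EuclideanSpace ℝ (Fin n) → ℝ} {u : EuclideanSpace ℝ (Fin n) → V}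
    (hc : ContDiff ℝ (⊤ : ℕ∞) c) (hu : ContDiff ℝ (⊤ : ℕ∞) u) (L : List (Fin n)) :
    listDeriv L (fun x => c x • u x) =
      fun x => ((splits L).map fun q => listDeriv q.1 c x • listDeriv q.2 u x).sum := by
  induction L with
  | nil =>
    funext x
    simp [splits]
  | cons i L ih =>
    rw [listDeriv_cons, ih, coordDeriv_list_sum]
    · funext x
      have h : ∀ q : List (Fin n) × List (Fin n),
          coordDeriv i (fun x => listDeriv q.1 c x • listDeriv q.2 u x) x =
            listDeriv (i :: q.1) c x • listDeriv q.2 u x +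
              listDeriv q.1 c x • listDeriv (i :: q.2) u x := by
        intro q
        unfold coordDeriv
        rw [fderiv_fun_smul (differentiable_of_smooth (contDiff_listDeriv hc _) x)
          (differentiable_of_smooth (contDiff_listDeriv hu _) x)]
        simp [listDeriv_cons, coordDeriv, add_comm]
      simp only [h, splits, List.map_append, List.sum_append, List.map_map, List.sum_map_add]
      rfl
    · intro q _
      exact (contDiff_listDeriv hc _).smul (contDiff_listDeriv hu _)

/-- Integration by parts against a test function. -/
lemma integral_listDeriv_smul {η : EuclideanSpace ℝ (Fin n) → ℝ}
    {u : EuclideanSpace ℝ (Fin n) → V} (hη : ContDiff ℝ (⊤ : ℕ∞) η) (hc : HasCompactSupport η)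
    (hu : ContDiff ℝ (⊤ : ℕ∞) u) (L : List (Fin n)) :
    ∫ x, listDeriv L η x • u x = (-1 : ℝ) ^ L.length • ∫ x, η x • listDeriv L u x := by
  induction L generalizing u with
  | nil => simp
  | cons i L ih =>
    have hη' := contDiff_listDeriv hη L
    have hc' := hasCompactSupport_listDeriv hc L
    have int : ∀ {a : EuclideanSpace ℝ (Fin n) → ℝ} {b : EuclideanSpace ℝ (Fin n) → V},
        ContDiff ℝ (⊤ : ℕ∞) a → HasCompactSupport a → ContDiff ℝ (⊤ : ℕ∞) b →
        Integrable (fun x => a x • b x) := fun ha hca hb =>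
      (ha.continuous.smul hb.continuous).integrable_of_hasCompactSupport hca.smul_right
    have key : ∫ x, listDeriv (i :: L) η x • u x = - ∫ x, listDeriv L η x • coordDeriv i u x := by
      have := integral_smul_fderiv_eq_neg_fderiv_smul_of_integrable (μ := volume)
        (f := listDeriv L η) (g := u) (v := EuclideanSpace.single i 1)
        (int (contDiff_listDeriv hη (i :: L)) (hasCompactSupport_listDeriv hc (i :: L)) hu)
        (int hη' hc' (contDiff_coordDeriv hu i)) (int hη' hc' hu)
        (fun x _ => differentiable_of_smooth hη' x) (fun x _ => differentiable_of_smooth hu x)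
      rw [eq_neg_iff_add_eq_zero, add_comm, ← eq_neg_iff_add_eq_zero]
      exact this
    -- The induction hypothesis puts the new direction innermost, whereas the list has it outermost.
    have hswap : listDeriv L (coordDeriv i u) = listDeriv (i :: L) u := by
      have : listDeriv (L ++ [i]) u = listDeriv (i :: L) u :=
        listDeriv_perm hu (List.perm_append_singleton i L)
      rw [← this, listDeriv_append]
      rfl
    rw [key, ih (contDiff_coordDeriv hu i), hswap, List.length_cons, pow_succ]
    simp

end ListDeriv

/-! ### Geometry of the subgraph of a Lipschitz function -/

section Geometry

variable {m : ℕ}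

lemma norm_bar_le (x : Space m) : ‖bar x‖ ≤ ‖x‖ := by
  rw [EuclideanSpace.norm_eq, EuclideanSpace.norm_eq]
  apply Real.sqrt_le_sqrt
  rw [Fin.sum_univ_castSucc]
  simp only [bar]
  have : 0 ≤ ‖x (Fin.last m)‖ ^ 2 := by positivity
  linarith

lemma abs_last_le (x : Space m) : |x (Fin.last m)| ≤ ‖x‖ := by
  have := PiLp.norm_apply_le x (Fin.last m)
  simpa using this

lemma bar_sub (x y : Space m) : bar (x - y) = bar x - bar y := by
  ext i
  simp [bar]

lemma bar_add (x y : Space m) : bar (x + y) = bar x + bar y := by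
  ext i
  simp [bar]

lemma bar_smul (s : ℝ) (x : Space m) : bar (s • x) = s • bar x := by
  ext i
  simp [bar]

/-- The amount by which a translation by `-ζ` certainly decreases `ρₙ`. -/
def descent (M : ℝ) (ζ : Space m) : ℝ := ζ (Fin.last m) - M * ‖bar ζ‖

lemma descent_add_le {M : ℝ} (hM : 0 ≤ M) (ζ ξ : Space m) :
    descent M ζ + descent M ξ ≤ descent M (ζ + ξ) := by
  have h := mul_le_mul_of_nonneg_left (norm_add_le (bar ζ) (bar ξ)) hM
  simp only [descent, bar_add, PiLp.add_apply]
  linarith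

lemma descent_smul {M s : ℝ} (hs : 0 ≤ s) (ζ : Space m) :
    descent M (s • ζ) = s * descent M ζ := by
  simp only [descent, bar_smul, norm_smul, PiLp.smul_apply, smul_eq_mul, Real.norm_eq_abs,
    abs_of_nonneg hs]
  ring

variable {γ : EuclideanSpace ℝ (Fin m) → ℝ} {M : ℝ}

lemma rho_sub_le (hγ : ∀ x y, |γ x - γ y| ≤ M * ‖x - y‖) (x ζ : Space m) :
    rho γ (x - ζ) ≤ rho γ x - descent M ζ := by
  have h := (abs_le.1 (hγ (bar x) (bar (x - ζ)))).2
  have e : bar x - bar (x - ζ) = bar ζ := by rw [bar_sub]; abel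
  rw [e] at h
  simp only [rho, descent, PiLp.sub_apply]
  linarith

lemma abs_rho_sub_rho_le (hM : 0 ≤ M) (hγ : ∀ x y, |γ x - γ y| ≤ M * ‖x - y‖) (x y : Space m) :
    |rho γ x - rho γ y| ≤ (1 + M) * ‖x - y‖ := by
  have h := abs_le.1 (hγ (bar x) (bar y))
  have h1 := abs_le.1 (abs_last_le (x - y))
  have h2 := mul_le_mul_of_nonneg_left (norm_bar_le (x - y)) hM
  rw [bar_sub] at h2
  simp only [PiLp.sub_apply] at h1
  rw [abs_le]
  simp only [rho]
  constructor <;> linarith [h.1, h.2, h1.1, h1.2]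

lemma continuous_rho (hM : 0 ≤ M) (hγ : ∀ x y, |γ x - γ y| ≤ M * ‖x - y‖) :
    Continuous (rho γ : Space m → ℝ) := by
  have : LipschitzWith (Real.toNNReal (1 + M)) (rho γ : Space m → ℝ) := by
    apply LipschitzWith.of_dist_le_mul
    intro x y
    rw [Real.dist_eq, dist_eq_norm, Real.coe_toNNReal _ (by linarith)]
    exact abs_rho_sub_rho_le hM hγ x y
  exact this.continuous

lemma mem_subgraph_iff {x : Space m} : x ∈ subgraph γ ↔ rho γ x < 0 := by
  simp [subgraph, rho]

lemma isOpen_subgraph (hM : 0 ≤ M) (hγ : ∀ x y, |γ x - γ y| ≤ M * ‖x - y‖) :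
    IsOpen (subgraph γ : Set (Space m)) := by
  have : (subgraph γ : Set (Space m)) = rho γ ⁻¹' Iio 0 := by
    ext x
    exact mem_subgraph_iff
  rw [this]
  exact isOpen_Iio.preimage (continuous_rho hM hγ)

lemma rho_add_smul_last (x : Space m) (s : ℝ) :
    rho γ (x + s • EuclideanSpace.single (Fin.last m) 1) = rho γ x + s := by
  have : bar (x + s • EuclideanSpace.single (Fin.last m) (1 : ℝ)) = bar x := by
    ext i
    simp [bar]
  simp only [rho, this]
  simp
  ring

lemma mem_exterior_iff (hM : 0 ≤ M) (hγ : ∀ x y, |γ x - γ y| ≤ M * ‖x - y‖) {x : Space m} :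
    x ∈ exterior γ ↔ 0 < rho γ x := by
  have hc := continuous_rho hM hγ
  rw [exterior, mem_compl_iff, ← not_le, not_iff_not]
  constructor
  · intro hx
    have hcl : IsClosed {y : Space m | rho γ y ≤ 0} := isClosed_le hc continuous_const
    exact closure_minimal (fun y hy => (mem_subgraph_iff.1 hy).le) hcl hx
  · intro hx
    -- A point with `ρₙ ≤ 0` is reached from inside Ω by moving vertically upwards.
    have ht : Filter.Tendsto
        (fun s : ℝ => x + s • EuclideanSpace.single (Fin.last m) (1 : ℝ)) (nhdsWithin 0 (Iio 0))
        (nhds x) := by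
      have : Continuous fun s : ℝ => x + s • EuclideanSpace.single (Fin.last m) (1 : ℝ) := by
        fun_prop
      have h := this.tendsto 0
      simp only [zero_smul, add_zero] at h
      exact h.mono_left nhdsWithin_le_nhds
    refine mem_closure_of_tendsto ht ?_
    filter_upwards [self_mem_nhdsWithin] with s hs
    rw [mem_subgraph_iff, rho_add_smul_last]
    have : s < 0 := hs
    linarith

lemma isOpen_exterior : IsOpen (exterior γ : Set (Space m)) :=
  isClosed_closure.isOpen_compl

lemma mem_layer_iff (hM : 0 ≤ M) (hγ : ∀ x y, |γ x - γ y| ≤ M * ‖x - y‖) {x : Space m} {k : ℤ} :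
    x ∈ layer γ k ↔ (2 : ℝ) ^ (-k - 1) < rho γ x ∧ rho γ x ≤ (2 : ℝ) ^ (-k) := by
  constructor
  · exact fun h => h.2
  · intro h
    refine ⟨(mem_exterior_iff hM hγ).2 (lt_trans (by positivity) h.1), h⟩

lemma measurableSet_layer (hM : 0 ≤ M) (hγ : ∀ x y, |γ x - γ y| ≤ M * ‖x - y‖) (k : ℤ) :
    MeasurableSet (layer γ k : Set (Space m)) := by
  have : (layer γ k : Set (Space m)) = rho γ ⁻¹' Ioc ((2 : ℝ) ^ (-k - 1)) ((2 : ℝ) ^ (-k)) := by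
    ext x
    exact mem_layer_iff hM hγ
  rw [this]
  exact (continuous_rho hM hγ).measurable measurableSet_Ioc

lemma eq_of_mem_layer {x : Space m} {j k : ℤ} (hj : x ∈ layer γ j) (hk : x ∈ layer γ k) :
    j = k := by
  have key : ∀ a b : ℤ, x ∈ layer γ a → x ∈ layer γ b → a ≤ b := by
    intro a b ha hb
    by_contra! h
    have h1 : (2 : ℝ) ^ (-a) ≤ (2 : ℝ) ^ (-b - 1) :=
      zpow_le_zpow_right₀ one_le_two (by omega)
    exact absurd (lt_of_lt_of_le hb.2.1 ha.2.2) (not_lt.2 h1)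
  exact le_antisymm (key _ _ hj hk) (key _ _ hk hj)

lemma exists_mem_layer (hM : 0 ≤ M) (hγ : ∀ x y, |γ x - γ y| ≤ M * ‖x - y‖) {x : Space m}
    (hx : x ∈ exterior γ) : ∃ j, x ∈ layer γ j := by
  obtain ⟨j, hj⟩ := exists_mem_Ioc_zpow ((mem_exterior_iff hM hγ).1 hx) (one_lt_two (α := ℝ))
  refine ⟨-(j + 1), hx, ?_, ?_⟩
  · have : -(-(j + 1)) - 1 = j := by ring
    rw [this]
    exact hj.1
  · rw [neg_neg]
    exact hj.2

/-- The shifts that carry the layer of index `j`, after multiplication by `2⁻ʲ`, into `Ω`. -/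
def admissibleShifts (M R : ℝ) : Set (Space m) := {ζ | ‖ζ‖ ≤ R ∧ 4 ≤ descent M ζ}

/-- A descent of 4 against `ρₙ ≤ 2⁻ʲ` leaves a depth of `3·2⁻ʲ`. Together with the opposite bound
`neg_le_rho_sub_shift`, the depth of the image determines `j` up to a bounded error. -/
lemma rho_sub_shift_le (hγ : ∀ x y, |γ x - γ y| ≤ M * ‖x - y‖) {R : ℝ} {x ζ : Space m} {j : ℤ}
    (hx : rho γ x ≤ (2 : ℝ) ^ (-j)) (hζ : ζ ∈ admissibleShifts M R) :
    rho γ (x - (2 : ℝ) ^ (-j) • ζ) ≤ -(3 * (2 : ℝ) ^ (-j)) := by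
  have h2 : (0 : ℝ) < (2 : ℝ) ^ (-j) := by positivity
  have h := rho_sub_le hγ x ((2 : ℝ) ^ (-j) • ζ)
  rw [descent_smul h2.le] at h
  have := mul_le_mul_of_nonneg_left hζ.2 h2.le
  linarith

lemma sub_shift_mem_subgraph (hγ : ∀ x y, |γ x - γ y| ≤ M * ‖x - y‖) {R : ℝ} {x ζ : Space m}
    {j : ℤ} (hx : rho γ x ≤ (2 : ℝ) ^ (-j)) (hζ : ζ ∈ admissibleShifts M R) :
    x - (2 : ℝ) ^ (-j) • ζ ∈ subgraph γ := by
  have h2 : (0 : ℝ) < (2 : ℝ) ^ (-j) := by positivity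
  have := rho_sub_shift_le hγ hx hζ
  rw [mem_subgraph_iff]
  linarith

lemma neg_le_rho_sub_shift (hM : 0 ≤ M) (hγ : ∀ x y, |γ x - γ y| ≤ M * ‖x - y‖) {R : ℝ}
    {x ζ : Space m} {j : ℤ} (hx : 0 ≤ rho γ x) (hζ : ‖ζ‖ ≤ R) :
    -((1 + M) * R * (2 : ℝ) ^ (-j)) ≤ rho γ (x - (2 : ℝ) ^ (-j) • ζ) := by
  have h2 : (0 : ℝ) < (2 : ℝ) ^ (-j) := by positivity
  have h := (abs_le.1 (abs_rho_sub_rho_le hM hγ x (x - (2 : ℝ) ^ (-j) • ζ))).2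
  have e : x - (x - (2 : ℝ) ^ (-j) • ζ) = (2 : ℝ) ^ (-j) • ζ := by abel
  rw [e, norm_smul, Real.norm_of_nonneg h2.le] at h
  have h3 : (1 + M) * ((2 : ℝ) ^ (-j) * ‖ζ‖) ≤ (1 + M) * ((2 : ℝ) ^ (-j) * R) := by gcongr
  linarith

lemma stretch_apply (A : ℝ) (z : Space m) (i : Fin (m + 1)) :
    stretch A z i = if i = Fin.last m then A * z i else z i := rfl

lemma bar_stretch (A : ℝ) (z : Space m) : bar (stretch A z) = bar z := by
  ext i
  simp [bar, stretch_apply]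

lemma norm_stretch_le {A : ℝ} (hA : 1 ≤ A) (z : Space m) : ‖stretch A z‖ ≤ A * ‖z‖ := by
  rw [EuclideanSpace.norm_eq, EuclideanSpace.norm_eq]
  apply Real.sqrt_le_iff.2
  refine ⟨by positivity, ?_⟩
  rw [mul_pow, Real.sq_sqrt (by positivity), Finset.mul_sum]
  apply Finset.sum_le_sum
  intro i _
  rw [stretch_apply, ← mul_pow]
  split_ifs
  · rw [norm_mul, Real.norm_of_nonneg (by linarith)]
  · gcongr
    nlinarith [norm_nonneg (z i)]

/-- The closed region in which the supports of the kernels lie. -/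
def kernelRegion (m : ℕ) : Set (Space m) :=
  {x | x ∈ Metric.closedBall 0 1 ∧ 1 / 2 ≤ x (Fin.last m)}

/-- `16(M+1)zₙ ≥ 8(M+1)` while `M‖z̄‖ ≤ M`. The value 8, twice the required 4, leaves room for the
scale `2⁻ᵏ = 2⁻ʲ/2` of the neighbour `k = j + 1`. -/
lemma eight_le_descent_stretch (hM : 0 ≤ M) {z : Space m} (hz : z ∈ kernelRegion m) :
    8 ≤ descent M (stretch (16 * (M + 1)) z) := by
  have h1 : ‖bar z‖ ≤ 1 := (norm_bar_le z).trans (by simpa using hz.1)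
  have h2 := hz.2
  rw [descent, bar_stretch, stretch_apply, if_pos rfl]
  nlinarith

lemma norm_stretch_kernelRegion_le (hM : 0 ≤ M) {z : Space m} (hz : z ∈ kernelRegion m) :
    ‖stretch (16 * (M + 1)) z‖ ≤ 16 * (M + 1) := by
  have h1 : ‖z‖ ≤ 1 := by simpa using hz.1
  have h2 := norm_stretch_le (A := 16 * (M + 1)) (by linarith) z
  nlinarith

end Geometry

/-! ### Local integral estimates for averages of shifts -/

section Averages

lemma lintegral_finset_biUnion_le {α ι : Type*} [MeasurableSpace α] {μ : Measure α} (t : Finset ι)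
    (s : ι → Set α) (Φ : α → ℝ≥0∞) :
    ∫⁻ x in ⋃ c ∈ t, s c, Φ x ∂μ ≤ ∑ c ∈ t, ∫⁻ x in s c, Φ x ∂μ := by
  classical
  induction t using Finset.induction_on with
  | empty => simp
  | insert a t ha ih =>
    rw [Finset.set_biUnion_insert, Finset.sum_insert ha]
    exact (lintegral_union_le _ _ _).trans (add_le_add le_rfl ih)

/-- The hypothesis may be used with either order of the two indices, so all non-zero terms lie
within `q` of any one of them. -/
lemma tsum_le_of_close {a : ℤ → ℝ≥0∞} {B : ℝ≥0∞} {q : ℕ} (hB : ∀ j, a j ≤ B)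
    (hq : ∀ j j', a j ≠ 0 → a j' ≠ 0 → j' - j ≤ q) : ∑' j, a j ≤ (2 * q + 1 : ℕ) * B := by
  by_cases h : ∃ j, a j ≠ 0
  · obtain ⟨j₀, hj₀⟩ := h
    rw [tsum_eq_sum (s := Finset.Icc (j₀ - q) (j₀ + q))]
    · refine (Finset.sum_le_card_nsmul _ _ B fun j _ => hB j).trans ?_
      rw [nsmul_eq_mul, Int.card_Icc]
      gcongr
      omega
    · intro j hj
      by_contra hne
      apply hj
      have h1 := hq _ _ hj₀ hne
      have h2 := hq _ _ hne hj₀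
      rw [Finset.mem_Icc]
      omega
  · push Not at h
    simp [h]

/-- Hölder's inequality against the constant 1, for a measure of arbitrary mass. -/
lemma lintegral_rpow_le_measure_univ {α : Type*} [MeasurableSpace α] (ν : Measure α) {p : ℝ}
    (hp : 1 ≤ p) {h : α → ℝ≥0∞} (hh : Measurable h) :
    (∫⁻ a, h a ∂ν) ^ p ≤ ν univ ^ (p - 1) * ∫⁻ a, h a ^ p ∂ν := by
  have hp0 : 0 < p := by linarith
  have key := eLpNorm'_le_eLpNorm'_mul_rpow_measure_univ (μ := ν) one_pos hp
    (f := h) hh.aestronglyMeasurable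
  simp only [eLpNorm', enorm_eq_self, ENNReal.rpow_one, div_one] at key
  have h2 := ENNReal.rpow_le_rpow key hp0.le
  rw [ENNReal.mul_rpow_of_nonneg _ _ hp0.le, ← ENNReal.rpow_mul, ← ENNReal.rpow_mul] at h2
  have e1 : 1 / p * p = 1 := by field_simp
  have e2 : (1 - 1 / p) * p = p - 1 := by field_simp
  rw [e1, e2, ENNReal.rpow_one, mul_comm] at h2
  exact h2

variable {E : Type*} [NormedAddCommGroup E] [NormedSpace ℝ E] [FiniteDimensional ℝ E]
  [MeasurableSpace E] [BorelSpace E]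

omit [NormedSpace ℝ E] [FiniteDimensional ℝ E] in
lemma setLIntegral_sub_le (μ : Measure E) [μ.IsAddRightInvariant] {s t : Set E}
    (hs : MeasurableSet s) (ht : MeasurableSet t) (w : E) (hst : ∀ x ∈ s, x - w ∈ t) (Φ : E → ℝ≥0∞) :
    ∫⁻ x in s, Φ (x - w) ∂μ ≤ ∫⁻ x in t, Φ x ∂μ := by
  calc ∫⁻ x in s, Φ (x - w) ∂μ = ∫⁻ x in s, t.indicator Φ (x - w) ∂μ := by
        refine setLIntegral_congr_fun hs fun x hx => ?_
        simp [indicator_of_mem (hst x hx)]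
    _ ≤ ∫⁻ x, t.indicator Φ (x - w) ∂μ := setLIntegral_le_lintegral _ _
    _ = ∫⁻ x, t.indicator Φ x ∂μ := lintegral_sub_right_eq_self _ w
    _ = ∫⁻ x in t, Φ x ∂μ := lintegral_indicator ht _

-- The large ball is covered by balls of radius `r/2`. One that meets Ω lies in the ball of radius
-- `r` about any of its points in Ω, so only balls centred in Ω are needed. By scaling, their number
-- does not depend on `r`.
omit [BorelSpace E] in
lemma exists_setLIntegral_ball_le (μ : Measure E) (κ : ℝ) : ∃ N : ℕ, ∀ (Ω : Set E) (Φ : E → ℝ≥0∞) (r : ℝ),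
    0 < r → ∀ (x₀ : E) (T : ℝ≥0∞), (∀ y ∈ Ω, ∫⁻ x in Metric.ball y r ∩ Ω, Φ x ∂μ ≤ T) →
      ∫⁻ x in Metric.ball x₀ (κ * r) ∩ Ω, Φ x ∂μ ≤ N * T := by
  obtain ⟨t, -, ht⟩ := (isCompact_closedBall (0 : E) κ).elim_nhds_subcover
    (fun c => Metric.ball c (1 / 2)) fun c _ => Metric.ball_mem_nhds c (by norm_num)
  refine ⟨t.card, fun Ω Φ r hr x₀ T hT => ?_⟩
  have hcov : Metric.ball x₀ (κ * r) ∩ Ω ⊆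
      ⋃ c ∈ t, Metric.ball (x₀ + r • c) (r / 2) ∩ Ω := by
    rintro x ⟨hx, hxΩ⟩
    have hx' : r⁻¹ • (x - x₀) ∈ Metric.closedBall (0 : E) κ := by
      rw [mem_closedBall_zero_iff, norm_smul, Real.norm_of_nonneg (by positivity)]
      rw [Metric.mem_ball, dist_eq_norm] at hx
      rw [inv_mul_le_iff₀ hr]
      linarith
    obtain ⟨c, hc, hxc⟩ := mem_iUnion₂.1 (ht hx')
    refine mem_iUnion₂.2 ⟨c, hc, ?_, hxΩ⟩
    rw [Metric.mem_ball, dist_eq_norm] at hxc ⊢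
    have e : x - (x₀ + r • c) = r • (r⁻¹ • (x - x₀) - c) := by
      rw [smul_sub, smul_smul, mul_inv_cancel₀ hr.ne', one_smul]
      abel
    rw [e, norm_smul, Real.norm_of_nonneg hr.le]
    nlinarith
  calc ∫⁻ x in Metric.ball x₀ (κ * r) ∩ Ω, Φ x ∂μ
      ≤ ∫⁻ x in ⋃ c ∈ t, Metric.ball (x₀ + r • c) (r / 2) ∩ Ω, Φ x ∂μ := lintegral_mono_set hcov
    _ ≤ ∑ c ∈ t, ∫⁻ x in Metric.ball (x₀ + r • c) (r / 2) ∩ Ω, Φ x ∂μ :=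
        lintegral_finset_biUnion_le t _ _
    _ ≤ t.card • T := by
        refine Finset.sum_le_card_nsmul _ _ _ fun c _ => ?_
        rcases (Metric.ball (x₀ + r • c) (r / 2) ∩ Ω).eq_empty_or_nonempty with h | ⟨y, hy, hyΩ⟩
        · simp [h]
        · refine (lintegral_mono_set ?_).trans (hT y hyΩ)
          rintro x ⟨hx, hxΩ⟩
          refine ⟨?_, hxΩ⟩
          rw [Metric.mem_ball] at hx hy ⊢
          have := dist_triangle_right x y (x₀ + r • c)
          linarith
    _ = t.card * T := nsmul_eq_mul _ _

end Averages

/-! ### Shifts of the layers into the subgraph. -/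

section LayerAverages

variable {m : ℕ} {γ : EuclideanSpace ℝ (Fin m) → ℝ} {M : ℝ}

lemma zpow_neg_sub_le {j j' : ℤ} {C : ℝ} {q : ℕ} (hC : C ≤ 2 ^ q)
    (h : (2 : ℝ) ^ (-j) ≤ C * 2 ^ (-j')) : j' - j ≤ q := by
  have h1 : (2 : ℝ) ^ (j' - j) ≤ 2 ^ (q : ℤ) := by
    have e : (2 : ℝ) ^ (j' - j) = 2 ^ (-j) * 2 ^ j' := by
      rw [← zpow_add₀ two_ne_zero]
      congr 1
      ring
    have e2 : (2 : ℝ) ^ (-j') * 2 ^ j' = 1 := by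
      rw [← zpow_add₀ two_ne_zero]
      simp
    calc (2 : ℝ) ^ (j' - j) = 2 ^ (-j) * 2 ^ j' := e
      _ ≤ C * 2 ^ (-j') * 2 ^ j' := by gcongr
      _ = C := by rw [mul_assoc, e2, mul_one]
      _ ≤ 2 ^ (q : ℤ) := by exact_mod_cast hC
  exact (zpow_le_zpow_iff_right₀ one_lt_two).1 h1

lemma exists_tsum_setLIntegral_shift_le (hM : 0 ≤ M) (hγ : ∀ x y, |γ x - γ y| ≤ M * ‖x - y‖)
    {R : ℝ} (hR : 0 ≤ R) : ∃ C : ℕ, ∀ ζ ∈ admissibleShifts (m := m) M R,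
      ∀ Φ : Space m → ℝ≥0∞, Measurable Φ → ∀ r, 0 < r → ∀ (x₀ : Space m) (T : ℝ≥0∞),
      (∀ y ∈ subgraph γ, ∫⁻ x in Metric.ball y r ∩ subgraph γ, Φ x ≤ T) →
      ∑' j : ℤ, ∫⁻ x in Metric.ball x₀ r ∩ layer γ j, Φ (x - (2 : ℝ) ^ (-j) • ζ) ≤ C * T := by
  obtain ⟨N, hN⟩ := exists_setLIntegral_ball_le (volume : Measure (Space m)) (1 + R)
  -- Bounds the spread of the indices `j` for which a given point has depth between `3·2⁻ʲ` and
  -- `(1+M)R·2⁻ʲ`.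
  obtain ⟨q₁, hq₁⟩ := pow_unbounded_of_one_lt ((1 + M) * R / 3) (one_lt_two (α := ℝ))
  -- Bounds the spread of the coarse layers met by one ball. If `r < 2^{-j'}`, then `ρₙ` varies by
  -- at most `2(1+M)r` over the ball, so `2⁻ʲ/2 ≤ 2^{-j'} + 2(1+M)2^{-j'}`.
  obtain ⟨q₂, hq₂⟩ := pow_unbounded_of_one_lt (2 * (3 + 2 * M)) (one_lt_two (α := ℝ))
  refine ⟨(2 * q₁ + 1) * N + (2 * q₂ + 1) * N, ?_⟩
  intro ζ hζ Φ hΦ r hr x₀ T hT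
  have hN' : ∀ y, ∫⁻ x in Metric.ball y ((1 + R) * r) ∩ subgraph γ, Φ x ≤ N * T :=
    fun y => hN _ Φ r hr y T hT
  have hmΩ := (isOpen_subgraph hM hγ).measurableSet
  set a : ℤ → ℝ≥0∞ :=
    fun j => ∫⁻ x in Metric.ball x₀ r ∩ layer γ j, Φ (x - (2 : ℝ) ^ (-j) • ζ) with ha
  have hml : ∀ j : ℤ, MeasurableSet (Metric.ball x₀ r ∩ layer γ j) := fun j =>
    measurableSet_ball.inter (measurableSet_layer hM hγ j)
  let S : ℤ → Set (Space m) := fun j =>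
    {y | 3 * (2 : ℝ) ^ (-j) ≤ -rho γ y ∧ -rho γ y ≤ (1 + M) * R * (2 : ℝ) ^ (-j)}
  have hS : ∀ j, MeasurableSet (S j) := by
    intro j
    have hc := (continuous_rho (m := m) hM hγ).neg
    exact ((isClosed_le continuous_const hc).inter (isClosed_le hc continuous_const)).measurableSet
  have hmaps : ∀ j, ∀ x ∈ Metric.ball x₀ r ∩ layer γ j,
      x - (2 : ℝ) ^ (-j) • ζ ∈ subgraph γ ∩ S j := by
    intro j x hx
    refine ⟨sub_shift_mem_subgraph hγ hx.2.2.2 hζ, ?_, ?_⟩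
    · have := rho_sub_shift_le hγ hx.2.2.2 hζ
      linarith
    · have := neg_le_rho_sub_shift hM hγ ((mem_exterior_iff hM hγ).1 hx.2.1).le hζ.1 (j := j)
      linarith
  -- Fine layers: the shift has length at most `Rr`, so all images lie in one ball about `x₀`, and
  -- their bounded overlap allows the sum to be taken under the integral.
  have hfine : ∑' j, (if (2 : ℝ) ^ (-j) ≤ r then a j else 0) ≤ (2 * q₁ + 1 : ℕ) * (N * T) := by
    have h1 : ∀ j, (if (2 : ℝ) ^ (-j) ≤ r then a j else 0) ≤
        ∫⁻ x in Metric.ball x₀ ((1 + R) * r) ∩ subgraph γ, (S j).indicator Φ x := by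
      intro j
      split_ifs with hj
      · have hst := setLIntegral_sub_le volume (hml j)
          ((measurableSet_ball (x := x₀) (ε := (1 + R) * r)).inter (hmΩ.inter (hS j)))
          ((2 : ℝ) ^ (-j) • ζ) ?_ Φ
        · refine hst.trans_eq ?_
          rw [setLIntegral_indicator (hS j)]
          congr 2
          ext x
          simp only [mem_inter_iff]
          tauto
        · intro x hx
          refine ⟨?_, hmaps j x hx⟩
          have hx1 := hx.1
          rw [Metric.mem_ball, dist_eq_norm] at hx1 ⊢
          have e : x - (2 : ℝ) ^ (-j) • ζ - x₀ = (x - x₀) - (2 : ℝ) ^ (-j) • ζ := by abel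
          rw [e]
          refine (norm_sub_le _ _).trans_lt ?_
          rw [norm_smul, Real.norm_of_nonneg (by positivity)]
          have : (2 : ℝ) ^ (-j) * ‖ζ‖ ≤ r * R :=
            mul_le_mul hj hζ.1 (norm_nonneg _) hr.le
          linarith
      · exact zero_le
    refine (ENNReal.tsum_le_tsum h1).trans ?_
    rw [← lintegral_tsum fun j => (hΦ.indicator (hS j)).aemeasurable]
    have h2 : ∀ x, ∑' j, (S j).indicator Φ x ≤ (2 * q₁ + 1 : ℕ) * Φ x := by
      intro x
      refine tsum_le_of_close (fun j => indicator_le_self _ _ _) ?_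
      intro j j' hj hj'
      have hxj : x ∈ S j := mem_of_indicator_ne_zero hj
      have hxj' : x ∈ S j' := mem_of_indicator_ne_zero hj'
      refine zpow_neg_sub_le hq₁.le ?_
      have := hxj.1.trans hxj'.2
      linarith
    refine (lintegral_mono h2).trans ?_
    rw [lintegral_const_mul _ hΦ]
    gcongr
    exact hN' x₀
  -- Coarse layers: the images may be far from each other, but boundedly many occur and each lies in
  -- a translate of the ball.
  have hcoarse : ∑' j, (if (2 : ℝ) ^ (-j) ≤ r then 0 else a j) ≤ (2 * q₂ + 1 : ℕ) * (N * T) := by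
    refine tsum_le_of_close ?_ ?_
    · intro j
      split_ifs
      · exact zero_le
      · refine (setLIntegral_sub_le volume (hml j) ((measurableSet_ball
          (x := x₀ - (2 : ℝ) ^ (-j) • ζ) (ε := (1 + R) * r)).inter hmΩ)
          ((2 : ℝ) ^ (-j) • ζ) ?_ Φ).trans (hN' _)
        intro x hx
        refine ⟨?_, (hmaps j x hx).1⟩
        have hx1 := hx.1
        rw [Metric.mem_ball] at hx1 ⊢
        rw [dist_sub_right]
        nlinarith
    · intro j j' hj hj'
      have h1 : ∀ i : ℤ, (if (2 : ℝ) ^ (-i) ≤ r then 0 else a i) ≠ 0 →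
          r < (2 : ℝ) ^ (-i) ∧ ∃ x, x ∈ Metric.ball x₀ r ∩ layer γ i := by
        intro i hi
        split_ifs at hi with h
        · exact absurd rfl hi
        · refine ⟨not_le.1 h, ?_⟩
          by_contra hne
          apply hi
          have : Metric.ball x₀ r ∩ layer γ i = ∅ :=
            Set.eq_empty_iff_forall_notMem.2 fun x hx => hne ⟨x, hx⟩
          simp [ha, this]
      obtain ⟨-, x, hx, hxj⟩ := h1 j hj
      obtain ⟨hr', x', hx', hxj'⟩ := h1 j' hj'
      refine zpow_neg_sub_le hq₂.le ?_
      have h2 := (abs_le.1 (abs_rho_sub_rho_le hM hγ x x')).2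
      rw [Metric.mem_ball] at hx hx'
      have h3 : ‖x - x'‖ ≤ 2 * r := by
        rw [← dist_eq_norm]
        have := dist_triangle_right x x' x₀
        linarith
      have h4 := hxj.2.1
      have h5 := hxj'.2.2
      have e : (2 : ℝ) ^ (-j - 1) = 2 ^ (-j) / 2 := by
        rw [zpow_sub_one₀ two_ne_zero]
        ring
      rw [e] at h4
      nlinarith
  have hsplit : ∑' j, a j = ∑' j, (if (2 : ℝ) ^ (-j) ≤ r then a j else 0) +
      ∑' j, (if (2 : ℝ) ^ (-j) ≤ r then 0 else a j) := by
    rw [← ENNReal.tsum_add]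
    congr 1
    funext j
    split_ifs <;> simp
  rw [hsplit]
  refine (add_le_add hfine hcoarse).trans_eq ?_
  push_cast
  ring

lemma measurable_lintegral_shift {Θ : Space m → ℝ≥0∞} (hΘ : Measurable Θ) (s : ℝ)
    (ν : Measure (Space m)) [SFinite ν] : Measurable fun x => ∫⁻ ζ, Θ (x - s • ζ) ∂ν := by
  have h : Measurable fun q : Space m × Space m => Θ (q.1 - s • q.2) := hΘ.comp (by fun_prop)
  exact h.lintegral_prod_right'

/-- The `Lᵖ` norm over a ball of a function controlled on the layers by averages of shifts of `Θ`
is controlled by the `Lᵖ` norms of `Θ` over balls of the same radius. -/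
lemma exists_setLIntegral_rpow_le (hM : 0 ≤ M) (hγ : ∀ x y, |γ x - γ y| ≤ M * ‖x - y‖)
    {R : ℝ} (hR : 0 ≤ R) : ∃ C : ℕ, ∀ p : ℝ, 1 ≤ p → ∀ W : ℝ≥0∞, W ≠ ∞ →
      ∀ ν : ℕ → Measure (Space m), (∀ N, ν N univ ≤ W) →
      (∀ N, ∀ᵐ ζ ∂(ν N), ζ ∈ admissibleShifts M R) →
      ∀ Θ : Space m → ℝ≥0∞, Measurable Θ → ∀ u : Space m → ℝ≥0∞,
      (∀ j, ∀ x ∈ layer γ j,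
        u x ≤ Filter.liminf (fun N => ∫⁻ ζ, Θ (x - (2 : ℝ) ^ (-j) • ζ) ∂(ν N)) Filter.atTop) →
      ∀ r, 0 < r → ∀ (x₀ : Space m) (T : ℝ≥0∞),
      (∀ y ∈ subgraph γ, ∫⁻ x in Metric.ball y r ∩ subgraph γ, Θ x ^ p ≤ T) →
      ∫⁻ x in Metric.ball x₀ r ∩ exterior γ, u x ^ p ≤ C * W ^ p * T := by
  obtain ⟨C, hC⟩ := exists_tsum_setLIntegral_shift_le (m := m) hM hγ hR
  refine ⟨C, ?_⟩
  intro p hp W hW ν hνW hν Θ hΘ u hu r hr x₀ T hT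
  have hp0 : 0 < p := by linarith
  have hfin : ∀ N, IsFiniteMeasure (ν N) := fun N =>
    ⟨(hνW N).trans_lt (lt_top_iff_ne_top.2 hW)⟩
  have hml := measurableSet_layer (m := m) hM hγ
  let I : ℕ → ℤ → Space m → ℝ≥0∞ := fun N j x => (∫⁻ ζ, Θ (x - (2 : ℝ) ^ (-j) • ζ) ∂(ν N)) ^ p
  have hI : ∀ N j, Measurable (I N j) := fun N j =>
    (measurable_lintegral_shift hΘ _ (ν N)).pow_const p
  let v : ℕ → Space m → ℝ≥0∞ := fun N x => ∑' j, (layer γ j).indicator (I N j) x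
  have hv : ∀ N, Measurable (v N) := fun N =>
    Measurable.tsum fun j => (hI N j).indicator (hml j)
  -- The layers are disjoint, so a single term of `v N x` survives; the `p`-th power, being
  -- continuous and increasing, commutes with the lower limit.
  have huv : ∀ x ∈ Metric.ball x₀ r ∩ exterior γ,
      u x ^ p ≤ Filter.liminf (fun N => v N x) Filter.atTop := by
    rintro x ⟨-, hx⟩
    obtain ⟨j, hj⟩ := exists_mem_layer hM hγ hx
    have hvx : ∀ N, v N x = I N j x := by
      intro N
      simp only [v]
      rw [tsum_eq_single j]
      · exact indicator_of_mem hj _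
      · intro k hk
        exact indicator_of_notMem (fun h => hk (eq_of_mem_layer h hj)) _
    simp only [hvx]
    refine (ENNReal.rpow_le_rpow (hu j x hj) hp0.le).trans_eq ?_
    exact (ENNReal.monotone_rpow_of_nonneg hp0.le).map_liminf_of_continuousAt _
      ENNReal.continuous_rpow_const.continuousAt
  have hmain : ∀ N, ∫⁻ x in Metric.ball x₀ r ∩ exterior γ, v N x ≤ C * W ^ p * T := by
    intro N
    have := hfin N
    calc ∫⁻ x in Metric.ball x₀ r ∩ exterior γ, v N x
        ≤ ∫⁻ x in Metric.ball x₀ r, v N x := lintegral_mono_set inter_subset_left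
      _ = ∑' j, ∫⁻ x in Metric.ball x₀ r, (layer γ j).indicator (I N j) x :=
          lintegral_tsum fun j => ((hI N j).indicator (hml j)).aemeasurable
      _ = ∑' j, ∫⁻ x in Metric.ball x₀ r ∩ layer γ j, I N j x := by
          congr 1
          funext j
          rw [setLIntegral_indicator (hml j), inter_comm]
      _ ≤ ∑' j, ∫⁻ x in Metric.ball x₀ r ∩ layer γ j,
            W ^ (p - 1) * ∫⁻ ζ, Θ (x - (2 : ℝ) ^ (-j) • ζ) ^ p ∂(ν N) := by
          refine ENNReal.tsum_le_tsum fun j => lintegral_mono fun x => ?_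
          refine (lintegral_rpow_le_measure_univ (ν N) hp
            (h := fun ζ => Θ (x - (2 : ℝ) ^ (-j) • ζ)) (hΘ.comp (by fun_prop))).trans ?_
          exact mul_le_mul_left (ENNReal.rpow_le_rpow (hνW N) (by linarith)) _
      _ = W ^ (p - 1) * ∑' j, ∫⁻ ζ, (∫⁻ x in Metric.ball x₀ r ∩ layer γ j,
            Θ (x - (2 : ℝ) ^ (-j) • ζ) ^ p) ∂(ν N) := by
          rw [← ENNReal.tsum_mul_left]
          congr 1
          funext j
          rw [lintegral_const_mul _ (measurable_lintegral_shift (hΘ.pow_const p) _ (ν N))]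
          congr 1
          rw [lintegral_lintegral_swap]
          have h : Measurable fun q : Space m × Space m => Θ (q.1 - (2 : ℝ) ^ (-j) • q.2) :=
            hΘ.comp (by fun_prop)
          exact (h.pow_const p).aemeasurable
      _ = W ^ (p - 1) * ∫⁻ ζ, (∑' j, ∫⁻ x in Metric.ball x₀ r ∩ layer γ j,
            Θ (x - (2 : ℝ) ^ (-j) • ζ) ^ p) ∂(ν N) := by
          rw [lintegral_tsum]
          intro j
          apply Measurable.aemeasurable
          have h : Measurable fun q : Space m × Space m => Θ (q.2 - (2 : ℝ) ^ (-j) • q.1) :=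
            hΘ.comp (by fun_prop)
          exact (h.pow_const p).lintegral_prod_right'
      _ ≤ W ^ (p - 1) * ∫⁻ ζ, C * T ∂(ν N) := by
          refine mul_le_mul_right ?_ _
          apply lintegral_mono_ae
          filter_upwards [hν N] with ζ hζ
          exact hC ζ hζ (fun x => Θ x ^ p) (hΘ.pow_const p) r hr x₀ T hT
      _ ≤ W ^ (p - 1) * (C * T * W) := by
          rw [lintegral_const]
          gcongr
          exact hνW N
      _ = C * W ^ p * T := by
          have : W ^ p = W ^ (p - 1) * W := by
            by_cases hW0 : W = 0
            · simp [hW0, hp0]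
            · have h := ENNReal.rpow_add (p - 1) 1 hW0 hW
              rw [ENNReal.rpow_one] at h
              rw [← h]
              congr 1
              ring
          rw [this]
          ring
  calc ∫⁻ x in Metric.ball x₀ r ∩ exterior γ, u x ^ p
      ≤ ∫⁻ x in Metric.ball x₀ r ∩ exterior γ, Filter.liminf (fun N => v N x) Filter.atTop :=
        setLIntegral_mono' (measurableSet_ball.inter isOpen_exterior.measurableSet) huv
    _ ≤ Filter.liminf (fun N => ∫⁻ x in Metric.ball x₀ r ∩ exterior γ, v N x) Filter.atTop :=
        lintegral_liminf_le hv
    _ ≤ C * W ^ p * T := by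
        refine (Filter.liminf_le_liminf (Filter.Eventually.of_forall hmain)).trans_eq ?_
        exact Filter.liminf_const _

end LayerAverages

/-! ### Mollification with the stretched kernel -/

section Moll

variable {m : ℕ} {V : Type*} [NormedAddCommGroup V] [NormedSpace ℝ V]

/-- The mollification at scale `t`; `mollified` is the case `t = 2⁻ᵏ`. -/
def moll (A : ℝ) (ω : Space m → ℝ) (t : ℝ) (F : Space m → V) (x : Space m) : V :=
  ∫ z, ω z • F (x - t • stretch A z)

lemma stretch_inv_stretch {A : ℝ} (hA : A ≠ 0) (z : Space m) : stretch A⁻¹ (stretch A z) = z := by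
  ext i
  simp only [stretch_apply]
  split_ifs
  · rw [← mul_assoc, inv_mul_cancel₀ hA, one_mul]
  · rfl

lemma stretch_smul (A t : ℝ) (z : Space m) : stretch A (t • z) = t • stretch A z := by
  ext i
  simp only [stretch_apply, PiLp.smul_apply, smul_eq_mul]
  split_ifs
  · ring
  · rfl

/-- The linear map `z ↦ t (z̄, A zₙ)`. -/
def dilation (A t : ℝ) : Space m →ₗ[ℝ] Space m where
  toFun z := t • stretch A z
  map_add' x y := by
    ext i
    simp only [stretch_apply, PiLp.smul_apply, PiLp.add_apply, smul_eq_mul]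
    split_ifs <;> ring
  map_smul' s x := by
    rw [stretch_smul, smul_comm]
    rfl

lemma dilation_apply (A t : ℝ) (z : Space m) : dilation A t z = t • stretch A z := rfl

lemma dilation_inv_dilation {A t : ℝ} (hA : A ≠ 0) (ht : t ≠ 0) (z : Space m) :
    dilation A⁻¹ t⁻¹ (dilation A t z) = z := by
  rw [dilation_apply, dilation_apply, stretch_smul, stretch_inv_stretch hA, smul_smul,
    inv_mul_cancel₀ ht, one_smul]

lemma dilation_dilation_inv {A t : ℝ} (hA : A ≠ 0) (ht : t ≠ 0) (z : Space m) :
    dilation A t (dilation A⁻¹ t⁻¹ z) = z := by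
  have := dilation_inv_dilation (inv_ne_zero hA) (inv_ne_zero ht) z
  rwa [inv_inv, inv_inv] at this

lemma continuous_dilation (A t : ℝ) : Continuous (dilation A t : Space m →ₗ[ℝ] Space m) :=
  LinearMap.continuous_of_finiteDimensional _

lemma continuous_smul_stretch (A t : ℝ) : Continuous fun z : Space m => t • stretch A z :=
  continuous_dilation A t

lemma continuous_stretch (A : ℝ) : Continuous (stretch A : Space m → Space m) := by
  simpa using continuous_smul_stretch (m := m) A 1

lemma integral_comp_dilation {A t : ℝ} (hA : A ≠ 0) (ht : t ≠ 0) (g : Space m → V) :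
    ∫ z, g (t • stretch A z) =
      |(LinearMap.det (dilation A t : Space m →ₗ[ℝ] Space m))⁻¹| • ∫ y, g y := by
  have hdet : LinearMap.det (dilation A t : Space m →ₗ[ℝ] Space m) ≠ 0 := by
    have h : (dilation A⁻¹ t⁻¹ : Space m →ₗ[ℝ] Space m) ∘ₗ dilation A t = LinearMap.id := by
      ext1 z
      exact dilation_inv_dilation hA ht z
    have h2 := congrArg LinearMap.det h
    rw [LinearMap.det_comp, LinearMap.det_id] at h2
    exact right_ne_zero_of_mul_eq_one h2
  have hemb : MeasurableEmbedding (dilation A t : Space m →ₗ[ℝ] Space m) := by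
    let e : Space m ≃ₜ Space m :=
      { toFun := dilation A t
        invFun := dilation A⁻¹ t⁻¹
        left_inv := dilation_inv_dilation hA ht
        right_inv := dilation_dilation_inv hA ht
        continuous_toFun := continuous_dilation A t
        continuous_invFun := continuous_dilation A⁻¹ t⁻¹ }
    exact e.measurableEmbedding
  have h := hemb.integral_map (μ := volume) g
  rw [Measure.map_linearMap_addHaar_eq_smul_addHaar _ hdet, integral_smul_measure,
    ENNReal.toReal_ofReal (abs_nonneg _)] at h
  exact h.symm

/-- The convolution kernel of the mollification. -/
def kernel (A : ℝ) (ω : Space m → ℝ) (t : ℝ) (y : Space m) : ℝ :=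
  |(LinearMap.det (dilation A t : Space m →ₗ[ℝ] Space m))⁻¹| * ω (dilation A⁻¹ t⁻¹ y)

variable {A : ℝ} {ω : Space m → ℝ} {t : ℝ}

lemma contDiff_kernel (hω : ContDiff ℝ (⊤ : ℕ∞) ω) : ContDiff ℝ (⊤ : ℕ∞) (kernel A ω t) :=
  contDiff_const.mul (hω.comp (LinearMap.toContinuousLinearMap (dilation A⁻¹ t⁻¹)).contDiff)

lemma isCompact_kernelRegion : IsCompact (kernelRegion m) := by
  have hc : IsClosed {x : Space m | 1 / 2 ≤ x (Fin.last m)} :=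
    isClosed_le continuous_const (by fun_prop)
  exact (isCompact_closedBall (0 : Space m) 1).inter_right hc

lemma hasCompactSupport_of_tsupport_subset (hs : tsupport ω ⊆ kernelRegion m) :
    HasCompactSupport ω :=
  isCompact_kernelRegion.of_isClosed_subset (isClosed_tsupport _) hs

lemma support_kernel_subset (hA : A ≠ 0) (ht : t ≠ 0) :
    Function.support (kernel A ω t) ⊆ (fun z => t • stretch A z) '' tsupport ω := by
  intro y hy
  refine ⟨dilation A⁻¹ t⁻¹ y, subset_tsupport _ fun h => hy ?_, dilation_dilation_inv hA ht y⟩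
  simp [kernel, h]

lemma hasCompactSupport_kernel (hA : A ≠ 0) (ht : t ≠ 0) (hs : HasCompactSupport ω) :
    HasCompactSupport (kernel A ω t) := by
  have hK : IsCompact ((fun z => t • stretch A z) '' tsupport ω) :=
    IsCompact.image hs (continuous_smul_stretch A t)
  exact hK.of_isClosed_subset (isClosed_tsupport _)
    (closure_minimal (support_kernel_subset hA ht) hK.isClosed)

/-- The substitution `y = t(z̄, Azₙ)` yields an ordinary convolution, for which smoothness,
differentiation and commutation are standard. -/
lemma moll_eq_convolution (hA : A ≠ 0) (ht : t ≠ 0) (F : Space m → V) :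
    moll A ω t F = convolution (kernel A ω t) F (ContinuousLinearMap.lsmul ℝ ℝ) volume := by
  funext x
  have h := integral_comp_dilation hA ht
    fun y : Space m => ω (dilation A⁻¹ t⁻¹ y) • F (x - y)
  rw [moll, convolution]
  simp only [ContinuousLinearMap.lsmul_apply, kernel, mul_smul]
  rw [integral_smul, ← h]
  congr 1
  funext z
  rw [← dilation_apply, dilation_inv_dilation hA ht]

lemma convolution_lsmul_eq (κ : Space m → ℝ) (F : Space m → V) (x : Space m) :
    convolution κ F (ContinuousLinearMap.lsmul ℝ ℝ) volume x = ∫ y, κ (x - y) • F y := by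
  rw [convolution]
  simp only [ContinuousLinearMap.lsmul_apply]
  rw [← integral_sub_left_eq_self _ volume x]
  simp

lemma moll_eq_integral (hA : A ≠ 0) (ht : t ≠ 0) (F : Space m → V) (x : Space m) :
    moll A ω t F x = ∫ y, kernel A ω t (x - y) • F y := by
  rw [moll_eq_convolution hA ht, convolution_lsmul_eq]

lemma contDiff_moll (hA : A ≠ 0) (ht : t ≠ 0) (hω : ContDiff ℝ (⊤ : ℕ∞) ω)
    (hs : HasCompactSupport ω) {F : Space m → V} (hF : LocallyIntegrable F) :
    ContDiff ℝ (⊤ : ℕ∞) (moll A ω t F) := by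
  rw [moll_eq_convolution hA ht]
  exact (hasCompactSupport_kernel hA ht hs).contDiff_convolution_left _ (contDiff_kernel hω) hF

lemma listDeriv_convolution [CompleteSpace V] {κ : Space m → ℝ} (hκ : ContDiff ℝ (⊤ : ℕ∞) κ)
    (hs : HasCompactSupport κ) {F : Space m → V} (hF : LocallyIntegrable F)
    (L : List (Fin (m + 1))) :
    listDeriv L (convolution κ F (ContinuousLinearMap.lsmul ℝ ℝ) volume) =
      convolution (listDeriv L κ) F (ContinuousLinearMap.lsmul ℝ ℝ) volume := by
  induction L with
  | nil => rfl
  | cons i L ih =>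
    rw [listDeriv_cons, ih]
    funext x
    have hκ' := contDiff_listDeriv hκ L
    have hs' := hasCompactSupport_listDeriv hs L
    have hd := hs'.hasFDerivAt_convolution_left (ContinuousLinearMap.lsmul ℝ ℝ)
      (hκ'.of_le (by exact_mod_cast le_top)) hF x
    rw [coordDeriv, hd.fderiv, convolution, convolution, ContinuousLinearMap.integral_apply]
    · rfl
    · exact (hs'.fderiv ℝ).convolutionExists_left _ (hκ'.continuous_fderiv (by simp)) hF x

lemma mem_of_kernel_ne_zero (hA : A ≠ 0) (ht : t ≠ 0) {U : Set (Space m)} {x y : Space m}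
    (hx : ∀ z ∈ tsupport ω, x - t • stretch A z ∈ U) (h : kernel A ω t (x - y) ≠ 0) : y ∈ U := by
  obtain ⟨z, hz, hzy⟩ := support_kernel_subset hA ht h
  have := hx z hz
  simp only at hzy
  rwa [hzy, sub_sub_cancel] at this

/-- The value at `x` depends only on the shifted points, and ignores null sets. Hence
representatives may be changed and the values off Ω chosen freely. -/
lemma moll_congr_ae (hA : A ≠ 0) (ht : t ≠ 0) {U : Set (Space m)} (hU : MeasurableSet U)
    {F F' : Space m → V} (hF : ∀ᵐ y ∂(volume.restrict U), F y = F' y) {x : Space m}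
    (hx : ∀ z ∈ tsupport ω, x - t • stretch A z ∈ U) : moll A ω t F x = moll A ω t F' x := by
  rw [moll_eq_integral hA ht, moll_eq_integral hA ht]
  apply integral_congr_ae
  rw [ae_restrict_iff' hU] at hF
  filter_upwards [hF] with y hy
  by_cases h : kernel A ω t (x - y) = 0
  · simp [h]
  · rw [hy (mem_of_kernel_ne_zero hA ht hx h)]

lemma tsupport_kernel_sub_subset (hA : A ≠ 0) (ht : t ≠ 0) (hs : HasCompactSupport ω)
    (x : Space m) : tsupport (fun y => kernel A ω t (x - y)) ⊆
      (fun z => x - t • stretch A z) '' tsupport ω := by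
  have hK : IsCompact ((fun z => x - t • stretch A z) '' tsupport ω) :=
    IsCompact.image hs (continuous_const.sub (continuous_smul_stretch A t))
  refine closure_minimal (fun y hy => ?_) hK.isClosed
  exact mem_of_kernel_ne_zero hA ht (fun z hz => mem_image_of_mem _ hz) hy

/-- The derivatives of the mollification are the mollifications of the weak derivatives. -/
lemma listDeriv_moll {𝕜 : Type*} [RCLike 𝕜] (hA : A ≠ 0) (ht : t ≠ 0)
    (hω : ContDiff ℝ (⊤ : ℕ∞) ω) (hs : HasCompactSupport ω) {F G : Space m → 𝕜}
    (hF : LocallyIntegrable F) {U : Set (Space m)} {L : List (Fin (m + 1))}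
    (hG : IsWeakDeriv U (fun i => L.count i) F G) {x : Space m}
    (hx : ∀ z ∈ tsupport ω, x - t • stretch A z ∈ U) :
    listDeriv L (moll A ω t F) x = moll A ω t G x := by
  have hκ := contDiff_kernel (A := A) (t := t) hω
  have hκs := hasCompactSupport_kernel hA ht hs
  rw [moll_eq_convolution hA ht, listDeriv_convolution hκ hκs hF, convolution_lsmul_eq,
    moll_eq_integral hA ht]
  have hη : ContDiff ℝ (⊤ : ℕ∞) (fun y => kernel A ω t (x - y)) :=
    hκ.comp (contDiff_const.sub contDiff_id)
  have hηU : tsupport (fun y => kernel A ω t (x - y)) ⊆ U := by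
    refine (tsupport_kernel_sub_subset hA ht hs x).trans ?_
    rintro _ ⟨z, hz, rfl⟩
    exact hx z hz
  have hηs : HasCompactSupport (fun y => kernel A ω t (x - y)) :=
    hκs.comp_homeomorph (Homeomorph.subLeft x)
  have h := hG.2.2 _ hη hηs hηU
  rw [← listDeriv_eq_multiDeriv hη, listDeriv_comp_const_sub hκ, order_count] at h
  simp only [smul_assoc] at h
  rw [integral_smul] at h
  -- The sign from differentiating `y ↦ κ(x - y)` and the sign in the definition of the weak
  -- derivative cancel.
  have h' := smul_right_injective 𝕜 (pow_ne_zero L.length (neg_ne_zero.2 (one_ne_zero (α := ℝ)))) h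
  rw [setIntegral_eq_integral_of_forall_compl_eq_zero,
    setIntegral_eq_integral_of_forall_compl_eq_zero] at h'
  · exact h'
  · intro y hy
    have : kernel A ω t (x - y) = 0 := by
      by_contra hne
      exact hy (mem_of_kernel_ne_zero hA ht hx hne)
    simp [this]
  · intro y hy
    have : listDeriv L (kernel A ω t) (x - y) = 0 := by
      by_contra hne
      refine hy (hηU (tsupport_listDeriv_subset _ L (subset_tsupport _ ?_)))
      rw [Function.mem_support, listDeriv_comp_const_sub hκ]
      exact smul_ne_zero (pow_ne_zero _ (by norm_num)) hne
    simp [this]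

/-- Convolution is associative and the two kernels commute. After the exchange the small-scale
average acts on a smooth function, where it converges at every point and not only almost everywhere.
-/
lemma moll_moll_comm [CompleteSpace V] {s : ℝ} (hA : A ≠ 0) (ht : t ≠ 0) (hs0 : s ≠ 0)
    (hω : ContDiff ℝ (⊤ : ℕ∞) ω) (hs : HasCompactSupport ω) {F : Space m → V}
    (hF : LocallyIntegrable F) : moll A ω t (moll A ω s F) = moll A ω s (moll A ω t F) := by
  have key : ∀ a b : ℝ, a ≠ 0 → b ≠ 0 → ∀ x, moll A ω a (moll A ω b F) x =
      convolution (convolution (kernel A ω a) (kernel A ω b) (ContinuousLinearMap.lsmul ℝ ℝ)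
        volume) F (ContinuousLinearMap.lsmul ℝ ℝ) volume x := by
    intro a b ha hb x
    have hca := (contDiff_kernel (A := A) (t := a) hω).continuous
    have hcb := (contDiff_kernel (A := A) (t := b) hω).continuous
    have hsa := hasCompactSupport_kernel hA ha hs
    have hsb := hasCompactSupport_kernel hA hb hs
    have hFn : LocallyIntegrable (fun x => ‖F x‖) := fun x => (hF x).norm
    rw [moll_eq_convolution hA ha, moll_eq_convolution hA hb]
    symm
    apply convolution_assoc
    · intro x y z
      simp [mul_smul, smul_comm x y z]
    · exact hca.aestronglyMeasurable
    · exact hcb.aestronglyMeasurable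
    · exact hF.aestronglyMeasurable
    · exact Filter.Eventually.of_forall fun y => hsa.convolutionExists_left _ hca
        hcb.locallyIntegrable y
    · exact Filter.Eventually.of_forall fun y => hsb.norm.convolutionExists_left _ hcb.norm
        hFn y
    · refine hsa.norm.convolutionExists_left _ hca.norm ?_ x
      exact (hsb.norm.continuous_convolution_left _ hcb.norm hFn).locallyIntegrable
  funext x
  rw [key t s ht hs0, key s t hs0 ht]
  congr 1
  rw [← convolution_flip]
  congr 1
  ext
  simp

/-- The average is continuous in its scale down to 0, where `∫ ω = 1` makes it the evaluation at
`x`. -/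
lemma tendsto_moll (hs : HasCompactSupport ω) (hω : Continuous ω) (hint : ∫ z, ω z = 1)
    [CompleteSpace V]
    {H : Space m → V} (hH : Continuous H) (x : Space m) {ε : ℕ → ℝ}
    (hε : Filter.Tendsto ε Filter.atTop (nhds 0)) :
    Filter.Tendsto (fun N => moll A ω (ε N) H x) Filter.atTop (nhds (H x)) := by
  have hc : Continuous fun s : ℝ => ∫ z in tsupport ω, ω z • H (x - s • stretch A z) := by
    apply continuous_parametric_integral_of_continuous
    · have := continuous_stretch (m := m) A
      fun_prop
    · exact hs
  have h := (hc.tendsto 0).comp hε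
  have e : ∀ s : ℝ, ∫ z in tsupport ω, ω z • H (x - s • stretch A z) = moll A ω s H x := by
    intro s
    rw [moll, setIntegral_eq_integral_of_forall_compl_eq_zero]
    intro z hz
    simp [image_eq_zero_of_notMem_tsupport hz]
  have e0 : moll A ω 0 H x = H x := by
    simp [moll, integral_smul_const, hint]
  simpa only [Function.comp_def, e, e0] using h

end Moll

/-! ### Taylor expansion in terms of derivatives along lists -/

section Taylor

variable {n : ℕ} {V : Type*} [NormedAddCommGroup V] [NormedSpace ℝ V]

/-- The `j`-th derivative of `s ↦ h (a + s v)` at `s = 0`. -/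
def taylorTerm (j : ℕ) (h : EuclideanSpace ℝ (Fin n) → V) (a v : EuclideanSpace ℝ (Fin n)) : V :=
  ∑ w : Fin j → Fin n, ((List.ofFn w).map v).prod • listDeriv (List.ofFn w) h a

lemma taylorTerm_zero (h : EuclideanSpace ℝ (Fin n) → V) (a v : EuclideanSpace ℝ (Fin n)) :
    taylorTerm 0 h a v = h a := by
  simp [taylorTerm]

lemma fderiv_apply_eq_sum (u : EuclideanSpace ℝ (Fin n) → V) (y v : EuclideanSpace ℝ (Fin n)) :
    fderiv ℝ u y v = ∑ i, v i • coordDeriv i u y := by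
  conv_lhs => rw [← (EuclideanSpace.basisFun (Fin n) ℝ).sum_repr v]
  rw [map_sum]
  refine Finset.sum_congr rfl fun i _ => ?_
  rw [map_smul]
  simp [coordDeriv]

/-- Summing over the first letter of a word gives the derivative in the direction `v`. Since all
words are summed, no multinomial coefficients appear. -/
lemma taylorTerm_succ (j : ℕ) (h : EuclideanSpace ℝ (Fin n) → V)
    (a v : EuclideanSpace ℝ (Fin n)) : taylorTerm (j + 1) h a v =
      ∑ w : Fin j → Fin n, ((List.ofFn w).map v).prod • fderiv ℝ (listDeriv (List.ofFn w) h) a v := by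
  rw [taylorTerm, ← (Fin.consEquiv fun _ : Fin (j + 1) => Fin n).sum_comp, Fintype.sum_prod_type,
    Finset.sum_comm]
  refine Finset.sum_congr rfl fun w _ => ?_
  rw [fderiv_apply_eq_sum, Finset.smul_sum]
  refine Finset.sum_congr rfl fun i _ => ?_
  have : List.ofFn ((Fin.consEquiv fun _ : Fin (j + 1) => Fin n) (i, w)) = i :: List.ofFn w :=
    List.ofFn_cons i w
  rw [this, List.map_cons, List.prod_cons, listDeriv_cons, mul_comm, mul_smul]

lemma hasDerivAt_taylorTerm {h : EuclideanSpace ℝ (Fin n) → V} (hh : ContDiff ℝ (⊤ : ℕ∞) h)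
    (j : ℕ) (a v : EuclideanSpace ℝ (Fin n)) (s : ℝ) :
    HasDerivAt (fun s : ℝ => taylorTerm j h (a + s • v) v) (taylorTerm (j + 1) h (a + s • v) v)
      s := by
  rw [taylorTerm_succ]
  unfold taylorTerm
  apply HasDerivAt.fun_sum
  intro w _
  apply HasDerivAt.const_smul
  have h1 := (differentiable_of_smooth (contDiff_listDeriv hh (List.ofFn w))
    (a + s • v)).hasFDerivAt
  have h2 : HasDerivAt (fun s : ℝ => a + s • v) v s := by
    simpa using ((hasDerivAt_id s).smul_const v).const_add a
  exact h1.comp_hasDerivAt s h2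

lemma iteratedDeriv_comp_line {h : EuclideanSpace ℝ (Fin n) → V} (hh : ContDiff ℝ (⊤ : ℕ∞) h)
    (a v : EuclideanSpace ℝ (Fin n)) (j : ℕ) :
    iteratedDeriv j (fun s : ℝ => h (a + s • v)) = fun s => taylorTerm j h (a + s • v) v := by
  induction j with
  | zero =>
    funext s
    simp [taylorTerm_zero]
  | succ j ih =>
    funext s
    rw [iteratedDeriv_succ, ih]
    exact (hasDerivAt_taylorTerm hh j a v s).deriv

/-- The Taylor polynomial of order less than `q` at `a`, evaluated at `a + v`. -/
def taylorPoly (q : ℕ) (h : EuclideanSpace ℝ (Fin n) → V) (a v : EuclideanSpace ℝ (Fin n)) : V :=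
  ∑ j ∈ Finset.range q, ((j.factorial : ℝ)⁻¹) • taylorTerm j h a v

/-- Integral form of the remainder along the segment. The weight `(1-s)^(q-1)/(q-1)!` is at most 1
and is dropped. -/
lemma enorm_sub_taylorPoly_le [CompleteSpace V] {h : EuclideanSpace ℝ (Fin n) → V}
    (hh : ContDiff ℝ (⊤ : ℕ∞) h) (a v : EuclideanSpace ℝ (Fin n)) {q : ℕ} (hq : q ≠ 0) :
    ‖h (a + v) - taylorPoly q h a v‖ₑ ≤
      ∫⁻ s in Icc (0 : ℝ) 1, ‖taylorTerm q h (a + s • v) v‖ₑ := by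
  obtain ⟨r, rfl⟩ := Nat.exists_eq_succ_of_ne_zero hq
  set φ : ℝ → V := fun s => h (a + s • v) with hφ
  have hφs : ContDiff ℝ (⊤ : ℕ∞) φ :=
    hh.comp (contDiff_const.add (contDiff_id.smul contDiff_const))
  have hcd : ∀ k : ℕ, ContDiff ℝ k φ := fun k => hφs.of_le (by exact_mod_cast le_top)
  have hu : UniqueDiffOn ℝ (uIcc (0 : ℝ) 1) := by
    rw [uIcc_of_le zero_le_one]
    exact uniqueDiffOn_Icc_zero_one
  have hit : ∀ k : ℕ, ∀ s ∈ uIcc (0 : ℝ) 1,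
      iteratedDerivWithin k φ (uIcc 0 1) s = taylorTerm k h (a + s • v) v := by
    intro k s hs
    rw [iteratedDerivWithin_eq_iteratedDeriv hu (hcd k).contDiffAt hs,
      iteratedDeriv_comp_line hh]
  have hT := taylor_integral_remainder (f := φ) (x := 1) (x₀ := 0) (n := r) (hcd _).contDiffOn
  have hP : taylorWithinEval φ r (uIcc (0 : ℝ) 1) 0 1 = taylorPoly (r + 1) h a v := by
    rw [taylor_within_apply, taylorPoly]
    refine Finset.sum_congr rfl fun k _ => ?_
    rw [hit k 0 left_mem_uIcc]
    simp
  have h1 : φ 1 = h (a + v) := by simp [hφ]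
  rw [hP, h1] at hT
  rw [Nat.succ_eq_add_one, hT, intervalIntegral.integral_of_le zero_le_one]
  refine (enorm_integral_le_lintegral_enorm _).trans ?_
  refine (lintegral_mono_set Ioc_subset_Icc_self).trans ?_
  refine setLIntegral_mono' measurableSet_Icc fun s hs => ?_
  rw [hit (r + 1) s (by rwa [uIcc_of_le zero_le_one]), enorm_smul]
  refine mul_le_of_le_one_left zero_le ?_
  rw [Real.enorm_eq_ofReal_abs, ENNReal.ofReal_le_one]
  have h2 : 0 ≤ 1 - s := by linarith [hs.2]
  rw [abs_of_nonneg (by positivity)]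
  apply div_le_one_of_le₀
  · calc (1 - s) ^ r ≤ 1 := pow_le_one₀ h2 (by linarith [hs.1])
      _ ≤ (r.factorial : ℝ) := by exact_mod_cast Nat.one_le_iff_ne_zero.2 (Nat.factorial_ne_zero r)
  · positivity

lemma enorm_taylorTerm_le (q : ℕ) (h : EuclideanSpace ℝ (Fin n) → V)
    (y : EuclideanSpace ℝ (Fin n)) {v : EuclideanSpace ℝ (Fin n)} {ϱ : ℝ} (hv : ‖v‖ ≤ ϱ) :
    ‖taylorTerm q h y v‖ₑ ≤
      ENNReal.ofReal ϱ ^ q * ∑ w : Fin q → Fin n, ‖listDeriv (List.ofFn w) h y‖ₑ := by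
  rw [taylorTerm, Finset.mul_sum]
  refine (enorm_sum_le _ _).trans (Finset.sum_le_sum fun w _ => ?_)
  rw [enorm_smul]
  gcongr
  rw [List.map_ofFn, List.prod_ofFn, Real.enorm_eq_ofReal_abs, Finset.abs_prod]
  rw [ENNReal.ofReal_prod_of_nonneg fun _ _ => abs_nonneg _]
  refine (Finset.prod_le_pow_card _ _ (ENNReal.ofReal ϱ) fun i _ => ?_).trans_eq (by simp)
  apply ENNReal.ofReal_le_ofReal
  have := PiLp.norm_apply_le v (w i)
  simp only [Real.norm_eq_abs] at this
  exact this.trans hv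

end Taylor

/-! ### Vanishing moments and reproduction of polynomials. -/

section Moments

variable {m l : ℕ} {ω : Space m → ℝ}

lemma continuous_coord_prod (b d : Fin (m + 1) → ℝ) (L : List (Fin (m + 1))) :
    Continuous fun z : Space m => (L.map fun i => b i - d i * z i).prod := by
  induction L with
  | nil => simpa using continuous_const
  | cons i L ih =>
    simp only [List.map_cons, List.prod_cons]
    exact (by fun_prop : Continuous fun z : Space m => b i - d i * z i).mul ih

lemma IsKernel.hasCompactSupport (hω : IsKernel l ω) : HasCompactSupport ω :=
  hasCompactSupport_of_tsupport_subset hω.support_subset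

/-- The monomial `z^α` is carried along for the induction: expanding a factor `b_j - d_j z_j` either
keeps `α` or raises its order by one, and monomials of positive order at most `l` integrate to 0. -/
lemma integral_kernel_mul_prod (hω : IsKernel l ω) (b d : Fin (m + 1) → ℝ)
    (L : List (Fin (m + 1))) (α : Fin (m + 1) → ℕ) (hα : order α + L.length ≤ l) :
    ∫ z, ω z * ((∏ i, z i ^ α i) * (L.map fun i => b i - d i * z i).prod) =
      if order α = 0 then (L.map b).prod else 0 := by
  induction L generalizing α with
  | nil =>
    simp only [List.map_nil, List.prod_nil, mul_one]
    split_ifs with h0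
    · have hα0 : ∀ i, α i = 0 := by
        simpa [order, Finset.sum_eq_zero_iff] using h0
      simp [hα0, hω.integral_eq_one]
    · exact hω.moments α (Nat.pos_of_ne_zero h0) (by simpa using hα)
  | cons j L ih =>
    have hc := continuous_coord_prod b d L
    have int : ∀ α : Fin (m + 1) → ℕ, Integrable fun z : Space m =>
        ω z * ((∏ i, z i ^ α i) * (L.map fun i => b i - d i * z i).prod) := by
      intro α
      apply Continuous.integrable_of_hasCompactSupport
      · exact hω.smooth.continuous.mul ((by fun_prop : Continuous _).mul hc)
      · exact hω.hasCompactSupport.mul_right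
    let α' : Fin (m + 1) → ℕ := α + Pi.single j 1
    have hα' : order α' = order α + 1 := by
      simp [order, α', Finset.sum_add_distrib]
    have hlen : order α + (L.length + 1) ≤ l := by simpa using hα
    have e : ∀ z : Space m,
        ω z * ((∏ i, z i ^ α i) * ((j :: L).map fun i => b i - d i * z i).prod) =
          b j * (ω z * ((∏ i, z i ^ α i) * (L.map fun i => b i - d i * z i).prod)) -
          d j * (ω z * ((∏ i, z i ^ α' i) * (L.map fun i => b i - d i * z i).prod)) := by
      intro z
      have : ∏ i, z i ^ α' i = (∏ i, z i ^ α i) * z j := by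
        simp only [α', Pi.add_apply, pow_add, Finset.prod_mul_distrib]
        congr 1
        rw [Finset.prod_eq_single j]
        · simp
        · intro i _ hi
          simp [hi]
        · simp
      rw [this, List.map_cons, List.prod_cons]
      ring
    simp only [e]
    rw [integral_sub ((int α).const_mul _) ((int α').const_mul _), integral_const_mul,
      integral_const_mul, ih α (by omega), ih α' (by omega)]
    split_ifs with h0 h1
    · omega
    · simp
    · omega
    · simp

variable {V : Type*} [NormedAddCommGroup V] [NormedSpace ℝ V] [CompleteSpace V]

lemma sub_smul_stretch_ofLp (A t : ℝ) (b z : Space m) :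
    (b - t • stretch A z).ofLp =
      fun i => b i - (t * if i = Fin.last m then A else 1) * z i := by
  funext i
  simp only [PiLp.sub_apply, PiLp.smul_apply, stretch_apply, smul_eq_mul]
  split_ifs <;> ring

omit [CompleteSpace V] in
lemma continuous_taylorTerm_shift (A t : ℝ) (j : ℕ) (h : Space m → V) (a b : Space m) :
    Continuous fun z : Space m => taylorTerm j h a (b - t • stretch A z) := by
  unfold taylorTerm
  refine continuous_finsetSum _ fun w _ => Continuous.smul ?_ continuous_const
  simp only [sub_smul_stretch_ofLp]
  exact continuous_coord_prod _ _ _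

/-- Only the constant term of the polynomial in `z` survives, so the result does not depend on the
scale. -/
lemma integral_kernel_smul_taylorTerm (hω : IsKernel l ω) (A t : ℝ) {j : ℕ} (hj : j ≤ l)
    (h : Space m → V) (a b : Space m) :
    ∫ z, ω z • taylorTerm j h a (b - t • stretch A z) = taylorTerm j h a b := by
  unfold taylorTerm
  simp only [Finset.smul_sum, smul_smul]
  rw [integral_finsetSum]
  · refine Finset.sum_congr rfl fun w _ => ?_
    rw [integral_smul_const]
    congr 1
    simp only [sub_smul_stretch_ofLp]
    have := integral_kernel_mul_prod hω b (fun i => t * if i = Fin.last m then A else 1)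
      (List.ofFn w) 0 (by simpa [order] using hj)
    simpa [order] using this
  · intro w _
    apply Continuous.integrable_of_hasCompactSupport
    · refine Continuous.smul (hω.smooth.continuous.mul ?_) continuous_const
      simp only [sub_smul_stretch_ofLp]
      exact continuous_coord_prod _ _ _
    · exact (hω.hasCompactSupport.mul_right).smul_right

/-- Up to a remainder, mollification reproduces the Taylor polynomial, whatever its scale. -/
lemma enorm_moll_sub_taylorPoly_le (hω : IsKernel l ω) (A t : ℝ) {q : ℕ} (hq : q ≠ 0)
    (hql : q ≤ l) {h : Space m → V} (hh : ContDiff ℝ (⊤ : ℕ∞) h) (a b : Space m) {ϱ : ℝ}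
    (hϱ : ∀ z ∈ kernelRegion m, ‖b - t • stretch A z‖ ≤ ϱ) :
    ‖moll A ω t h (a + b) - taylorPoly q h a b‖ₑ ≤ ∫⁻ z, ‖ω z‖ₑ *
      ∫⁻ s in Icc (0 : ℝ) 1, ENNReal.ofReal ϱ ^ q *
        ∑ w : Fin q → Fin (m + 1), ‖listDeriv (List.ofFn w) h (a + s • (b - t • stretch A z))‖ₑ := by
  have hcT : ∀ j, Continuous fun z : Space m => ω z • taylorTerm j h a (b - t • stretch A z) :=
    fun j => hω.smooth.continuous.smul (continuous_taylorTerm_shift A t j h a b)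
  have hcs := hω.hasCompactSupport
  -- The expansion is about `a`, whatever `t` is; hence the polynomial part averages to the same
  -- value at every scale.
  have hP : ∫ z, ω z • taylorPoly q h a (b - t • stretch A z) = taylorPoly q h a b := by
    unfold taylorPoly
    simp only [Finset.smul_sum]
    rw [integral_finsetSum]
    · refine Finset.sum_congr rfl fun j hj => ?_
      simp only [smul_comm (ω _) (_ : ℝ) (_ : V)]
      rw [integral_smul, integral_kernel_smul_taylorTerm hω A t
        ((Finset.mem_range.1 hj).le.trans hql)]
    · intro j _
      simp only [smul_comm (ω _) (_ : ℝ) (_ : V)]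
      exact ((hcT j).integrable_of_hasCompactSupport (μ := volume) hcs.smul_right).smul (_ : ℝ)
  have hcP : Continuous fun z : Space m => ω z • taylorPoly q h a (b - t • stretch A z) := by
    unfold taylorPoly
    exact hω.smooth.continuous.smul (continuous_finsetSum _ fun j _ =>
      (continuous_taylorTerm_shift A t j h a b).const_smul _)
  have hch : Continuous fun z : Space m => ω z • h (a + b - t • stretch A z) := by
    have h1 := hh.continuous
    have h2 := continuous_smul_stretch (m := m) A t
    have h3 := hω.smooth.continuous
    fun_prop
  rw [← hP, moll, ← integral_sub (hch.integrable_of_hasCompactSupport hcs.smul_right)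
    (hcP.integrable_of_hasCompactSupport hcs.smul_right)]
  refine (enorm_integral_le_lintegral_enorm _).trans (lintegral_mono fun z => ?_)
  rw [← smul_sub, enorm_smul]
  by_cases hz : z ∈ tsupport ω
  · have hz' : z ∈ kernelRegion m := hω.support_subset hz
    gcongr
    have e : a + b - t • stretch A z = a + (b - t • stretch A z) := by abel
    rw [e]
    refine (enorm_sub_taylorPoly_le hh _ _ hq).trans (lintegral_mono fun s => ?_)
    exact enorm_taylorTerm_le q h _ (hϱ z hz')
  · simp [image_eq_zero_of_notMem_tsupport hz]

end Moments

/-! ### Comparison of mollifications at neighbouring scales -/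

section Bracket

variable {m l : ℕ} {ω : Space m → ℝ} {γ : EuclideanSpace ℝ (Fin m) → ℝ} {M : ℝ}

/-- The measure with density `|ω|`. -/
def kernelMeasure (ω : Space m → ℝ) : Measure (Space m) := volume.withDensity fun z => ‖ω z‖ₑ

lemma measurable_enorm_kernel (hω : IsKernel l ω) : Measurable fun z => ‖ω z‖ₑ :=
  hω.smooth.continuous.measurable.enorm

lemma kernelMeasure_univ_lt_top (hω : IsKernel l ω) : kernelMeasure ω univ < ∞ := by
  rw [kernelMeasure, withDensity_apply _ MeasurableSet.univ, Measure.restrict_univ]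
  exact (hω.smooth.continuous.integrable_of_hasCompactSupport hω.hasCompactSupport).2

lemma isFiniteMeasure_kernelMeasure (hω : IsKernel l ω) : IsFiniteMeasure (kernelMeasure ω) :=
  ⟨kernelMeasure_univ_lt_top hω⟩

lemma lintegral_kernelMeasure (hω : IsKernel l ω) {Θ : Space m → ℝ≥0∞} (hΘ : Measurable Θ) :
    ∫⁻ z, Θ z ∂(kernelMeasure ω) = ∫⁻ z, ‖ω z‖ₑ * Θ z :=
  lintegral_withDensity_eq_lintegral_mul _ (measurable_enorm_kernel hω) hΘ

lemma ae_kernelMeasure_mem (hω : IsKernel l ω) : ∀ᵐ z ∂(kernelMeasure ω), z ∈ kernelRegion m := by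
  rw [kernelMeasure, ae_withDensity_iff (measurable_enorm_kernel hω)]
  refine Filter.Eventually.of_forall fun z hz => hω.support_subset (subset_tsupport _ ?_)
  simpa using hz

/-- The shift arising from a point of the segment between the reference point and a point of the
kernel region, followed by a small mollification. -/
def shiftPoint (A c ε : ℝ) (q : Space m × ℝ × Space m) : Space m :=
  (1 - q.2.1) • stretch A (EuclideanSpace.single (Fin.last m) 1) + (q.2.1 * c) • stretch A q.1 +
    ε • stretch A q.2.2

lemma continuous_shiftPoint (A c ε : ℝ) : Continuous (shiftPoint (m := m) A c ε) := by
  have := continuous_stretch (m := m) A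
  unfold shiftPoint
  fun_prop

/-- The distribution of `shiftPoint`. -/
def shiftMeasure (A : ℝ) (ω : Space m → ℝ) (c ε : ℝ) : Measure (Space m) :=
  Measure.map (shiftPoint A c ε)
    ((kernelMeasure ω).prod ((volume.restrict (Icc (0 : ℝ) 1)).prod (kernelMeasure ω)))

lemma shiftMeasure_univ (hω : IsKernel l ω) (A c ε : ℝ) :
    shiftMeasure A ω c ε univ = kernelMeasure ω univ * kernelMeasure ω univ := by
  have := isFiniteMeasure_kernelMeasure hω
  rw [shiftMeasure, Measure.map_apply (continuous_shiftPoint A c ε).measurable MeasurableSet.univ,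
    preimage_univ, ← univ_prod_univ, Measure.prod_prod, ← univ_prod_univ, Measure.prod_prod]
  simp

lemma lintegral_shiftMeasure (hω : IsKernel l ω) (A c ε : ℝ) {Θ : Space m → ℝ≥0∞}
    (hΘ : Measurable Θ) : ∫⁻ ζ, Θ ζ ∂(shiftMeasure A ω c ε) =
      ∫⁻ z, ‖ω z‖ₑ * ∫⁻ s in Icc (0 : ℝ) 1, ∫⁻ z', ‖ω z'‖ₑ * Θ (shiftPoint A c ε (z, s, z')) := by
  have := isFiniteMeasure_kernelMeasure hω
  have hm : Measurable fun q : Space m × ℝ × Space m => Θ (shiftPoint A c ε q) :=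
    hΘ.comp (continuous_shiftPoint A c ε).measurable
  have h2 : ∀ z : Space m, Measurable fun q : ℝ × Space m => Θ (shiftPoint A c ε (z, q)) :=
    fun z => hm.comp (by fun_prop)
  rw [shiftMeasure, lintegral_map hΘ (continuous_shiftPoint A c ε).measurable,
    lintegral_prod _ hm.aemeasurable]
  have e : ∀ z : Space m, ∫⁻ q, Θ (shiftPoint A c ε (z, q))
      ∂((volume.restrict (Icc (0 : ℝ) 1)).prod (kernelMeasure ω)) =
      ∫⁻ s in Icc (0 : ℝ) 1, ∫⁻ z', ‖ω z'‖ₑ * Θ (shiftPoint A c ε (z, s, z')) := by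
    intro z
    rw [lintegral_prod _ (h2 z).aemeasurable]
    refine lintegral_congr fun s => ?_
    exact lintegral_kernelMeasure hω ((h2 z).comp (by fun_prop : Measurable fun z' => (s, z')))
  rw [lintegral_kernelMeasure hω hm.lintegral_prod_right']
  simp only [e]

lemma single_last_mem_kernelRegion :
    EuclideanSpace.single (Fin.last m) (1 : ℝ) ∈ kernelRegion m := by
  refine ⟨?_, ?_⟩
  · simp
  · simp
    norm_num

/-- The length is at most `(1 + 2 + 1)·16(M+1)`. The descent is superadditive, hence at least
`8(1-s) + 8·s/2 ≥ 4`, and the small last shift only adds to it. -/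
lemma shiftPoint_mem (hM : 0 ≤ M) {c ε : ℝ} (hc : 1 / 2 ≤ c) (hc2 : c ≤ 2) (hε : 0 ≤ ε)
    (hε1 : ε ≤ 1) {z z' : Space m} (hz : z ∈ kernelRegion m) (hz' : z' ∈ kernelRegion m) {s : ℝ}
    (hs : s ∈ Icc (0 : ℝ) 1) :
    shiftPoint (16 * (M + 1)) c ε (z, s, z') ∈ admissibleShifts M (64 * (M + 1)) := by
  have h0 := single_last_mem_kernelRegion (m := m)
  have h1s : 0 ≤ 1 - s := by linarith [hs.2]
  have hsc : 0 ≤ s * c := mul_nonneg hs.1 (by linarith)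
  constructor
  · have n0 := norm_stretch_kernelRegion_le hM h0
    have n1 := norm_stretch_kernelRegion_le hM hz
    have n2 := norm_stretch_kernelRegion_le hM hz'
    have t1 := norm_add₃_le
      (a := (1 - s) • stretch (16 * (M + 1)) (EuclideanSpace.single (Fin.last m) (1 : ℝ)))
      (b := (s * c) • stretch (16 * (M + 1)) z) (c := ε • stretch (16 * (M + 1)) z')
    rw [norm_smul, norm_smul, norm_smul, Real.norm_of_nonneg h1s, Real.norm_of_nonneg hsc,
      Real.norm_of_nonneg hε] at t1
    have hA : 0 ≤ 16 * (M + 1) := by linarith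
    have b0 : (1 - s) * ‖stretch (16 * (M + 1)) (EuclideanSpace.single (Fin.last m) (1 : ℝ))‖ ≤
        1 * (16 * (M + 1)) := mul_le_mul (by linarith [hs.1]) n0 (norm_nonneg _) zero_le_one
    have b1 : (s * c) * ‖stretch (16 * (M + 1)) z‖ ≤ 2 * (16 * (M + 1)) :=
      mul_le_mul (by nlinarith [hs.1, hs.2]) n1 (norm_nonneg _) zero_le_two
    have b2 : ε * ‖stretch (16 * (M + 1)) z'‖ ≤ 1 * (16 * (M + 1)) :=
      mul_le_mul hε1 n2 (norm_nonneg _) zero_le_one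
    refine t1.trans ?_
    linarith
  · have d0 := eight_le_descent_stretch hM h0
    have d1 := eight_le_descent_stretch hM hz
    have d2 := eight_le_descent_stretch hM hz'
    have t1 := descent_add_le hM
      ((1 - s) • stretch (16 * (M + 1)) (EuclideanSpace.single (Fin.last m) (1 : ℝ)) +
      (s * c) • stretch (16 * (M + 1)) z) (ε • stretch (16 * (M + 1)) z')
    have t2 := descent_add_le hM
      ((1 - s) • stretch (16 * (M + 1)) (EuclideanSpace.single (Fin.last m) (1 : ℝ)))
      ((s * c) • stretch (16 * (M + 1)) z)
    rw [descent_smul h1s, descent_smul hsc] at t2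
    rw [descent_smul hε] at t1
    refine le_trans ?_ t1
    have b0 := mul_le_mul_of_nonneg_left d0 h1s
    have b1 := mul_le_mul_of_nonneg_left d1 hsc
    have b2 := mul_nonneg hε (le_trans (by norm_num) d2)
    have b3 := mul_le_mul_of_nonneg_left hc hs.1
    nlinarith [hs.1, hs.2]

lemma ae_shiftMeasure_mem (hM : 0 ≤ M) (hω : IsKernel l ω) {c ε : ℝ} (hc : 1 / 2 ≤ c)
    (hc2 : c ≤ 2) (hε : 0 ≤ ε) (hε1 : ε ≤ 1) :
    ∀ᵐ ζ ∂(shiftMeasure (16 * (M + 1)) ω c ε), ζ ∈ admissibleShifts M (64 * (M + 1)) := by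
  have := isFiniteMeasure_kernelMeasure hω
  have hcl : IsClosed (admissibleShifts (m := m) M (64 * (M + 1))) := by
    have hb : Continuous (bar : Space m → _) := by
      unfold bar
      fun_prop
    have hd : Continuous (descent M : Space m → ℝ) := by
      unfold descent
      fun_prop
    exact (isClosed_le continuous_norm continuous_const).inter (isClosed_le continuous_const hd)
  have hmap := ae_map_iff (p := fun ζ => ζ ∈ admissibleShifts M (64 * (M + 1)))
    (μ := (kernelMeasure ω).prod ((volume.restrict (Icc (0 : ℝ) 1)).prod (kernelMeasure ω)))
    (continuous_shiftPoint (16 * (M + 1)) c ε).measurable.aemeasurable hcl.measurableSet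
  rw [shiftMeasure, hmap]
  have h1 := (Measure.quasiMeasurePreserving_fst (μ := kernelMeasure ω)
    (ν := (volume.restrict (Icc (0 : ℝ) 1)).prod (kernelMeasure ω))).ae (ae_kernelMeasure_mem hω)
  have h2 := (Measure.quasiMeasurePreserving_snd (μ := kernelMeasure ω)
    (ν := (volume.restrict (Icc (0 : ℝ) 1)).prod (kernelMeasure ω))).ae
    ((Measure.quasiMeasurePreserving_fst).ae (ae_restrict_mem measurableSet_Icc))
  have h3 := (Measure.quasiMeasurePreserving_snd (μ := kernelMeasure ω)
    (ν := (volume.restrict (Icc (0 : ℝ) 1)).prod (kernelMeasure ω))).ae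
    ((Measure.quasiMeasurePreserving_snd).ae (ae_kernelMeasure_mem hω))
  filter_upwards [h1, h2, h3] with q hq1 hq2 hq3
  exact shiftPoint_mem hM hc hc2 hε hε1 hq1 hq3 hq2

/-- The sum of the distributions of the shifts for the three neighbouring scales. -/
def totalShiftMeasure (A : ℝ) (ω : Space m → ℝ) (ε : ℝ) : Measure (Space m) :=
  shiftMeasure A ω (1 / 2) ε + shiftMeasure A ω 1 ε + shiftMeasure A ω 2 ε

lemma shiftMeasure_le_total (A : ℝ) (ω : Space m → ℝ) (ε : ℝ) {c : ℝ}
    (hc : c = 1 / 2 ∨ c = 1 ∨ c = 2) : shiftMeasure A ω c ε ≤ totalShiftMeasure A ω ε := by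
  unfold totalShiftMeasure
  rcases hc with rfl | rfl | rfl
  · exact Measure.le_add_right (Measure.le_add_right le_rfl)
  · exact Measure.le_add_right (Measure.le_add_left le_rfl)
  · exact Measure.le_add_left le_rfl

lemma totalShiftMeasure_univ (hω : IsKernel l ω) (A ε : ℝ) :
    totalShiftMeasure A ω ε univ = 3 * (kernelMeasure ω univ * kernelMeasure ω univ) := by
  simp only [totalShiftMeasure, Measure.coe_add, Pi.add_apply, shiftMeasure_univ hω]
  ring

lemma ae_totalShiftMeasure_mem (hM : 0 ≤ M) (hω : IsKernel l ω) {ε : ℝ} (hε : 0 ≤ ε)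
    (hε1 : ε ≤ 1) : ∀ᵐ ζ ∂(totalShiftMeasure (16 * (M + 1)) ω ε),
      ζ ∈ admissibleShifts M (64 * (M + 1)) := by
  simp only [totalShiftMeasure, ae_add_measure_iff]
  exact ⟨⟨ae_shiftMeasure_mem hM hω le_rfl (by norm_num) hε hε1,
    ae_shiftMeasure_mem hM hω (by norm_num) (by norm_num) hε hε1⟩,
    ae_shiftMeasure_mem hM hω (by norm_num) le_rfl hε hε1⟩

variable {𝕜 : Type*} [RCLike 𝕜]

/-- A family of representatives of the weak derivatives of order at most `l` of a function on `Ω`,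
extended by zero. -/
structure IsSobolevFamily (l : ℕ) (Ω : Set (Space m)) (f : List (Fin (m + 1)) → Space m → 𝕜) :
    Prop where
  stronglyMeasurable : ∀ L, StronglyMeasurable (f L)
  eq_zero : ∀ L, ∀ x ∉ Ω, f L x = 0
  locallyIntegrable : ∀ L, LocallyIntegrable (f L)
  isWeakDeriv : ∀ L, L.length ≤ l → IsWeakDeriv Ω (fun i => L.count i) (f []) (f L)

/-- The sum of the norms of the derivatives of order `l`. -/
def topNorm (l : ℕ) (f : List (Fin (m + 1)) → Space m → 𝕜) (y : Space m) : ℝ≥0∞ :=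
  ∑ w : Fin l → Fin (m + 1), ‖f (List.ofFn w) y‖ₑ

lemma IsSobolevFamily.measurable_topNorm {Ω : Set (Space m)}
    {f : List (Fin (m + 1)) → Space m → 𝕜} (hf : IsSobolevFamily l Ω f) :
    Measurable (topNorm l f) :=
  Finset.measurable_sum _ fun _ _ => (hf.stronglyMeasurable _).measurable.enorm

lemma enorm_le_topNorm (f : List (Fin (m + 1)) → Space m → 𝕜) (y : Space m)
    {L : List (Fin (m + 1))} (hL : L.length = l) : ‖f L y‖ₑ ≤ topNorm l f y := by
  subst hL
  have h := Finset.single_le_sum (f := fun w : Fin L.length → Fin (m + 1) => ‖f (List.ofFn w) y‖ₑ)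
    (fun _ _ => zero_le) (Finset.mem_univ L.get)
  simp only [List.ofFn_get] at h
  exact h

/-- The remainder estimate at scale `2⁻ʲ c`. -/
lemma enorm_moll_listDeriv_sub_taylorPoly_le (hM : 0 ≤ M)
    (hγ : ∀ x y, |γ x - γ y| ≤ M * ‖x - y‖) (hω : IsKernel l ω)
    {f : List (Fin (m + 1)) → Space m → 𝕜} (hf : IsSobolevFamily l (subgraph γ) f)
    {L : List (Fin (m + 1))} {q : ℕ} (hq : q ≠ 0) (hql : q + L.length = l) {x : Space m} {j : ℤ}
    (hx : rho γ x ≤ (2 : ℝ) ^ (-j)) {c ε : ℝ} (hc : 1 / 2 ≤ c) (hc2 : c ≤ 2) (hε : 0 < ε)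
    (hε1 : ε ≤ 1) :
    ‖moll (16 * (M + 1)) ω ((2 : ℝ) ^ (-j) * c)
        (listDeriv L (moll (16 * (M + 1)) ω ((2 : ℝ) ^ (-j) * ε) (f []))) x -
      taylorPoly q (listDeriv L (moll (16 * (M + 1)) ω ((2 : ℝ) ^ (-j) * ε) (f [])))
        (x - (2 : ℝ) ^ (-j) • stretch (16 * (M + 1)) (EuclideanSpace.single (Fin.last m) 1))
        ((2 : ℝ) ^ (-j) • stretch (16 * (M + 1)) (EuclideanSpace.single (Fin.last m) 1))‖ₑ ≤
      ENNReal.ofReal ((2 : ℝ) ^ (-j) * (48 * (M + 1))) ^ q * ((m + 1 : ℕ) : ℝ≥0∞) ^ q *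
        ∫⁻ ζ, topNorm l f (x - (2 : ℝ) ^ (-j) • ζ) ∂(shiftMeasure (16 * (M + 1)) ω c ε) := by
  set A := 16 * (M + 1) with hA
  set τ := (2 : ℝ) ^ (-j) with hτ
  have hτ0 : 0 < τ := by positivity
  have hA0 : A ≠ 0 := by rw [hA]; linarith
  set σ := stretch A (EuclideanSpace.single (Fin.last m) (1 : ℝ)) with hσ
  set h := listDeriv L (moll A ω (τ * ε) (f [])) with hh
  have hτε : τ * ε ≠ 0 := (mul_pos hτ0 hε).ne'
  have hsm : ContDiff ℝ (⊤ : ℕ∞) h := contDiff_listDeriv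
    (contDiff_moll hA0 hτε hω.smooth hω.hasCompactSupport (hf.locallyIntegrable [])) L
  -- `48 = 16 + 2·16`, since `c ≤ 2`.
  have hϱ : ∀ z ∈ kernelRegion m, ‖τ • σ - (τ * c) • stretch A z‖ ≤ τ * (48 * (M + 1)) := by
    intro z hz
    have n0 := norm_stretch_kernelRegion_le hM (single_last_mem_kernelRegion (m := m))
    have n1 := norm_stretch_kernelRegion_le hM hz
    rw [mul_smul, ← smul_sub, norm_smul, Real.norm_of_nonneg hτ0.le]
    gcongr
    refine (norm_sub_le _ _).trans ?_
    rw [norm_smul, Real.norm_of_nonneg (by linarith)]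
    have : c * ‖stretch A z‖ ≤ 2 * (16 * (M + 1)) := by gcongr
    linarith
  have h1 := enorm_moll_sub_taylorPoly_le hω A (τ * c) hq (by omega : q ≤ l) hsm (x - τ • σ)
    (τ • σ) hϱ
  rw [sub_add_cancel] at h1
  refine h1.trans ?_
  have hΘ : Measurable fun ζ => topNorm l f (x - τ • ζ) :=
    hf.measurable_topNorm.comp (by fun_prop)
  rw [lintegral_shiftMeasure hω A c ε hΘ, mul_assoc]
  rw [← lintegral_const_mul' _ _ (by simp), ← lintegral_const_mul' _ _ (by simp)]
  refine lintegral_mono fun z => ?_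
  by_cases hz : z ∈ tsupport ω
  swap
  · simp [image_eq_zero_of_notMem_tsupport hz]
  have hz' := hω.support_subset hz
  rw [mul_left_comm (((m + 1 : ℕ) : ℝ≥0∞) ^ q) ‖ω z‖ₑ,
    mul_left_comm (ENNReal.ofReal _ ^ q) ‖ω z‖ₑ]
  refine mul_le_mul_right ?_ _
  have hfin : ENNReal.ofReal (τ * (48 * (M + 1))) ^ q * ((m + 1 : ℕ) : ℝ≥0∞) ^ q ≠ ∞ :=
    ENNReal.mul_ne_top (ENNReal.pow_ne_top ENNReal.ofReal_ne_top)
      (ENNReal.pow_ne_top (ENNReal.natCast_ne_top _))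
  rw [← mul_assoc (ENNReal.ofReal _ ^ q), ← lintegral_const_mul' _ _ hfin]
  refine setLIntegral_mono' measurableSet_Icc fun s hs => ?_
  rw [mul_assoc]
  refine mul_le_mul_right ?_ _
  have key : ∀ w : Fin q → Fin (m + 1),
      ‖listDeriv (List.ofFn w) h (x - τ • σ + s • (τ • σ - (τ * c) • stretch A z))‖ₑ ≤
        ∫⁻ z', ‖ω z'‖ₑ * topNorm l f (x - τ • shiftPoint A c ε (z, s, z')) := by
    intro w
    -- A point of the Taylor segment, moved further by the small mollification, is again `x - τζ`
    -- with an admissible `ζ`. For this the expansion is taken about `x - τσ`, deep in Ω, and not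
    -- about `x`.
    have epoint : ∀ z', x - τ • σ + s • (τ • σ - (τ * c) • stretch A z) - (τ * ε) • stretch A z' =
        x - τ • shiftPoint A c ε (z, s, z') := by
      intro z'
      simp only [shiftPoint, ← hσ]
      module
    have hmem : ∀ z' ∈ tsupport ω,
        x - τ • σ + s • (τ • σ - (τ * c) • stretch A z) - (τ * ε) • stretch A z' ∈
          subgraph γ := by
      intro z' hz1
      rw [epoint]
      exact sub_shift_mem_subgraph hγ hx
        (shiftPoint_mem hM hc hc2 hε.le hε1 hz' (hω.support_subset hz1) hs)
    have hlen : (List.ofFn w ++ L).length = l := by simp [hql]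
    rw [hh, ← listDeriv_append, listDeriv_moll hA0 hτε hω.smooth hω.hasCompactSupport
      (hf.locallyIntegrable []) (hf.isWeakDeriv (List.ofFn w ++ L) hlen.le) hmem, moll]
    refine (enorm_integral_le_lintegral_enorm _).trans (lintegral_mono fun z' => ?_)
    rw [enorm_smul, epoint]
    gcongr
    exact enorm_le_topNorm f _ hlen
  refine (Finset.sum_le_card_nsmul _ _ _ fun w _ => key w).trans_eq ?_
  rw [nsmul_eq_mul]
  simp

/-- The scaling constant in the comparison of neighbouring mollifications. -/
def bracketConst (m : ℕ) (M : ℝ) (q : ℕ) (j : ℤ) : ℝ≥0∞ :=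
  ENNReal.ofReal ((2 : ℝ) ^ (-j) * (48 * (M + 1))) ^ q * ((m + 1 : ℕ) : ℝ≥0∞) ^ q

lemma bracketConst_ne_top (m : ℕ) (M : ℝ) (q : ℕ) (j : ℤ) : bracketConst m M q j ≠ ∞ :=
  ENNReal.mul_ne_top (ENNReal.pow_ne_top ENNReal.ofReal_ne_top)
    (ENNReal.pow_ne_top (ENNReal.natCast_ne_top _))

lemma zpow_neg_eq_mul {j k : ℤ} : (2 : ℝ) ^ (-k) = (2 : ℝ) ^ (-j) * (2 : ℝ) ^ (j - k) := by
  rw [← zpow_add₀ two_ne_zero]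
  congr 1
  ring

lemma zpow_neighbour {j k : ℤ} (hk : |k - j| ≤ 1) : (2 : ℝ) ^ (j - k) = 1 / 2 ∨
    (2 : ℝ) ^ (j - k) = 1 ∨ (2 : ℝ) ^ (j - k) = 2 := by
  rw [abs_le] at hk
  have : j - k = -1 ∨ j - k = 0 ∨ j - k = 1 := by omega
  rcases this with h | h | h <;> rw [h] <;> norm_num

/-- For `k ≤ j + 1` the descent `8·2⁻ᵏ ≥ 4·2⁻ʲ` exceeds the height of `x`. Smaller `k`, that is
larger shifts, are allowed. -/
lemma sub_smul_stretch_mem_subgraph (hM : 0 ≤ M) (hγ : ∀ x y, |γ x - γ y| ≤ M * ‖x - y‖)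
    {x z : Space m} {j k : ℤ} (hx : rho γ x ≤ (2 : ℝ) ^ (-j)) (hk : k - j ≤ 1)
    (hz : z ∈ kernelRegion m) :
    x - (2 : ℝ) ^ (-k) • stretch (16 * (M + 1)) z ∈ subgraph γ := by
  have h2 : (0 : ℝ) < (2 : ℝ) ^ (-k) := by positivity
  have h := rho_sub_le hγ x ((2 : ℝ) ^ (-k) • stretch (16 * (M + 1)) z)
  rw [descent_smul h2.le] at h
  have h3 := mul_le_mul_of_nonneg_left (eight_le_descent_stretch hM hz) h2.le
  have h4 : (2 : ℝ) ^ (-j) ≤ 2 * (2 : ℝ) ^ (-k) := by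
    rw [← zpow_one_add₀ two_ne_zero]
    exact zpow_le_zpow_right₀ one_le_two (by omega)
  rw [mem_subgraph_iff]
  linarith

/-- Removes the auxiliary smoothing: the derivative passes to `f L`, the two mollifications are
exchanged, and the small one then acts on a continuous function. -/
lemma tendsto_moll_listDeriv_moll (hM : 0 ≤ M) (hγ : ∀ x y, |γ x - γ y| ≤ M * ‖x - y‖)
    (hω : IsKernel l ω) {f : List (Fin (m + 1)) → Space m → 𝕜}
    (hf : IsSobolevFamily l (subgraph γ) f) {L : List (Fin (m + 1))} (hL : L.length ≤ l)
    {x : Space m} {j k : ℤ} (hx : rho γ x ≤ (2 : ℝ) ^ (-j)) (hk : k - j ≤ 1) :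
    Filter.Tendsto (fun N : ℕ => moll (16 * (M + 1)) ω ((2 : ℝ) ^ (-k))
        (listDeriv L (moll (16 * (M + 1)) ω ((2 : ℝ) ^ (-j) * (1 / ((N : ℝ) + 1))) (f []))) x)
      Filter.atTop (nhds (moll (16 * (M + 1)) ω ((2 : ℝ) ^ (-k)) (f L) x)) := by
  have hA0 : 16 * (M + 1) ≠ 0 := by linarith
  have hτ0 : (0 : ℝ) < (2 : ℝ) ^ (-j) := by positivity
  have hk0 : (2 : ℝ) ^ (-k) ≠ 0 := by positivity
  have hcs := hω.hasCompactSupport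
  have hε : Filter.Tendsto (fun N : ℕ => (2 : ℝ) ^ (-j) * (1 / ((N : ℝ) + 1))) Filter.atTop
      (nhds 0) := by
    simpa using tendsto_one_div_add_atTop_nhds_zero_nat.const_mul ((2 : ℝ) ^ (-j))
  have h := tendsto_moll (A := 16 * (M + 1)) hcs hω.smooth.continuous hω.integral_eq_one
    (contDiff_moll hA0 hk0 hω.smooth hcs (hf.locallyIntegrable L)).continuous x hε
  refine h.congr fun N => ?_
  have hε0 : (0 : ℝ) < 1 / ((N : ℝ) + 1) := by positivity
  have hτε : (2 : ℝ) ^ (-j) * (1 / ((N : ℝ) + 1)) ≠ 0 := by positivity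
  rw [moll_moll_comm hA0 hτε hk0 hω.smooth hcs (hf.locallyIntegrable L), moll, moll]
  congr 1
  funext z
  by_cases hz : z ∈ tsupport ω
  · rw [listDeriv_moll hA0 hτε hω.smooth hcs (hf.locallyIntegrable []) (hf.isWeakDeriv L hL)]
    intro z' hz'
    have h1 := mem_subgraph_iff.1 (sub_smul_stretch_mem_subgraph hM hγ hx hk (hω.support_subset hz))
    rw [mem_subgraph_iff]
    have h2 := rho_sub_le hγ (x - (2 : ℝ) ^ (-k) • stretch (16 * (M + 1)) z)
      (((2 : ℝ) ^ (-j) * (1 / ((N : ℝ) + 1))) • stretch (16 * (M + 1)) z')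
    rw [descent_smul (by positivity)] at h2
    have h3 := eight_le_descent_stretch hM (hω.support_subset hz')
    have h4 : 0 ≤ ((2 : ℝ) ^ (-j) * (1 / ((N : ℝ) + 1))) *
        descent M (stretch (16 * (M + 1)) z') := mul_nonneg (by positivity) (by linarith)
    linarith
  · simp [image_eq_zero_of_notMem_tsupport hz]

/-- Mollifications of a derivative of order less than `l` at neighbouring scales differ by an
average of the derivatives of order `l`. -/
lemma enorm_moll_sub_moll_le (hM : 0 ≤ M) (hγ : ∀ x y, |γ x - γ y| ≤ M * ‖x - y‖)
    (hω : IsKernel l ω) {f : List (Fin (m + 1)) → Space m → 𝕜}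
    (hf : IsSobolevFamily l (subgraph γ) f) {L : List (Fin (m + 1))} {q : ℕ} (hq : q ≠ 0)
    (hql : q + L.length = l) {x : Space m} {j k : ℤ} (hx : rho γ x ≤ (2 : ℝ) ^ (-j))
    (hk : |k - j| ≤ 1) :
    ‖moll (16 * (M + 1)) ω ((2 : ℝ) ^ (-k)) (f L) x -
      moll (16 * (M + 1)) ω ((2 : ℝ) ^ (-j)) (f L) x‖ₑ ≤
      2 * bracketConst m M q j * Filter.liminf (fun N : ℕ => ∫⁻ ζ,
        topNorm l f (x - (2 : ℝ) ^ (-j) • ζ)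
          ∂(totalShiftMeasure (16 * (M + 1)) ω (1 / ((N : ℝ) + 1)))) Filter.atTop := by
  have hk' := abs_le.1 hk
  have hlim := (tendsto_moll_listDeriv_moll hM hγ hω hf (L := L) (by omega) hx hk'.2).sub
    (tendsto_moll_listDeriv_moll hM hγ hω hf (L := L) (by omega) hx (by simp : j - j ≤ 1))
  have hfin : 2 * bracketConst m M q j ≠ ∞ :=
    ENNReal.mul_ne_top (by simp) (bracketConst_ne_top m M q j)
  -- The bound is proved for each auxiliary scale `2⁻ʲ/(N+1)`. On the left there is convergence,
  -- while on the right the measure varies with `N` and only the lower limit is kept.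
  rw [← ENNReal.liminf_const_mul_of_ne_top hfin, ← hlim.enorm.liminf_eq]
  refine Filter.liminf_le_liminf (Filter.Eventually.of_forall fun N => ?_)
  have hε0 : (0 : ℝ) < 1 / ((N : ℝ) + 1) := by positivity
  have hε1 : 1 / ((N : ℝ) + 1) ≤ 1 := by
    rw [div_le_one (by positivity)]
    have : (0 : ℝ) ≤ N := by positivity
    linarith
  have key : ∀ i : ℤ, |i - j| ≤ 1 →
      ‖moll (16 * (M + 1)) ω ((2 : ℝ) ^ (-i)) (listDeriv L
          (moll (16 * (M + 1)) ω ((2 : ℝ) ^ (-j) * (1 / ((N : ℝ) + 1))) (f []))) x -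
        taylorPoly q (listDeriv L
            (moll (16 * (M + 1)) ω ((2 : ℝ) ^ (-j) * (1 / ((N : ℝ) + 1))) (f [])))
          (x - (2 : ℝ) ^ (-j) • stretch (16 * (M + 1)) (EuclideanSpace.single (Fin.last m) 1))
          ((2 : ℝ) ^ (-j) • stretch (16 * (M + 1)) (EuclideanSpace.single (Fin.last m) 1))‖ₑ ≤
        bracketConst m M q j * ∫⁻ ζ, topNorm l f (x - (2 : ℝ) ^ (-j) • ζ)
          ∂(totalShiftMeasure (16 * (M + 1)) ω (1 / ((N : ℝ) + 1))) := by
    intro i hi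
    have hc := zpow_neighbour hi
    have h := enorm_moll_listDeriv_sub_taylorPoly_le hM hγ hω hf hq hql hx
      (c := (2 : ℝ) ^ (j - i)) (by rcases hc with h | h | h <;> rw [h] <;> norm_num)
      (by rcases hc with h | h | h <;> rw [h] <;> norm_num) hε0 hε1
    rw [← zpow_neg_eq_mul] at h
    refine h.trans ?_
    rw [bracketConst]
    gcongr
    exact shiftMeasure_le_total _ _ _ hc
  have h := add_le_add (key k hk) (key j (by simp))
  -- Both mollifications are compared with the same Taylor polynomial, which cancels; this costs the
  -- factor 2.
  rw [← sub_sub_sub_cancel_right _ _ (taylorPoly q (listDeriv L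
    (moll (16 * (M + 1)) ω ((2 : ℝ) ^ (-j) * (1 / ((N : ℝ) + 1))) (f [])))
    (x - (2 : ℝ) ^ (-j) • stretch (16 * (M + 1)) (EuclideanSpace.single (Fin.last m) 1))
    ((2 : ℝ) ^ (-j) • stretch (16 * (M + 1)) (EuclideanSpace.single (Fin.last m) 1)))]
  refine (enorm_sub_le.trans h).trans_eq ?_
  ring

end Bracket

/-! ### The partition of unity -/

section Partition

variable {m : ℕ} {γ : EuclideanSpace ℝ (Fin m) → ℝ} {M : ℝ} {ψ : ℤ → Space m → ℝ}

lemma IsPartition.abs_sub_le_one (hψ : IsPartition γ ψ) {x : Space m} {j k : ℤ}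
    (hx : x ∈ layer γ j) (hk : x ∈ tsupport (ψ k)) : |k - j| ≤ 1 := by
  rw [abs_le]
  rcases hψ.support_subset k hk with (h | h) | h
  · have := eq_of_mem_layer hx h
    omega
  · have := eq_of_mem_layer hx h
    omega
  · have := eq_of_mem_layer hx h
    omega

lemma IsPartition.listDeriv_eq_zero_of_layer (hψ : IsPartition γ ψ) {x : Space m} {j k : ℤ}
    (hx : x ∈ layer γ j) (hk : k ∉ Finset.Icc (j - 1) (j + 1)) (L : List (Fin (m + 1))) :
    listDeriv L (ψ k) x = 0 := by
  by_contra h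
  have h1 := hψ.abs_sub_le_one hx (tsupport_listDeriv_subset _ L (subset_tsupport _ h))
  rw [abs_le] at h1
  apply hk
  rw [Finset.mem_Icc]
  omega

lemma IsPartition.listDeriv_eq_zero_of_notMem (hψ : IsPartition γ ψ) {x : Space m}
    (hx : x ∉ exterior γ) (k : ℤ) (L : List (Fin (m + 1))) : listDeriv L (ψ k) x = 0 := by
  by_contra h
  apply hx
  rw [hψ.cover, mem_iUnion]
  exact ⟨k, tsupport_listDeriv_subset _ L (subset_tsupport _ h)⟩

lemma IsPartition.sum_layer (hψ : IsPartition γ ψ) {x : Space m} {j : ℤ} (hx : x ∈ layer γ j)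
    {s : Finset ℤ} (hs : Finset.Icc (j - 1) (j + 1) ⊆ s) : ∑ k ∈ s, ψ k x = 1 := by
  rw [← (hψ.sum_eq_one x hx.1).tsum_eq, tsum_eq_sum]
  intro k hk
  exact hψ.listDeriv_eq_zero_of_layer hx (fun h => hk (hs h)) []

/-- The identity `∑ ψ_k = 1` is needed in a neighbourhood of `x`, and `x` may lie at the edge of its
layer. Nearby points lie in the layers `j - 1`, `j`, `j + 1`, so the indices from `j - 2` to `j + 2`
suffice locally. -/
lemma IsPartition.sum_listDeriv_layer (hM : 0 ≤ M) (hγ : ∀ x y, |γ x - γ y| ≤ M * ‖x - y‖)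
    (hψ : IsPartition γ ψ) {x : Space m} {j : ℤ} (hx : x ∈ layer γ j) {s : Finset ℤ}
    (hs : Finset.Icc (j - 1) (j + 1) ⊆ s) {L : List (Fin (m + 1))} (hL : L ≠ []) :
    ∑ k ∈ s, listDeriv L (ψ k) x = 0 := by
  have hvan : ∀ k ∉ Finset.Icc (j - 1) (j + 1), listDeriv L (ψ k) x = 0 :=
    fun k hk => hψ.listDeriv_eq_zero_of_layer hx hk L
  rw [← Finset.sum_subset hs fun k _ hk => hvan k hk]
  have hs2 : Finset.Icc (j - 1) (j + 1) ⊆ Finset.Icc (j - 2) (j + 2) := by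
    intro k hk
    rw [Finset.mem_Icc] at hk ⊢
    omega
  rw [Finset.sum_subset hs2 fun k _ hk => hvan k hk]
  have hc := continuous_rho (m := m) hM hγ
  have hU : IsOpen (rho γ ⁻¹' Ioo ((2 : ℝ) ^ (-j - 2)) ((2 : ℝ) ^ (-j + 1)) : Set (Space m)) :=
    isOpen_Ioo.preimage hc
  have hxU : x ∈ (rho γ ⁻¹' Ioo ((2 : ℝ) ^ (-j - 2)) ((2 : ℝ) ^ (-j + 1)) : Set (Space m)) := by
    constructor
    · exact lt_trans (zpow_lt_zpow_right₀ one_lt_two (by omega)) hx.2.1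
    · exact lt_of_le_of_lt hx.2.2 (zpow_lt_zpow_right₀ one_lt_two (by omega))
  have hloc : (fun y => ∑ k ∈ Finset.Icc (j - 2) (j + 2), ψ k y) =ᶠ[nhds x] fun _ => 1 := by
    filter_upwards [hU.mem_nhds hxU] with y hy
    have hyG : y ∈ exterior γ :=
      (mem_exterior_iff hM hγ).2 (lt_trans (by positivity) hy.1)
    obtain ⟨i, hi⟩ := exists_mem_layer hM hγ hyG
    refine hψ.sum_layer hi ?_
    have h1 := (zpow_lt_zpow_iff_right₀ (one_lt_two (α := ℝ))).1 (hi.2.1.trans hy.2)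
    have h2 := (zpow_lt_zpow_iff_right₀ (one_lt_two (α := ℝ))).1 (hy.1.trans_le hi.2.2)
    intro k hk
    rw [Finset.mem_Icc] at hk ⊢
    omega
  have h := (listDeriv_congr hloc L).eq_of_nhds
  rw [listDeriv_finset_sum _ _ (fun k _ => hψ.smooth k), listDeriv_const _ hL] at h
  exact h

lemma IsPartition.exists_listDeriv_le (hψ : IsPartition γ ψ) (L : List (Fin (m + 1))) :
    ∃ C : ℝ, 0 ≤ C ∧ ∀ (k : ℤ) (x : Space m), |listDeriv L (ψ k) x| ≤ C * 2 ^ (k * (L.length : ℤ)) := by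
  obtain ⟨C, hC⟩ := hψ.deriv_bound fun i => L.count i
  refine ⟨C, ?_, fun k x => ?_⟩
  · have h := (abs_nonneg _).trans (hC 0 0)
    simpa using h
  · have h := hC k x
    rwa [order_count, ← listDeriv_eq_multiDeriv (hψ.smooth k)] at h

lemma IsPartition.summable_sum_le (hψ : IsPartition γ ψ) (s : Finset ℤ) (x : Space m) :
    ∑ k ∈ s, ψ k x ≤ 1 := by
  by_cases hx : x ∈ exterior γ
  · exact sum_le_hasSum s (fun k _ => hψ.nonneg k x) (hψ.sum_eq_one x hx)
  · refine (Finset.sum_eq_zero fun k _ => ?_).trans_le zero_le_one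
    exact hψ.listDeriv_eq_zero_of_notMem hx k []

lemma IsPartition.tsum_layer {V : Type*} [AddCommMonoid V] [TopologicalSpace V]
    [Module ℝ V] (hψ : IsPartition γ ψ) {x : Space m} {j : ℤ} (hx : x ∈ layer γ j) {s : Finset ℤ}
    (hs : Finset.Icc (j - 1) (j + 1) ⊆ s) (L : List (Fin (m + 1))) (c : ℤ → V) :
    ∑' k, listDeriv L (ψ k) x • c k = ∑ k ∈ s, listDeriv L (ψ k) x • c k := by
  apply tsum_eq_sum
  intro k hk
  rw [hψ.listDeriv_eq_zero_of_layer hx (fun h => hk (hs h)), zero_smul]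

end Partition

/-! ### Sums over the layers -/

section LayerSum

variable {m l : ℕ} {γ : EuclideanSpace ℝ (Fin m) → ℝ} {M : ℝ} {ψ : ℤ → Space m → ℝ}
  {ω : Space m → ℝ} {𝕜 : Type*} [RCLike 𝕜]

/-- The sum `∑_k D_L ψ_k f_k`. -/
def layerSum (M : ℝ) (ψ : ℤ → Space m → ℝ) (ω : Space m → ℝ) (L : List (Fin (m + 1)))
    (F : Space m → 𝕜) (x : Space m) : 𝕜 :=
  ∑' k : ℤ, listDeriv L (ψ k) x • mollified (16 * (M + 1)) ω F k x

lemma mollified_eq_moll (A : ℝ) (ω : Space m → ℝ) (F : Space m → 𝕜) (k : ℤ) :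
    mollified A ω F k = moll A ω ((2 : ℝ) ^ (-k)) F := rfl

lemma layerSum_eq_zero (hψ : IsPartition γ ψ) {x : Space m} (hx : x ∉ exterior γ)
    (L : List (Fin (m + 1))) (F : Space m → 𝕜) : layerSum M ψ ω L F x = 0 := by
  simp [layerSum, hψ.listDeriv_eq_zero_of_notMem hx]

lemma disjoint_subgraph_exterior {x : Space m} (hx : x ∈ subgraph γ) : x ∉ exterior γ :=
  fun h => h (subset_closure hx)

/-- `layerSum` vanishes off the exterior and `F` off Ω, so the definition by cases becomes a sum. On
`∂Ω` both vanish, in agreement with the value 0 chosen there. -/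
lemma burenkovExt_eq_add (hψ : IsPartition γ ψ) {F : Space m → 𝕜}
    (hF : ∀ x ∉ subgraph γ, F x = 0) (x : Space m) :
    burenkovExt γ M ψ ω F x = F x + layerSum M ψ ω [] F x := by
  unfold burenkovExt
  split_ifs with h1 h2
  · rw [layerSum_eq_zero hψ (disjoint_subgraph_exterior h1), add_zero]
  · rw [hF x h1, zero_add]
    rfl
  · rw [hF x h1, layerSum_eq_zero hψ h2, add_zero]

lemma contDiff_mollified (hM : 0 ≤ M) (hω : IsKernel l ω) {F : Space m → 𝕜}
    (hF : LocallyIntegrable F) (k : ℤ) :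
    ContDiff ℝ (⊤ : ℕ∞) (mollified (16 * (M + 1)) ω F k) :=
  contDiff_moll (by linarith) (by positivity) hω.smooth hω.hasCompactSupport hF

lemma measurable_layerSum (hM : 0 ≤ M) (hψ : IsPartition γ ψ) (hω : IsKernel l ω)
    {F : Space m → 𝕜} (hF : LocallyIntegrable F) (L : List (Fin (m + 1))) :
    Measurable (layerSum M ψ ω L F) :=
  Measurable.tsum fun k => ((contDiff_listDeriv (hψ.smooth k) L).continuous.smul
    (contDiff_mollified hM hω hF k).continuous).measurable

/-- The distribution of the dilated kernel. -/
def dilationMeasure (A : ℝ) (ω : Space m → ℝ) (c : ℝ) : Measure (Space m) :=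
  Measure.map (fun z => c • stretch A z) (kernelMeasure ω)

/-- The sum of the distributions of the kernels at the three neighbouring scales. -/
def totalDilationMeasure (A : ℝ) (ω : Space m → ℝ) : Measure (Space m) :=
  dilationMeasure A ω (1 / 2) + dilationMeasure A ω 1 + dilationMeasure A ω 2

lemma dilationMeasure_le_total (A : ℝ) (ω : Space m → ℝ) {c : ℝ}
    (hc : c = 1 / 2 ∨ c = 1 ∨ c = 2) : dilationMeasure A ω c ≤ totalDilationMeasure A ω := by
  unfold totalDilationMeasure
  rcases hc with rfl | rfl | rfl
  · exact Measure.le_add_right (Measure.le_add_right le_rfl)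
  · exact Measure.le_add_right (Measure.le_add_left le_rfl)
  · exact Measure.le_add_left le_rfl

lemma totalDilationMeasure_univ (A : ℝ) (ω : Space m → ℝ) :
    totalDilationMeasure A ω univ = 3 * kernelMeasure ω univ := by
  have h : ∀ c, dilationMeasure A ω c univ = kernelMeasure ω univ := by
    intro c
    rw [dilationMeasure, Measure.map_apply (continuous_smul_stretch A c).measurable
      MeasurableSet.univ, preimage_univ]
  simp only [totalDilationMeasure, Measure.coe_add, Pi.add_apply, h]
  ring

lemma isClosed_admissibleShifts (M R : ℝ) : IsClosed (admissibleShifts (m := m) M R) := by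
  have hb : Continuous (bar : Space m → _) := by
    unfold bar
    fun_prop
  have hd : Continuous (descent M : Space m → ℝ) := by
    unfold descent
    fun_prop
  exact (isClosed_le continuous_norm continuous_const).inter (isClosed_le continuous_const hd)

lemma ae_totalDilationMeasure_mem (hM : 0 ≤ M) (hω : IsKernel l ω) :
    ∀ᵐ ζ ∂(totalDilationMeasure (16 * (M + 1)) ω), ζ ∈ admissibleShifts M (64 * (M + 1)) := by
  have h : ∀ c : ℝ, 1 / 2 ≤ c → c ≤ 2 → ∀ᵐ ζ ∂(dilationMeasure (16 * (M + 1)) ω c),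
      ζ ∈ admissibleShifts M (64 * (M + 1)) := by
    intro c hc hc2
    have hmap := ae_map_iff (p := fun ζ => ζ ∈ admissibleShifts M (64 * (M + 1)))
      (μ := kernelMeasure ω) (continuous_smul_stretch (16 * (M + 1)) c).measurable.aemeasurable
      (isClosed_admissibleShifts M _).measurableSet
    rw [dilationMeasure, hmap]
    filter_upwards [ae_kernelMeasure_mem hω] with z hz
    have h1 := norm_stretch_kernelRegion_le hM hz
    have h2 := eight_le_descent_stretch hM hz
    constructor
    · rw [norm_smul, Real.norm_of_nonneg (by linarith)]
      nlinarith
    · rw [descent_smul (by linarith)]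
      nlinarith
  simp only [totalDilationMeasure, ae_add_measure_iff]
  exact ⟨⟨h _ le_rfl (by norm_num), h _ (by norm_num) (by norm_num)⟩, h _ (by norm_num) le_rfl⟩

/-- Writing `2⁻ᵏ = 2⁻ʲc` with `c` equal to 1/2, 1 or 2 gives one measure that serves all layers and
all their neighbours. -/
lemma enorm_mollified_le (hω : IsKernel l ω) {F : Space m → 𝕜} (hF : StronglyMeasurable F)
    {j k : ℤ} (hk : |k - j| ≤ 1) (x : Space m) (A : ℝ) :
    ‖mollified A ω F k x‖ₑ ≤
      ∫⁻ ζ, ‖F (x - (2 : ℝ) ^ (-j) • ζ)‖ₑ ∂(totalDilationMeasure A ω) := by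
  have hm : Measurable fun ζ => ‖F (x - (2 : ℝ) ^ (-j) • ζ)‖ₑ :=
    hF.measurable.enorm.comp (by fun_prop)
  have hcs := (continuous_smul_stretch (m := m) A ((2 : ℝ) ^ (j - k))).measurable
  calc ‖mollified A ω F k x‖ₑ
      ≤ ∫⁻ z, ‖ω z‖ₑ * ‖F (x - (2 : ℝ) ^ (-j) • (2 : ℝ) ^ (j - k) • stretch A z)‖ₑ := by
        refine (enorm_integral_le_lintegral_enorm _).trans_eq (lintegral_congr fun z => ?_)
        rw [enorm_smul, smul_smul, ← zpow_neg_eq_mul]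
    _ = ∫⁻ ζ, ‖F (x - (2 : ℝ) ^ (-j) • ζ)‖ₑ ∂(dilationMeasure A ω ((2 : ℝ) ^ (j - k))) := by
        rw [dilationMeasure, lintegral_map hm hcs]
        exact (lintegral_kernelMeasure hω (hm.comp hcs)).symm
    _ ≤ ∫⁻ ζ, ‖F (x - (2 : ℝ) ^ (-j) • ζ)‖ₑ ∂(totalDilationMeasure A ω) :=
        lintegral_mono' (dilationMeasure_le_total A ω (zpow_neighbour hk)) le_rfl

lemma abs_sub_le_one_of_mem {j k : ℤ} (hk : k ∈ Finset.Icc (j - 1) (j + 1)) : |k - j| ≤ 1 := by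
  rw [Finset.mem_Icc] at hk
  rw [abs_le]
  omega

/-- The weights `ψ_k(x)` sum to 1, so no constant is lost. The sum of norms serves as the majorant
for finite sums in dominated convergence. -/
lemma tsum_mul_enorm_mollified_le (hψ : IsPartition γ ψ) (hω : IsKernel l ω) {F : Space m → 𝕜}
    (hF : StronglyMeasurable F) {j : ℤ} {x : Space m} (hx : x ∈ layer γ j) (A : ℝ) :
    ‖∑' k, ψ k x • ‖mollified A ω F k x‖‖ₑ ≤
      ∫⁻ ζ, ‖F (x - (2 : ℝ) ^ (-j) • ζ)‖ₑ ∂(totalDilationMeasure A ω) := by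
  have h := hψ.tsum_layer hx le_rfl [] fun k => ‖mollified A ω F k x‖
  simp only [listDeriv_nil] at h
  rw [h]
  refine (enorm_sum_le _ _).trans ?_
  calc ∑ k ∈ Finset.Icc (j - 1) (j + 1), ‖ψ k x • ‖mollified A ω F k x‖‖ₑ
      ≤ ∑ k ∈ Finset.Icc (j - 1) (j + 1), ENNReal.ofReal (ψ k x) *
        ∫⁻ ζ, ‖F (x - (2 : ℝ) ^ (-j) • ζ)‖ₑ ∂(totalDilationMeasure A ω) := by
        refine Finset.sum_le_sum fun k hk => ?_
        rw [enorm_smul, enorm_norm, Real.enorm_of_nonneg (hψ.nonneg k x)]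
        gcongr
        exact enorm_mollified_le hω hF (abs_sub_le_one_of_mem hk) x A
    _ = ∫⁻ ζ, ‖F (x - (2 : ℝ) ^ (-j) • ζ)‖ₑ ∂(totalDilationMeasure A ω) := by
        rw [← Finset.sum_mul, ← ENNReal.ofReal_sum_of_nonneg fun k _ => hψ.nonneg k x,
          hψ.sum_layer hx le_rfl, ENNReal.ofReal_one, one_mul]

lemma enorm_layerSum_nil_le (hψ : IsPartition γ ψ) (hω : IsKernel l ω) {F : Space m → 𝕜}
    (hF : StronglyMeasurable F) {j : ℤ} {x : Space m} (hx : x ∈ layer γ j) :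
    ‖layerSum M ψ ω [] F x‖ₑ ≤
      ∫⁻ ζ, ‖F (x - (2 : ℝ) ^ (-j) • ζ)‖ₑ ∂(totalDilationMeasure (16 * (M + 1)) ω) := by
  refine le_trans ?_ (tsum_mul_enorm_mollified_le hψ hω hF hx (16 * (M + 1)))
  have h := hψ.tsum_layer hx le_rfl [] fun k => ‖mollified (16 * (M + 1)) ω F k x‖
  simp only [listDeriv_nil] at h
  rw [layerSum, hψ.tsum_layer hx le_rfl [], h, enorm_le_iff_norm_le]
  refine (norm_sum_le _ _).trans ((Finset.sum_le_sum fun k _ => ?_).trans (le_abs_self _))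
  rw [norm_smul, listDeriv_nil, Real.norm_of_nonneg (hψ.nonneg k x)]
  rfl

/-- The local `Lᵖ` estimate for functions on the exterior which are controlled by averages. -/
lemma exists_lintegral_layerSum_nil_le (hM : 0 ≤ M) (hγ : ∀ x y, |γ x - γ y| ≤ M * ‖x - y‖)
    (hω : IsKernel l ω) {p : ℝ} (hp : 1 ≤ p) : ∃ C : ℝ≥0∞, C ≠ ∞ ∧
      ∀ Θ : Space m → ℝ≥0∞, Measurable Θ → ∀ u : Space m → ℝ≥0∞,
      (∀ j, ∀ x ∈ layer γ j, u x ≤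
        ∫⁻ ζ, Θ (x - (2 : ℝ) ^ (-j) • ζ) ∂(totalDilationMeasure (16 * (M + 1)) ω)) →
      ∀ r, 0 < r → ∀ (x₀ : Space m) (T : ℝ≥0∞),
      (∀ y ∈ subgraph γ, ∫⁻ x in Metric.ball y r ∩ subgraph γ, Θ x ^ p ≤ T) →
      ∫⁻ x in Metric.ball x₀ r ∩ exterior γ, u x ^ p ≤ C * T := by
  obtain ⟨C, hC⟩ := exists_setLIntegral_rpow_le (m := m) hM hγ
    (R := 64 * (M + 1)) (by linarith)
  have hW : 3 * kernelMeasure ω univ ≠ ∞ :=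
    ENNReal.mul_ne_top (by simp) (kernelMeasure_univ_lt_top hω).ne
  refine ⟨C * (3 * kernelMeasure ω univ) ^ p, ENNReal.mul_ne_top (by simp)
    (ENNReal.rpow_ne_top_of_nonneg (by linarith) hW), ?_⟩
  intro Θ hΘ u hu r hr x₀ T hT
  refine hC p hp _ hW (fun _ => totalDilationMeasure (16 * (M + 1)) ω)
    (fun _ => (totalDilationMeasure_univ _ ω).le) (fun _ => ae_totalDilationMeasure_mem hM hω)
    Θ hΘ u ?_ r hr x₀ T hT
  intro j x hx
  rw [Filter.liminf_const]
  exact hu j x hx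

lemma exists_lintegral_bracket_le (hM : 0 ≤ M) (hγ : ∀ x y, |γ x - γ y| ≤ M * ‖x - y‖)
    (hω : IsKernel l ω) {p : ℝ} (hp : 1 ≤ p) : ∃ C : ℝ≥0∞, C ≠ ∞ ∧
      ∀ Θ : Space m → ℝ≥0∞, Measurable Θ → ∀ u : Space m → ℝ≥0∞,
      (∀ j, ∀ x ∈ layer γ j, u x ≤ Filter.liminf (fun N : ℕ =>
        ∫⁻ ζ, Θ (x - (2 : ℝ) ^ (-j) • ζ)
          ∂(totalShiftMeasure (16 * (M + 1)) ω (1 / ((N : ℝ) + 1)))) Filter.atTop) →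
      ∀ r, 0 < r → ∀ (x₀ : Space m) (T : ℝ≥0∞),
      (∀ y ∈ subgraph γ, ∫⁻ x in Metric.ball y r ∩ subgraph γ, Θ x ^ p ≤ T) →
      ∫⁻ x in Metric.ball x₀ r ∩ exterior γ, u x ^ p ≤ C * T := by
  obtain ⟨C, hC⟩ := exists_setLIntegral_rpow_le (m := m) hM hγ
    (R := 64 * (M + 1)) (by linarith)
  have hK := (kernelMeasure_univ_lt_top hω).ne
  have hW : 3 * (kernelMeasure ω univ * kernelMeasure ω univ) ≠ ∞ :=
    ENNReal.mul_ne_top (by simp) (ENNReal.mul_ne_top hK hK)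
  refine ⟨C * (3 * (kernelMeasure ω univ * kernelMeasure ω univ)) ^ p, ENNReal.mul_ne_top (by simp)
    (ENNReal.rpow_ne_top_of_nonneg (by linarith) hW), ?_⟩
  intro Θ hΘ u hu r hr x₀ T hT
  refine hC p hp _ hW (fun N => totalShiftMeasure (16 * (M + 1)) ω (1 / ((N : ℝ) + 1)))
    (fun _ => (totalShiftMeasure_univ hω _ _).le) (fun N => ?_) Θ hΘ u hu r hr x₀ T hT
  refine ae_totalShiftMeasure_mem hM hω (by positivity) ?_
  rw [div_le_one (by positivity)]
  have : (0 : ℝ) ≤ N := by positivity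
  linarith

/-- The function that dominates the terms with derivatives on the partition functions. -/
def bracketSum (γ : EuclideanSpace ℝ (Fin m) → ℝ) (M : ℝ) (ψ : ℤ → Space m → ℝ)
    (ω : Space m → ℝ) (L : List (Fin (m + 1))) (F : Space m → 𝕜) (x : Space m) : ℝ :=
  ∑' j : ℤ, (layer γ j).indicator (fun x => ∑ k ∈ Finset.Icc (j - 1) (j + 1),
    |listDeriv L (ψ k) x| *
      ‖mollified (16 * (M + 1)) ω F k x - mollified (16 * (M + 1)) ω F j x‖) x

lemma measurable_bracketSum (hM : 0 ≤ M) (hγ : ∀ x y, |γ x - γ y| ≤ M * ‖x - y‖)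
    (hψ : IsPartition γ ψ) (hω : IsKernel l ω) {F : Space m → 𝕜} (hF : LocallyIntegrable F)
    (L : List (Fin (m + 1))) : Measurable (bracketSum γ M ψ ω L F) := by
  refine Measurable.tsum fun j => Measurable.indicator ?_ (measurableSet_layer hM hγ j)
  refine Finset.measurable_sum _ fun k _ => Continuous.measurable ?_
  exact (contDiff_listDeriv (hψ.smooth k) L).continuous.abs.mul
    ((contDiff_mollified hM hω hF k).continuous.sub
      (contDiff_mollified hM hω hF j).continuous).norm

lemma bracketSum_of_mem {x : Space m} {j : ℤ} (hx : x ∈ layer γ j) (L : List (Fin (m + 1)))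
    (F : Space m → 𝕜) : bracketSum γ M ψ ω L F x = ∑ k ∈ Finset.Icc (j - 1) (j + 1),
      |listDeriv L (ψ k) x| *
        ‖mollified (16 * (M + 1)) ω F k x - mollified (16 * (M + 1)) ω F j x‖ := by
  rw [bracketSum, tsum_eq_single j]
  · exact indicator_of_mem hx _
  · intro k hk
    exact indicator_of_notMem (fun h => hk (eq_of_mem_layer h hx)) _

lemma bracketSum_of_notMem {x : Space m} (hx : x ∉ exterior γ) (L : List (Fin (m + 1)))
    (F : Space m → 𝕜) : bracketSum γ M ψ ω L F x = 0 := by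
  have h : ∀ j, x ∉ layer γ j := fun j hj => hx hj.1
  simp [bracketSum, h]

/-- Since `∑_k D_L ψ_k = 0`, the common value at scale `2⁻ʲ` may be subtracted. Without this
difference the factors `D_L ψ_k` would blow up at the boundary. -/
lemma layerSum_eq_sum_sub (hM : 0 ≤ M) (hγ : ∀ x y, |γ x - γ y| ≤ M * ‖x - y‖)
    (hψ : IsPartition γ ψ) {x : Space m} {j : ℤ} (hx : x ∈ layer γ j) {L : List (Fin (m + 1))}
    (hL : L ≠ []) (F : Space m → 𝕜) : layerSum M ψ ω L F x =
      ∑ k ∈ Finset.Icc (j - 1) (j + 1), listDeriv L (ψ k) x •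
        (mollified (16 * (M + 1)) ω F k x - mollified (16 * (M + 1)) ω F j x) := by
  rw [layerSum, hψ.tsum_layer hx le_rfl]
  simp only [smul_sub, Finset.sum_sub_distrib]
  rw [← Finset.sum_smul, hψ.sum_listDeriv_layer hM hγ hx le_rfl hL, zero_smul, sub_zero]

lemma norm_layerSum_le_bracketSum (hM : 0 ≤ M) (hγ : ∀ x y, |γ x - γ y| ≤ M * ‖x - y‖)
    (hψ : IsPartition γ ψ) {L : List (Fin (m + 1))} (hL : L ≠ []) (F : Space m → 𝕜)
    (x : Space m) : ‖layerSum M ψ ω L F x‖ ≤ bracketSum γ M ψ ω L F x := by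
  by_cases hx : x ∈ exterior γ
  · obtain ⟨j, hj⟩ := exists_mem_layer hM hγ hx
    rw [layerSum_eq_sum_sub hM hγ hψ hj hL, bracketSum_of_mem hj]
    refine (norm_sum_le _ _).trans (Finset.sum_le_sum fun k _ => ?_)
    rw [norm_smul, Real.norm_eq_abs]
  · rw [layerSum_eq_zero hψ hx, bracketSum_of_notMem hx, norm_zero]

/-- The terms with derivatives on the partition functions are controlled by averages of the
derivatives of order `l`. -/
lemma exists_enorm_bracketSum_le (hM : 0 ≤ M) (hγ : ∀ x y, |γ x - γ y| ≤ M * ‖x - y‖)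
    (hψ : IsPartition γ ψ) (hω : IsKernel l ω) {a b : List (Fin (m + 1))} (ha : a ≠ [])
    (hab : a.length + b.length = l) : ∃ K : ℝ≥0∞, K ≠ ∞ ∧
      ∀ f : List (Fin (m + 1)) → Space m → 𝕜, IsSobolevFamily l (subgraph γ) f →
      ∀ j, ∀ x ∈ layer γ j, ‖bracketSum γ M ψ ω a (f b) x‖ₑ ≤ Filter.liminf (fun N : ℕ =>
        ∫⁻ ζ, K * topNorm l f (x - (2 : ℝ) ^ (-j) • ζ)
          ∂(totalShiftMeasure (16 * (M + 1)) ω (1 / ((N : ℝ) + 1)))) Filter.atTop := by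
  obtain ⟨C, hC0, hC⟩ := hψ.exists_listDeriv_le a
  set q := a.length with hq
  have hq0 : q ≠ 0 := fun h => ha (List.length_eq_zero_iff.1 h)
  -- The 3 counts the neighbouring indices, the 2 comes from `enorm_moll_sub_moll_le`, and `96 =
  -- 2·48` from `2^{j+1}·2⁻ʲ = 2`.
  set K : ℝ≥0∞ := 3 * (ENNReal.ofReal C * (2 * (ENNReal.ofReal (96 * (M + 1)) ^ q *
    ((m + 1 : ℕ) : ℝ≥0∞) ^ q))) with hK
  have hKtop : K ≠ ∞ := by
    refine ENNReal.mul_ne_top (by simp) (ENNReal.mul_ne_top (by simp)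
      (ENNReal.mul_ne_top (by simp) (ENNReal.mul_ne_top ?_ ?_)))
    · exact ENNReal.pow_ne_top ENNReal.ofReal_ne_top
    · exact ENNReal.pow_ne_top (ENNReal.natCast_ne_top _)
  refine ⟨K, hKtop, fun f hf j x hx => ?_⟩
  have hc : ∀ N : ℕ, ∫⁻ ζ, K * topNorm l f (x - (2 : ℝ) ^ (-j) • ζ)
      ∂(totalShiftMeasure (16 * (M + 1)) ω (1 / ((N : ℝ) + 1))) =
      K * ∫⁻ ζ, topNorm l f (x - (2 : ℝ) ^ (-j) • ζ)
        ∂(totalShiftMeasure (16 * (M + 1)) ω (1 / ((N : ℝ) + 1))) :=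
    fun N => lintegral_const_mul' _ _ hKtop
  simp only [hc]
  rw [ENNReal.liminf_const_mul_of_ne_top hKtop]
  set I := Filter.liminf (fun N : ℕ => ∫⁻ ζ, topNorm l f (x - (2 : ℝ) ^ (-j) • ζ)
    ∂(totalShiftMeasure (16 * (M + 1)) ω (1 / ((N : ℝ) + 1)))) Filter.atTop with hI
  rw [bracketSum_of_mem hx]
  refine (enorm_sum_le _ _).trans ?_
  have hterm : ∀ k ∈ Finset.Icc (j - 1) (j + 1), ‖|listDeriv a (ψ k) x| *
      ‖mollified (16 * (M + 1)) ω (f b) k x - mollified (16 * (M + 1)) ω (f b) j x‖‖ₑ ≤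
      ENNReal.ofReal C * (2 * (ENNReal.ofReal (96 * (M + 1)) ^ q *
        ((m + 1 : ℕ) : ℝ≥0∞) ^ q)) * I := by
    intro k hk
    rw [enorm_mul, enorm_norm, Real.enorm_eq_ofReal_abs, abs_abs]
    have h1 := enorm_moll_sub_moll_le hM hγ hω hf hq0 hab hx.2.2 (abs_sub_le_one_of_mem hk)
    have h2 : |listDeriv a (ψ k) x| ≤ C * ((2 : ℝ) ^ (j + 1)) ^ q := by
      refine (hC k x).trans ?_
      rw [zpow_mul, zpow_natCast]
      gcongr
      · exact one_le_two
      · rw [Finset.mem_Icc] at hk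
        exact hk.2
    refine (mul_le_mul' (ENNReal.ofReal_le_ofReal h2) h1).trans_eq ?_
    rw [bracketConst, ENNReal.ofReal_mul hC0, ENNReal.ofReal_pow (by positivity)]
    -- The growth `2^{kq}` of the derivatives of `ψ_k`, with `k ≤ j + 1`, cancels the gain `2^{-jq}`
    -- of the Taylor estimate.
    have h3 : ENNReal.ofReal ((2 : ℝ) ^ (j + 1)) ^ q *
        ENNReal.ofReal ((2 : ℝ) ^ (-j) * (48 * (M + 1))) ^ q =
        ENNReal.ofReal (96 * (M + 1)) ^ q := by
      rw [← mul_pow, ← ENNReal.ofReal_mul (by positivity)]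
      congr 2
      have : (2 : ℝ) ^ (j + 1) * 2 ^ (-j) = 2 := by
        rw [← zpow_add₀ two_ne_zero]
        simp
      linear_combination (48 * (M + 1)) * this
    rw [← h3]
    ring
  refine (Finset.sum_le_card_nsmul _ _ _ hterm).trans_eq ?_
  have hcard : (Finset.Icc (j - 1) (j + 1)).card = 3 := by
    rw [Int.card_Icc]
    omega
  rw [hcard, hK, nsmul_eq_mul]
  push_cast
  ring

end LayerSum

/-! ### Smooth approximations of the extension -/

section Approximation

variable {m l : ℕ} {γ : EuclideanSpace ℝ (Fin m) → ℝ} {M : ℝ} {ψ : ℤ → Space m → ℝ}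
  {ω : Space m → ℝ} {𝕜 : Type*} [RCLike 𝕜]

/-- The function `1 - ∑_{-N ≤ k < N} ψ_k`. -/
def cutoff (ψ : ℤ → Space m → ℝ) (N : ℕ) (x : Space m) : ℝ :=
  1 - ∑ k ∈ Finset.Ico (-(N : ℤ)) N, ψ k x

lemma contDiff_cutoff (hψ : IsPartition γ ψ) (N : ℕ) : ContDiff ℝ (⊤ : ℕ∞) (cutoff ψ N) :=
  contDiff_const.sub (ContDiff.sum fun k _ => hψ.smooth k)

lemma cutoff_nonneg (hψ : IsPartition γ ψ) (N : ℕ) (x : Space m) : 0 ≤ cutoff ψ N x :=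
  sub_nonneg.2 (hψ.summable_sum_le _ x)

lemma cutoff_le_one (hψ : IsPartition γ ψ) (N : ℕ) (x : Space m) : cutoff ψ N x ≤ 1 :=
  sub_le_self _ (Finset.sum_nonneg fun k _ => hψ.nonneg k x)

lemma cutoff_eq_one (hψ : IsPartition γ ψ) (N : ℕ) {x : Space m} (hx : x ∉ exterior γ) :
    cutoff ψ N x = 1 := by
  have h : ∀ k, ψ k x = 0 := fun k => hψ.listDeriv_eq_zero_of_notMem hx k []
  simp [cutoff, h]

lemma listDeriv_cutoff (hψ : IsPartition γ ψ) (N : ℕ) {L : List (Fin (m + 1))} (hL : L ≠ [])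
    (x : Space m) : listDeriv L (cutoff ψ N) x =
      -∑ k ∈ Finset.Ico (-(N : ℤ)) N, listDeriv L (ψ k) x := by
  have key : ∀ L : List (Fin (m + 1)), listDeriv L (cutoff ψ N) =
      fun x => listDeriv L (fun _ : Space m => (1 : ℝ)) x -
        ∑ k ∈ Finset.Ico (-(N : ℤ)) N, listDeriv L (ψ k) x := by
    intro L
    induction L with
    | nil => rfl
    | cons i L ih =>
      funext x
      rw [listDeriv_cons, ih, coordDeriv, fderiv_fun_sub
        (differentiable_of_smooth (contDiff_listDeriv contDiff_const L) x)
        (differentiable_of_smooth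
          (ContDiff.sum fun k _ => contDiff_listDeriv (hψ.smooth k) L) x),
        fderiv_fun_sum fun k _ => differentiable_of_smooth (contDiff_listDeriv (hψ.smooth k) L) x]
      simp [listDeriv_cons, coordDeriv]
  rw [key, listDeriv_const _ hL]
  exact zero_sub _

/-- On the exterior the cutoff lives only on layers close to the boundary, `j ≥ N - 1`, and on
remote ones, `j ≤ -N`. The remote ones are later excluded by the compact support of the test
function. -/
lemma listDeriv_cutoff_eq_zero (hM : 0 ≤ M) (hγ : ∀ x y, |γ x - γ y| ≤ M * ‖x - y‖)
    (hψ : IsPartition γ ψ) {N : ℕ} {x : Space m} {j : ℤ} (hx : x ∈ layer γ j)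
    (hj : -(N : ℤ) < j) (hjN : j + 1 < N) (L : List (Fin (m + 1))) :
    listDeriv L (cutoff ψ N) x = 0 := by
  have hs : Finset.Icc (j - 1) (j + 1) ⊆ Finset.Ico (-(N : ℤ)) N := by
    intro k hk
    rw [Finset.mem_Icc] at hk
    rw [Finset.mem_Ico]
    omega
  by_cases hL : L = []
  · subst hL
    rw [listDeriv_nil, cutoff, hψ.sum_layer hx hs, sub_self]
  · rw [listDeriv_cutoff hψ N hL, hψ.sum_listDeriv_layer hM hγ hx hs hL, neg_zero]

/-- The finite analogues of `layerSum`, where the missing terms are replaced by a single one. -/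
def partialSum (M : ℝ) (ψ : ℤ → Space m → ℝ) (ω : Space m → ℝ) (L : List (Fin (m + 1))) (N : ℕ)
    (F : Space m → 𝕜) (x : Space m) : 𝕜 :=
  ∑ k ∈ Finset.Ico (-(N : ℤ)) N, listDeriv L (ψ k) x • mollified (16 * (M + 1)) ω F k x +
    listDeriv L (cutoff ψ N) x • mollified (16 * (M + 1)) ω F N x

lemma continuous_sum_part (hM : 0 ≤ M) (hψ : IsPartition γ ψ) (hω : IsKernel l ω)
    {F : Space m → 𝕜} (hF : LocallyIntegrable F) (L : List (Fin (m + 1))) (N : ℕ) :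
    Continuous fun x => ∑ k ∈ Finset.Ico (-(N : ℤ)) N,
      listDeriv L (ψ k) x • mollified (16 * (M + 1)) ω F k x :=
  continuous_finsetSum _ fun k _ => (contDiff_listDeriv (hψ.smooth k) L).continuous.smul
    (contDiff_mollified hM hω hF k).continuous

lemma continuous_cutoff_part (hM : 0 ≤ M) (hψ : IsPartition γ ψ) (hω : IsKernel l ω)
    {F : Space m → 𝕜} (hF : LocallyIntegrable F) (L : List (Fin (m + 1))) (N : ℕ) :
    Continuous fun x => listDeriv L (cutoff ψ N) x • mollified (16 * (M + 1)) ω F N x :=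
  (contDiff_listDeriv (contDiff_cutoff hψ N) L).continuous.smul
    (contDiff_mollified hM hω hF N).continuous

lemma continuous_partialSum (hM : 0 ≤ M) (hψ : IsPartition γ ψ) (hω : IsKernel l ω)
    {F : Space m → 𝕜} (hF : LocallyIntegrable F) (L : List (Fin (m + 1))) (N : ℕ) :
    Continuous (partialSum M ψ ω L N F) :=
  (continuous_sum_part hM hψ hω hF L N).add (continuous_cutoff_part hM hψ hω hF L N)

lemma partialSum_eq_layerSum (hM : 0 ≤ M) (hγ : ∀ x y, |γ x - γ y| ≤ M * ‖x - y‖)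
    (hψ : IsPartition γ ψ) {N : ℕ} {x : Space m} {j : ℤ} (hx : x ∈ layer γ j)
    (hj : -(N : ℤ) < j) (hjN : j + 1 < N) (L : List (Fin (m + 1))) (F : Space m → 𝕜) :
    partialSum M ψ ω L N F x = layerSum M ψ ω L F x := by
  have hs : Finset.Icc (j - 1) (j + 1) ⊆ Finset.Ico (-(N : ℤ)) N := by
    intro k hk
    rw [Finset.mem_Icc] at hk
    rw [Finset.mem_Ico]
    omega
  rw [partialSum, listDeriv_cutoff_eq_zero hM hγ hψ hx hj hjN, zero_smul, add_zero, layerSum,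
    hψ.tsum_layer hx hs]

lemma partialSum_eq_zero (hψ : IsPartition γ ψ) (N : ℕ) {x : Space m} (hx : x ∉ exterior γ)
    {L : List (Fin (m + 1))} (hL : L ≠ []) (F : Space m → 𝕜) :
    partialSum M ψ ω L N F x = 0 := by
  simp [partialSum, listDeriv_cutoff hψ N hL, hψ.listDeriv_eq_zero_of_notMem hx]

/-- If `j < N`, then `∑_k D_L ψ_k = 0` gives `D_L (cutoff) = D_L ψ_N` at `x`, and the finite sum is
the full one. If `j = N`, its terms occur among those of `bracketSum`. If `j > N`, no `ψ_k` with `k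
< N` reaches the layer. The majorant is thus independent of `N`. -/
lemma norm_partialSum_le (hM : 0 ≤ M) (hγ : ∀ x y, |γ x - γ y| ≤ M * ‖x - y‖)
    (hψ : IsPartition γ ψ) {N : ℕ} {x : Space m}
    (hxN : ∀ j, x ∈ layer γ j → -(N : ℤ) < j)
    {L : List (Fin (m + 1))} (hL : L ≠ []) (F : Space m → 𝕜) :
    ‖partialSum M ψ ω L N F x‖ ≤ bracketSum γ M ψ ω L F x := by
  by_cases hx : x ∈ exterior γ
  swap
  · rw [partialSum_eq_zero hψ N hx hL, bracketSum_of_notMem hx, norm_zero]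
  obtain ⟨j, hj⟩ := exists_mem_layer hM hγ hx
  have hjN := hxN j hj
  have hvan : ∀ k, k ∉ Finset.Icc (j - 1) (j + 1) → listDeriv L (ψ k) x = 0 :=
    fun k hk => hψ.listDeriv_eq_zero_of_layer hj hk L
  set c : ℤ → 𝕜 := fun k => mollified (16 * (M + 1)) ω F k x with hc
  have hterm : ∀ k, ‖listDeriv L (ψ k) x • (c k - c j)‖ = |listDeriv L (ψ k) x| *
      ‖mollified (16 * (M + 1)) ω F k x - mollified (16 * (M + 1)) ω F j x‖ := by
    intro k
    rw [norm_smul, Real.norm_eq_abs]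
  have hform : partialSum M ψ ω L N F x =
      ∑ k ∈ Finset.Ico (-(N : ℤ)) N, listDeriv L (ψ k) x • (c k - c N) := by
    rw [partialSum, listDeriv_cutoff hψ N hL, neg_smul, Finset.sum_smul, ← sub_eq_add_neg,
      ← Finset.sum_sub_distrib]
    simp only [smul_sub, hc]
  rcases lt_trichotomy j N with hlt | heq | hgt
  · have heq : partialSum M ψ ω L N F x = layerSum M ψ ω L F x := by
      have hs : Finset.Icc (j - 1) (j + 1) ⊆ insert (N : ℤ) (Finset.Ico (-(N : ℤ)) N) := by
        intro k hk
        rw [Finset.mem_Icc] at hk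
        rw [Finset.mem_insert, Finset.mem_Ico]
        omega
      have hN : (N : ℤ) ∉ Finset.Ico (-(N : ℤ)) N := by simp
      have hsum := hψ.sum_listDeriv_layer hM hγ hj hs hL
      rw [Finset.sum_insert hN] at hsum
      rw [layerSum, hψ.tsum_layer hj hs, Finset.sum_insert hN, partialSum,
        listDeriv_cutoff hψ N hL, ← eq_neg_of_add_eq_zero_left hsum, add_comm]
    rw [heq]
    exact norm_layerSum_le_bracketSum hM hγ hψ hL F x
  · rw [hform, bracketSum_of_mem hj]
    refine (norm_sum_le _ _).trans ?_
    rw [← heq]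
    simp only [hterm]
    rw [← Finset.sum_subset Finset.inter_subset_left (s₁ := Finset.Ico (-j) j ∩
      Finset.Icc (j - 1) (j + 1))]
    · exact Finset.sum_le_sum_of_subset_of_nonneg Finset.inter_subset_right
        fun k _ _ => mul_nonneg (abs_nonneg _) (norm_nonneg _)
    · intro k hk hk'
      rw [hvan k fun h => hk' (Finset.mem_inter.2 ⟨hk, h⟩), abs_zero, zero_mul]
  · rw [hform, Finset.sum_eq_zero, norm_zero]
    · rw [bracketSum_of_mem hj]
      positivity
    · intro k hk
      rw [hvan k, zero_smul]
      rw [Finset.mem_Ico] at hk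
      rw [Finset.mem_Icc]
      omega

lemma exists_layer_bound (hM : 0 ≤ M) (hγ : ∀ x y, |γ x - γ y| ≤ M * ‖x - y‖) {K : Set (Space m)}
    (hK : IsCompact K) : ∃ N₀ : ℕ, ∀ N ≥ N₀, ∀ x ∈ K, ∀ j, x ∈ layer γ j → -(N : ℤ) < j := by
  obtain ⟨B, hB⟩ := (hK.image (continuous_rho hM hγ)).bddAbove
  obtain ⟨N₀, hN₀⟩ := pow_unbounded_of_one_lt B (one_lt_two (α := ℝ))
  refine ⟨N₀ + 1, fun N hN x hx j hj => ?_⟩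
  have h1 := hB (mem_image_of_mem _ hx)
  have h2 : (2 : ℝ) ^ (-j - 1) < (2 : ℝ) ^ (N₀ : ℤ) := by
    rw [zpow_natCast]
    exact hj.2.1.trans_le (h1.trans hN₀.le)
  have h3 := (zpow_lt_zpow_iff_right₀ (one_lt_two (α := ℝ))).1 h2
  omega

lemma eventually_partialSum_eq (hM : 0 ≤ M) (hγ : ∀ x y, |γ x - γ y| ≤ M * ‖x - y‖)
    (hψ : IsPartition γ ψ) {x : Space m} (hx : x ∈ exterior γ) (L : List (Fin (m + 1)))
    (F : Space m → 𝕜) :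
    ∀ᶠ N : ℕ in Filter.atTop, partialSum M ψ ω L N F x = layerSum M ψ ω L F x := by
  obtain ⟨j, hj⟩ := exists_mem_layer hM hγ hx
  filter_upwards [Filter.eventually_ge_atTop (j.natAbs + 2)] with N hN
  exact partialSum_eq_layerSum hM hγ hψ hj (by omega) (by omega) L F

lemma tendsto_integral_partialSum (hM : 0 ≤ M) (hγ : ∀ x y, |γ x - γ y| ≤ M * ‖x - y‖)
    (hψ : IsPartition γ ψ) (hω : IsKernel l ω) {F : Space m → 𝕜} (hF : LocallyIntegrable F)
    {L : List (Fin (m + 1))} (hL : L ≠ []) (hb : LocallyIntegrable (bracketSum γ M ψ ω L F))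
    {η : Space m → ℝ} (hη : Continuous η) (hηs : HasCompactSupport η) :
    Filter.Tendsto (fun N : ℕ => ∫ x, η x • partialSum M ψ ω L N F x) Filter.atTop
      (nhds (∫ x, η x • layerSum M ψ ω L F x)) := by
  obtain ⟨N₀, hN₀⟩ := exists_layer_bound (m := m) hM hγ hηs
  refine tendsto_integral_filter_of_dominated_convergence
    (fun x => ‖η x‖ * bracketSum γ M ψ ω L F x) ?_ ?_ ?_ ?_
  · exact Filter.Eventually.of_forall fun N =>
      (hη.smul (continuous_partialSum hM hψ hω hF L N)).aestronglyMeasurable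
  · filter_upwards [Filter.eventually_ge_atTop N₀] with N hN
    refine Filter.Eventually.of_forall fun x => ?_
    rw [norm_smul]
    by_cases hx : x ∈ tsupport η
    · gcongr
      exact norm_partialSum_le hM hγ hψ (hN₀ N hN x hx) hL F
    · simp [image_eq_zero_of_notMem_tsupport hx]
  · exact hb.integrable_smul_left_of_hasCompactSupport hη.norm hηs.norm
  · refine Filter.Eventually.of_forall fun x => ?_
    by_cases hx : x ∈ exterior γ
    · refine tendsto_const_nhds.congr' ?_
      filter_upwards [eventually_partialSum_eq (ω := ω) hM hγ hψ hx L F] with N hN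
      rw [hN]
    · simp only [partialSum_eq_zero hψ _ hx hL, layerSum_eq_zero hψ hx]
      exact tendsto_const_nhds

lemma tendsto_integral_sum_part (hM : 0 ≤ M) (hγ : ∀ x y, |γ x - γ y| ≤ M * ‖x - y‖)
    (hψ : IsPartition γ ψ) (hω : IsKernel l ω) {F : Space m → 𝕜} (hF : LocallyIntegrable F)
    (hb : LocallyIntegrable fun x => ∑' k, ψ k x • ‖mollified (16 * (M + 1)) ω F k x‖)
    {η : Space m → ℝ} (hη : Continuous η) (hηs : HasCompactSupport η) :
    Filter.Tendsto (fun N : ℕ => ∫ x, η x • ∑ k ∈ Finset.Ico (-(N : ℤ)) N,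
        ψ k x • mollified (16 * (M + 1)) ω F k x) Filter.atTop
      (nhds (∫ x, η x • layerSum M ψ ω [] F x)) := by
  refine tendsto_integral_filter_of_dominated_convergence
    (fun x => ‖η x‖ * ∑' k, ψ k x • ‖mollified (16 * (M + 1)) ω F k x‖) ?_ ?_ ?_ ?_
  · exact Filter.Eventually.of_forall fun N =>
      (hη.smul (continuous_sum_part hM hψ hω hF [] N)).aestronglyMeasurable
  · refine Filter.Eventually.of_forall fun N => Filter.Eventually.of_forall fun x => ?_
    rw [norm_smul]
    gcongr
    have hsum : Summable fun k => ψ k x • ‖mollified (16 * (M + 1)) ω F k x‖ := by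
      by_cases hx : x ∈ exterior γ
      · obtain ⟨j, hj⟩ := exists_mem_layer hM hγ hx
        refine summable_of_ne_finset_zero (s := Finset.Icc (j - 1) (j + 1)) fun k hk => ?_
        have := hψ.listDeriv_eq_zero_of_layer hj hk []
        rw [listDeriv_nil] at this
        rw [this, zero_smul]
      · have h : ∀ k, ψ k x = 0 := fun k => hψ.listDeriv_eq_zero_of_notMem hx k []
        simp [h]
    refine (norm_sum_le _ _).trans (le_trans (Finset.sum_le_sum fun k _ => ?_)
      (hsum.sum_le_tsum (Finset.Ico (-(N : ℤ)) N)
        fun k _ => smul_nonneg (hψ.nonneg k x) (norm_nonneg _)))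
    rw [norm_smul, Real.norm_of_nonneg (hψ.nonneg k x)]
    rfl
  · exact hb.integrable_smul_left_of_hasCompactSupport hη.norm hηs.norm
  · refine Filter.Eventually.of_forall fun x => ?_
    by_cases hx : x ∈ exterior γ
    · obtain ⟨j, hj⟩ := exists_mem_layer hM hγ hx
      refine tendsto_const_nhds.congr' ?_
      filter_upwards [Filter.eventually_ge_atTop (j.natAbs + 2)] with N hN
      rw [layerSum, hψ.tsum_layer hj (s := Finset.Ico (-(N : ℤ)) N)]
      · rfl
      · intro k hk
        rw [Finset.mem_Icc] at hk
        rw [Finset.mem_Ico]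
        omega
    · have h : ∀ k, ψ k x = 0 := fun k => hψ.listDeriv_eq_zero_of_notMem hx k []
      simp only [h, layerSum_eq_zero hψ hx, zero_smul, Finset.sum_const_zero]
      exact tendsto_const_nhds

/-- The adjoint of the mollification. -/
lemma integral_smul_moll {A t : ℝ} (hA : A ≠ 0) (ht : t ≠ 0) (hω : IsKernel l ω) {F : Space m → 𝕜}
    (hF : LocallyIntegrable F) {a : Space m → ℝ} (ha : Continuous a) (has : HasCompactSupport a) :
    ∫ x, a x • moll A ω t F x = ∫ y, (∫ z, ω z * a (y + t • stretch A z)) • F y := by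
  have hκ := (contDiff_kernel (A := A) (t := t) hω.smooth).continuous
  have hκs := hasCompactSupport_kernel hA ht hω.hasCompactSupport
  set κ := kernel A ω t with hκdef
  -- `F` is only locally integrable. The compact set `B` contains every `y` that contributes, so
  -- Fubini's theorem can be applied to `F` cut off to `B`.
  set B : Set (Space m) := (fun q : Space m × Space m => q.1 - q.2) '' (tsupport a ×ˢ tsupport κ)
    with hB
  have hBc : IsCompact B := (IsCompact.prod has hκs).image (by fun_prop)
  have hBint : Integrable (B.indicator F) := by
    rw [integrable_indicator_iff hBc.measurableSet]
    exact hF.integrableOn_isCompact hBc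
  have hFB : ∀ x y, a x • κ (x - y) • F y = a x • κ (x - y) • B.indicator F y := by
    intro x y
    by_cases hy : y ∈ B
    · rw [indicator_of_mem hy]
    · by_cases hx : x ∈ tsupport a
      · by_cases hxy : x - y ∈ tsupport κ
        · exact absurd ⟨(x, x - y), ⟨hx, hxy⟩, by simp⟩ hy
        · simp [image_eq_zero_of_notMem_tsupport hxy]
      · simp [image_eq_zero_of_notMem_tsupport hx]
  have hint : Integrable (Function.uncurry fun x y : Space m => a x • κ (x - y) • F y)
      (volume.prod volume) := by
    have h1 := hBint.convolution_integrand (ContinuousLinearMap.lsmul ℝ ℝ).flip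
      (hκ.integrable_of_hasCompactSupport (μ := volume) hκs)
    obtain ⟨C, hC⟩ := has.exists_bound_of_continuous ha
    have h2 := h1.bdd_smul (φ := fun q : Space m × Space m => a q.1) C
      (ha.comp continuous_fst).aestronglyMeasurable
      (Filter.Eventually.of_forall fun q => hC q.1)
    refine h2.congr (Filter.Eventually.of_forall fun q => ?_)
    simp only [Function.uncurry]
    rw [hFB]
    rfl
  have h1 : ∀ x, a x • moll A ω t F x = ∫ y, a x • κ (x - y) • F y := by
    intro x
    rw [moll_eq_integral hA ht, integral_smul]
  simp only [h1]
  rw [integral_integral_swap hint]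
  congr 1
  funext y
  simp only [smul_smul]
  rw [integral_smul_const]
  congr 1
  -- The reflection `y ↦ -y` turns the shift `y + t(z̄, Azₙ)` into a mollification of the reflected
  -- function.
  have h2 := congrFun (moll_eq_convolution (ω := ω) hA ht fun u => a (-u)) (-y)
  rw [convolution_lsmul_eq] at h2
  rw [← integral_neg_eq_self, moll] at h2
  simp only [neg_sub, sub_neg_eq_add, neg_neg, smul_eq_mul] at h2
  rw [show (fun z => ω z * a (y + t • stretch A z)) = fun z => ω z * a (t • stretch A z + y) by
    funext z; rw [add_comm], h2]
  congr 1
  funext x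
  rw [mul_comm, neg_add_eq_sub]

/-- With the mollification moved onto the test function, no convergence of `f_N` itself is needed.
Near a point `y` of Ω the cutoff is 1, so the averaged test function tends to `η y`; off Ω the
function `F` vanishes. The limit is exactly `f` on Ω, with nothing left on the boundary. -/
lemma tendsto_integral_cutoff_part (hM : 0 ≤ M) (hγ : ∀ x y, |γ x - γ y| ≤ M * ‖x - y‖)
    (hψ : IsPartition γ ψ) (hω : IsKernel l ω) {F : Space m → 𝕜} (hF : LocallyIntegrable F)
    (hF0 : ∀ x ∉ subgraph γ, F x = 0) {η : Space m → ℝ} (hη : Continuous η)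
    (hηs : HasCompactSupport η) :
    Filter.Tendsto (fun N : ℕ => ∫ x, η x • (cutoff ψ N x • mollified (16 * (M + 1)) ω F N x))
      Filter.atTop (nhds (∫ x, η x • F x)) := by
  set A := 16 * (M + 1) with hA
  have hA0 : A ≠ 0 := by rw [hA]; linarith
  let τ : ℕ → ℝ := fun N => (2 : ℝ) ^ (-(N : ℤ))
  have hτ0 : ∀ N, 0 < τ N := fun N => by positivity
  have hτ1 : ∀ N, τ N ≤ 1 := fun N => zpow_le_one_of_nonpos₀ one_le_two (by simp)
  have hτlim : Filter.Tendsto τ Filter.atTop (nhds 0) := by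
    have h := tendsto_pow_atTop_nhds_zero_of_lt_one (r := (1 / 2 : ℝ)) (by norm_num) (by norm_num)
    refine h.congr fun N => ?_
    simp [τ]
  let a : ℕ → Space m → ℝ := fun N x => η x * cutoff ψ N x
  have ha : ∀ N, Continuous (a N) := fun N => hη.mul (contDiff_cutoff hψ N).continuous
  have has : ∀ N, HasCompactSupport (a N) := fun N => hηs.mul_right
  have haη : ∀ N x, ‖a N x‖ ≤ ‖η x‖ := by
    intro N x
    rw [norm_mul, Real.norm_of_nonneg (cutoff_nonneg hψ N x)]
    exact mul_le_of_le_one_right (norm_nonneg _) (cutoff_le_one hψ N x)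
  have hadj : ∀ N : ℕ, ∫ x, η x • (cutoff ψ N x • mollified A ω F N x) =
      ∫ y, (∫ z, ω z * a N (y + τ N • stretch A z)) • F y := by
    intro N
    rw [← integral_smul_moll hA0 (hτ0 N).ne' hω hF (ha N) (has N)]
    simp only [smul_smul]
    rfl
  simp only [hadj]
  obtain ⟨C, hC⟩ := hηs.exists_bound_of_continuous hη
  have hC0 : 0 ≤ C := (norm_nonneg _).trans (hC 0)
  have hωint : Integrable ω :=
    hω.smooth.continuous.integrable_of_hasCompactSupport hω.hasCompactSupport
  obtain ⟨R, hR⟩ := hηs.isBounded.subset_closedBall (0 : Space m)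
  set B := Metric.closedBall (0 : Space m) (R + A) with hB
  have hzero : ∀ N, ∀ y ∉ B, ∫ z, ω z * a N (y + τ N • stretch A z) = 0 := by
    intro N y hy
    refine integral_eq_zero_of_ae (Filter.Eventually.of_forall fun z => ?_)
    by_contra hne
    have hz : z ∈ tsupport ω := subset_tsupport _ (left_ne_zero_of_mul hne)
    have h1 : η (y + τ N • stretch A z) ≠ 0 := left_ne_zero_of_mul (right_ne_zero_of_mul hne)
    have h2 := hR (subset_tsupport _ h1)
    apply hy
    rw [mem_closedBall_zero_iff] at h2 ⊢
    have h3 := norm_stretch_kernelRegion_le hM (hω.support_subset hz)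
    have h4 : ‖τ N • stretch A z‖ ≤ A := by
      rw [norm_smul, Real.norm_of_nonneg (hτ0 N).le]
      have := mul_le_mul (hτ1 N) h3 (norm_nonneg _) zero_le_one
      linarith
    have h5 := norm_sub_le (y + τ N • stretch A z) (τ N • stretch A z)
    rw [add_sub_cancel_right] at h5
    linarith
  have hbound : ∀ N y, ‖∫ z, ω z * a N (y + τ N • stretch A z)‖ ≤ C * ∫ z, ‖ω z‖ := by
    intro N y
    rw [← integral_const_mul]
    refine norm_integral_le_of_norm_le (hωint.norm.const_mul C)
      (Filter.Eventually.of_forall fun z => ?_)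
    rw [norm_mul, mul_comm]
    gcongr
    exact (haη N _).trans (hC _)
  have hcont : ∀ N, Continuous fun y => ∫ z, ω z * a N (y + τ N • stretch A z) := by
    intro N
    refine continuous_of_dominated (bound := fun z => ‖ω z‖ * C) (fun y => ?_) (fun y => ?_)
      (hωint.norm.mul_const C) ?_
    · have h1 := hω.smooth.continuous
      have h2 := continuous_smul_stretch (m := m) A (τ N)
      exact (h1.mul ((ha N).comp (continuous_const.add h2))).aestronglyMeasurable
    · refine Filter.Eventually.of_forall fun z => ?_
      rw [norm_mul]
      gcongr
      exact (haη N _).trans (hC _)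
    · exact Filter.Eventually.of_forall fun z =>
        continuous_const.mul ((ha N).comp (continuous_id.add continuous_const))
  have hFB : Integrable (B.indicator fun y => ‖F y‖) := by
    rw [integrable_indicator_iff measurableSet_closedBall]
    exact (hF.integrableOn_isCompact (isCompact_closedBall _ _)).norm
  refine tendsto_integral_of_dominated_convergence
    (fun y => (C * ∫ z, ‖ω z‖) * B.indicator (fun y => ‖F y‖) y) ?_ (hFB.const_mul _) ?_ ?_
  · exact fun N => (hcont N).aestronglyMeasurable.smul hF.aestronglyMeasurable
  · intro N
    refine Filter.Eventually.of_forall fun y => ?_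
    by_cases hy : y ∈ B
    · rw [indicator_of_mem hy, norm_smul]
      gcongr
      exact hbound N y
    · simp [hzero N y hy, indicator_of_notMem hy]
  · refine Filter.Eventually.of_forall fun y => ?_
    by_cases hy : y ∈ subgraph γ
    · apply Filter.Tendsto.smul_const
      have h1 : η y = ∫ z, ω z * η y := by
        rw [integral_mul_const, hω.integral_eq_one, one_mul]
      rw [h1]
      refine tendsto_integral_of_dominated_convergence (fun z => ‖ω z‖ * C) ?_
        (hωint.norm.mul_const C) ?_ ?_
      · intro N
        have h1 := hω.smooth.continuous
        have h2 := continuous_smul_stretch (m := m) A (τ N)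
        exact (h1.mul ((ha N).comp (continuous_const.add h2))).aestronglyMeasurable
      · intro N
        refine Filter.Eventually.of_forall fun z => ?_
        rw [norm_mul]
        gcongr
        exact (haη N _).trans (hC _)
      · refine Filter.Eventually.of_forall fun z => Filter.Tendsto.const_mul _ ?_
        have hlim : Filter.Tendsto (fun N => y + τ N • stretch A z) Filter.atTop (nhds y) := by
          simpa using (hτlim.smul_const (stretch A z)).const_add y
        refine ((hη.tendsto y).comp hlim).congr' ?_
        filter_upwards [hlim.eventually ((isOpen_subgraph hM hγ).mem_nhds hy)] with N hN
        simp only [a, Function.comp_apply,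
          cutoff_eq_one hψ N (disjoint_subgraph_exterior hN), mul_one]
    · simp only [hF0 y hy, smul_zero]
      exact tendsto_const_nhds

lemma locallyIntegrable_layerSum_nil (hM : 0 ≤ M) (hγ : ∀ x y, |γ x - γ y| ≤ M * ‖x - y‖)
    (hψ : IsPartition γ ψ) (hω : IsKernel l ω) {F : Space m → 𝕜} (hF : LocallyIntegrable F)
    (hb : LocallyIntegrable fun x => ∑' k, ψ k x • ‖mollified (16 * (M + 1)) ω F k x‖) :
    LocallyIntegrable (layerSum M ψ ω [] F) := by
  refine hb.mono (measurable_layerSum hM hψ hω hF []).aestronglyMeasurable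
    (Filter.Eventually.of_forall fun x => ?_)
  by_cases hx : x ∈ exterior γ
  · obtain ⟨j, hj⟩ := exists_mem_layer hM hγ hx
    have h := hψ.tsum_layer hj le_rfl [] fun k => ‖mollified (16 * (M + 1)) ω F k x‖
    simp only [listDeriv_nil] at h
    rw [layerSum, hψ.tsum_layer hj le_rfl, h]
    refine (norm_sum_le _ _).trans ((Finset.sum_le_sum fun k _ => ?_).trans (le_abs_self _))
    rw [norm_smul, listDeriv_nil, Real.norm_of_nonneg (hψ.nonneg k x)]
    rfl
  · rw [layerSum_eq_zero hψ hx, norm_zero]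
    exact norm_nonneg _

lemma tendsto_integral_partialSum_nil (hM : 0 ≤ M) (hγ : ∀ x y, |γ x - γ y| ≤ M * ‖x - y‖)
    (hψ : IsPartition γ ψ) (hω : IsKernel l ω) {F : Space m → 𝕜} (hF : LocallyIntegrable F)
    (hF0 : ∀ x ∉ subgraph γ, F x = 0)
    (hb : LocallyIntegrable fun x => ∑' k, ψ k x • ‖mollified (16 * (M + 1)) ω F k x‖)
    {η : Space m → ℝ} (hη : Continuous η) (hηs : HasCompactSupport η) :
    Filter.Tendsto (fun N : ℕ => ∫ x, η x • partialSum M ψ ω [] N F x) Filter.atTop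
      (nhds (∫ x, η x • (F x + layerSum M ψ ω [] F x))) := by
  have h1 := tendsto_integral_sum_part hM hγ hψ hω hF hb hη hηs
  have h2 := tendsto_integral_cutoff_part hM hγ hψ hω hF hF0 hη hηs
  have h3 := h2.add h1
  have e : ∫ x, η x • (F x + layerSum M ψ ω [] F x) =
      (∫ x, η x • F x) + ∫ x, η x • layerSum M ψ ω [] F x := by
    simp only [smul_add]
    exact integral_add (hF.integrable_smul_left_of_hasCompactSupport hη hηs)
      ((locallyIntegrable_layerSum_nil hM hγ hψ hω hF
        hb).integrable_smul_left_of_hasCompactSupport hη hηs)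
  rw [e]
  refine h3.congr fun N => ?_
  have e2 : ∀ x, η x • partialSum M ψ ω [] N F x =
      η x • (cutoff ψ N x • mollified (16 * (M + 1)) ω F N x) +
      η x • ∑ k ∈ Finset.Ico (-(N : ℤ)) N, ψ k x • mollified (16 * (M + 1)) ω F k x := by
    intro x
    rw [partialSum, smul_add, add_comm]
    rfl
  simp only [e2]
  rw [integral_add]
  · exact (hη.smul (continuous_cutoff_part hM hψ hω hF [] N)).integrable_of_hasCompactSupport
      hηs.smul_right
  · exact (hη.smul (continuous_sum_part hM hψ hω hF [] N)).integrable_of_hasCompactSupport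
      hηs.smul_right

end Approximation

/-! ### Weak derivatives of the extension -/

section WeakDeriv

variable {m l : ℕ} {γ : EuclideanSpace ℝ (Fin m) → ℝ} {M : ℝ} {ψ : ℤ → Space m → ℝ}
  {ω : Space m → ℝ} {𝕜 : Type*} [RCLike 𝕜]

lemma listDeriv_add {n : ℕ} {V : Type*} [NormedAddCommGroup V] [NormedSpace ℝ V]
    {u v : EuclideanSpace ℝ (Fin n) → V} (hu : ContDiff ℝ (⊤ : ℕ∞) u)
    (hv : ContDiff ℝ (⊤ : ℕ∞) v) (L : List (Fin n)) :
    listDeriv L (fun x => u x + v x) = fun x => listDeriv L u x + listDeriv L v x := by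
  induction L with
  | nil => rfl
  | cons i L ih =>
    funext x
    rw [listDeriv_cons, ih, coordDeriv, fderiv_fun_add
      (differentiable_of_smooth (contDiff_listDeriv hu L) x)
      (differentiable_of_smooth (contDiff_listDeriv hv L) x)]
    rfl

lemma sum_list_sum {ι κ V : Type*} [AddCommMonoid V] (s : Finset ι) (l : List κ)
    (φ : ι → κ → V) : ∑ k ∈ s, (l.map fun q => φ k q).sum = (l.map fun q => ∑ k ∈ s, φ k q).sum := by
  induction l with
  | nil => simp
  | cons q l ih => simp [Finset.sum_add_distrib, ih]

lemma integrable_list_sum {α κ V : Type*} [MeasurableSpace α] {μ : Measure α}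
    [NormedAddCommGroup V] (l : List κ) (φ : κ → α → V)
    (h : ∀ q ∈ l, Integrable (φ q) μ) : Integrable (fun x => (l.map fun q => φ q x).sum) μ := by
  induction l with
  | nil => simp
  | cons q l ih =>
    simp only [List.map_cons, List.sum_cons]
    exact (h q (by simp)).add (ih fun q' hq' => h q' (by simp [hq']))

lemma integral_list_sum {α κ V : Type*} [MeasurableSpace α] {μ : Measure α}
    [NormedAddCommGroup V] [NormedSpace ℝ V] (l : List κ) (φ : κ → α → V)
    (h : ∀ q ∈ l, Integrable (φ q) μ) :
    ∫ x, (l.map fun q => φ q x).sum ∂μ = (l.map fun q => ∫ x, φ q x ∂μ).sum := by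
  induction l with
  | nil => simp
  | cons q l ih =>
    simp only [List.map_cons, List.sum_cons]
    have hl : ∀ q' ∈ l, Integrable (φ q') μ := fun q' hq' => h q' (by simp [hq'])
    rw [integral_add (h q (by simp)) (integrable_list_sum l φ hl), ih hl]

lemma smul_list_sum {κ V : Type*} [AddCommGroup V] [Module ℝ V] (c : ℝ) (l : List κ)
    (φ : κ → V) : c • (l.map φ).sum = (l.map fun q => c • φ q).sum := by
  induction l with
  | nil => simp
  | cons q l ih => simp [ih]

lemma contDiff_partialSum_nil (hM : 0 ≤ M) (hψ : IsPartition γ ψ) (hω : IsKernel l ω)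
    {F : Space m → 𝕜} (hF : LocallyIntegrable F) (N : ℕ) :
    ContDiff ℝ (⊤ : ℕ∞) (partialSum M ψ ω [] N F) :=
  (ContDiff.sum fun k _ => (hψ.smooth k).smul (contDiff_mollified hM hω hF k)).add
    ((contDiff_cutoff hψ N).smul (contDiff_mollified hM hω hF N))

/-- The derivatives of `f_k` are mollified weak derivatives only at points whose shifts stay in Ω.
Elsewhere the coefficient vanishes: that of `ψ_k` by its support, that of the cutoff because, once
remote layers are excluded, it lives where `ρₙ ≤ 2^{-(N-1)}`. -/
lemma listDeriv_partialSum (hM : 0 ≤ M) (hγ : ∀ x y, |γ x - γ y| ≤ M * ‖x - y‖)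
    (hψ : IsPartition γ ψ) (hω : IsKernel l ω) {f : List (Fin (m + 1)) → Space m → 𝕜}
    (hf : IsSobolevFamily l (subgraph γ) f) {L : List (Fin (m + 1))} (hL : L.length ≤ l) {N : ℕ}
    {x : Space m} (hxN : ∀ j, x ∈ layer γ j → -(N : ℤ) < j) :
    listDeriv L (partialSum M ψ ω [] N (f [])) x =
      ((splits L).map fun q => partialSum M ψ ω q.1 N (f q.2) x).sum := by
  have hA0 : 16 * (M + 1) ≠ 0 := by linarith
  have hF := hf.locallyIntegrable []
  have hsm := fun k => contDiff_mollified (𝕜 := 𝕜) (m := m) hM hω hF k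
  have h1 : ContDiff ℝ (⊤ : ℕ∞) fun x => ∑ k ∈ Finset.Ico (-(N : ℤ)) N,
      ψ k x • mollified (16 * (M + 1)) ω (f []) k x :=
    ContDiff.sum fun k _ => (hψ.smooth k).smul (hsm k)
  have h2 : ContDiff ℝ (⊤ : ℕ∞) fun x => cutoff ψ N x • mollified (16 * (M + 1)) ω (f []) N x :=
    (contDiff_cutoff hψ N).smul (hsm N)
  have e0 : partialSum M ψ ω [] N (f []) = fun x =>
      (∑ k ∈ Finset.Ico (-(N : ℤ)) N, ψ k x • mollified (16 * (M + 1)) ω (f []) k x) +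
      cutoff ψ N x • mollified (16 * (M + 1)) ω (f []) N x := rfl
  rw [e0, listDeriv_add h1 h2, listDeriv_finset_sum _
    (fun k x => ψ k x • mollified (16 * (M + 1)) ω (f []) k x)
    fun k _ => (hψ.smooth k).smul (hsm k)]
  simp only [listDeriv_smul (hψ.smooth _) (hsm _), listDeriv_smul (contDiff_cutoff hψ N) (hsm _)]
  rw [sum_list_sum, ← List.sum_map_add]
  congr 1
  refine List.map_congr_left fun q hq => ?_
  have hlen := length_add_length_of_mem_splits hq
  rw [partialSum]
  congr 1
  · refine Finset.sum_congr rfl fun k _ => ?_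
    by_cases hk : listDeriv q.1 (ψ k) x = 0
    · rw [hk, zero_smul, zero_smul]
    · have hx : x ∈ tsupport (ψ k) := tsupport_listDeriv_subset _ _ (subset_tsupport _ hk)
      have hxG : x ∈ exterior γ := by
        rw [hψ.cover]
        exact mem_iUnion_of_mem k hx
      obtain ⟨j, hj⟩ := exists_mem_layer hM hγ hxG
      have hkj := (abs_le.1 (hψ.abs_sub_le_one hj hx)).2
      rw [mollified_eq_moll, mollified_eq_moll, listDeriv_moll hA0 (by positivity) hω.smooth
        hω.hasCompactSupport hF (hf.isWeakDeriv q.2 (by omega)) fun z hz =>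
        sub_smul_stretch_mem_subgraph hM hγ hj.2.2 hkj (hω.support_subset hz)]
  · by_cases hk : listDeriv q.1 (cutoff ψ N) x = 0
    · rw [hk, zero_smul, zero_smul]
    · have hx : rho γ x ≤ (2 : ℝ) ^ (-((N : ℤ) - 1)) := by
        by_contra! hlt
        have hxG : x ∈ exterior γ :=
          (mem_exterior_iff hM hγ).2 (lt_trans (by positivity) hlt)
        obtain ⟨j, hj⟩ := exists_mem_layer hM hγ hxG
        have h3 := (zpow_lt_zpow_iff_right₀ (one_lt_two (α := ℝ))).1 (hlt.trans_le hj.2.2)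
        exact hk (listDeriv_cutoff_eq_zero hM hγ hψ hj (hxN j hj) (by omega) _)
      rw [mollified_eq_moll, mollified_eq_moll, listDeriv_moll hA0 (by positivity) hω.smooth
        hω.hasCompactSupport hF (hf.isWeakDeriv q.2 (by omega)) fun z hz =>
        sub_smul_stretch_mem_subgraph hM hγ hx (by omega) (hω.support_subset hz)]

/-- The weak derivative of the extension. -/
def extDeriv (M : ℝ) (ψ : ℤ → Space m → ℝ) (ω : Space m → ℝ)
    (f : List (Fin (m + 1)) → Space m → 𝕜) (L : List (Fin (m + 1))) (x : Space m) : 𝕜 :=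
  f L x + layerSum M ψ ω [] (f L) x +
    ((properSplits L).map fun q => layerSum M ψ ω q.1 (f q.2) x).sum

lemma locallyIntegrable_layerSum (hM : 0 ≤ M) (hγ : ∀ x y, |γ x - γ y| ≤ M * ‖x - y‖)
    (hψ : IsPartition γ ψ) (hω : IsKernel l ω) {F : Space m → 𝕜} (hF : LocallyIntegrable F)
    {L : List (Fin (m + 1))} (hL : L ≠ []) (hb : LocallyIntegrable (bracketSum γ M ψ ω L F)) :
    LocallyIntegrable (layerSum M ψ ω L F) :=
  hb.mono (measurable_layerSum hM hψ hω hF L).aestronglyMeasurable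
    (Filter.Eventually.of_forall fun x =>
      (norm_layerSum_le_bracketSum hM hγ hψ hL F x).trans (le_abs_self _))

/-- Both sides are limits of classical integration by parts for `partialSum`. The approximations are
smooth on the whole space, so no boundary term arises. -/
lemma integral_listDeriv_smul_ext (hM : 0 ≤ M) (hγ : ∀ x y, |γ x - γ y| ≤ M * ‖x - y‖)
    (hψ : IsPartition γ ψ) (hω : IsKernel l ω) {f : List (Fin (m + 1)) → Space m → 𝕜}
    (hf : IsSobolevFamily l (subgraph γ) f) {L : List (Fin (m + 1))} (hL : L.length ≤ l)
    (hb : ∀ L', LocallyIntegrable fun x =>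
      ∑' k, ψ k x • ‖mollified (16 * (M + 1)) ω (f L') k x‖)
    (hbr : ∀ q ∈ properSplits L, LocallyIntegrable (bracketSum γ M ψ ω q.1 (f q.2)))
    {η : Space m → ℝ} (hη : ContDiff ℝ (⊤ : ℕ∞) η) (hηs : HasCompactSupport η) :
    ∫ x, listDeriv L η x • (f [] x + layerSum M ψ ω [] (f []) x) =
      (-1 : ℝ) ^ L.length • ∫ x, η x • extDeriv M ψ ω f L x := by
  have hη' := contDiff_listDeriv hη L
  have hηs' := hasCompactSupport_listDeriv hηs L
  have hlim1 := tendsto_integral_partialSum_nil hM hγ hψ hω (hf.locallyIntegrable [])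
    (hf.eq_zero []) (hb []) hη'.continuous hηs'
  have hlimL := tendsto_integral_partialSum_nil hM hγ hψ hω (hf.locallyIntegrable L)
    (hf.eq_zero L) (hb L) hη.continuous hηs
  have hlimq := tendsto_list_sum (properSplits L) fun q hq =>
    tendsto_integral_partialSum hM hγ hψ hω (hf.locallyIntegrable q.2)
      (ne_nil_of_mem_properSplits hq) (hbr q hq) hη.continuous hηs
  have hlim2 := (hlimL.add hlimq).const_smul ((-1 : ℝ) ^ L.length)
  have hint : ∀ (N : ℕ) (q : List (Fin (m + 1)) × List (Fin (m + 1))),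
      Integrable fun x => η x • partialSum M ψ ω q.1 N (f q.2) x := fun N q =>
    (hη.continuous.smul (continuous_partialSum hM hψ hω (hf.locallyIntegrable q.2) q.1
      N)).integrable_of_hasCompactSupport hηs.smul_right
  have hfinal : (∫ x, η x • (f L x + layerSum M ψ ω [] (f L) x)) +
      ((properSplits L).map fun q => ∫ x, η x • layerSum M ψ ω q.1 (f q.2) x).sum =
      ∫ x, η x • extDeriv M ψ ω f L x := by
    have hi : ∀ q ∈ properSplits L, Integrable fun x => η x • layerSum M ψ ω q.1 (f q.2) x :=
      fun q hq => (locallyIntegrable_layerSum hM hγ hψ hω (hf.locallyIntegrable q.2)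
        (ne_nil_of_mem_properSplits hq) (hbr q hq)).integrable_smul_left_of_hasCompactSupport
        hη.continuous hηs
    rw [← integral_list_sum _ _ hi, ← integral_add]
    · congr 1
      funext x
      rw [extDeriv, smul_add (η x) (f L x + _), smul_list_sum]
    · exact ((hf.locallyIntegrable L).add (locallyIntegrable_layerSum_nil hM hγ hψ hω
        (hf.locallyIntegrable L) (hb L))).integrable_smul_left_of_hasCompactSupport
        hη.continuous hηs
    · exact integrable_list_sum _ _ hi
  rw [hfinal] at hlim2
  refine tendsto_nhds_unique (hlim1.congr' ?_) hlim2
  obtain ⟨N₀, hN₀⟩ := exists_layer_bound (m := m) hM hγ hηs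
  filter_upwards [Filter.eventually_ge_atTop N₀] with N hN
  rw [integral_listDeriv_smul hη hηs
    (contDiff_partialSum_nil hM hψ hω (hf.locallyIntegrable []) N)]
  congr 1
  rw [← integral_list_sum _ _ fun q _ => hint N q, ← integral_add (hint N ([], L))
    (integrable_list_sum _ _ fun q _ => hint N q)]
  congr 1
  funext x
  by_cases hx : x ∈ tsupport η
  · rw [listDeriv_partialSum hM hγ hψ hω hf hL (hN₀ N hN x hx), sum_splits, smul_add,
      smul_list_sum]
  · simp [image_eq_zero_of_notMem_tsupport hx]

end WeakDeriv

/-! ### Control of local integrals -/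

section Control

variable {m : ℕ} {ι : Type*} {p : ℝ} {Ω : Set (Space m)} {Θ Θ' u v : ι → Space m → ℝ≥0∞}

/-- The `p`-th power integrals of `u` over balls of radius `r` are controlled by those of `Θ` over
balls of radius `r` centred in `Ω`, uniformly in the index. -/
def BallControl (p : ℝ) (Ω : Set (Space m)) (Θ u : ι → Space m → ℝ≥0∞) : Prop :=
  ∃ C : ℝ≥0∞, C ≠ ∞ ∧ ∀ i r, 0 < r → ∀ (x₀ : Space m) (T : ℝ≥0∞),
    (∀ y ∈ Ω, ∫⁻ x in Metric.ball y r ∩ Ω, Θ i x ^ p ≤ T) →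
    ∫⁻ x in Metric.ball x₀ r, u i x ^ p ≤ C * T

lemma BallControl.mono (hp : 0 ≤ p) (h : BallControl p Ω Θ u) (hu : ∀ i x, v i x ≤ u i x)
    (hΘ : ∀ i x, Θ i x ≤ Θ' i x) : BallControl p Ω Θ' v := by
  obtain ⟨C, hC, H⟩ := h
  refine ⟨C, hC, fun i r hr x₀ T hT => ?_⟩
  refine (lintegral_mono fun x => ENNReal.rpow_le_rpow (hu i x) hp).trans (H i r hr x₀ T ?_)
  exact fun y hy => (lintegral_mono fun x => ENNReal.rpow_le_rpow (hΘ i x) hp).trans (hT y hy)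

lemma BallControl.add (hp : 1 ≤ p) (hu : BallControl p Ω Θ u) (hv : BallControl p Ω Θ v)
    (hm : ∀ i, Measurable (u i)) : BallControl p Ω Θ fun i x => u i x + v i x := by
  obtain ⟨C, hC, H⟩ := hu
  obtain ⟨C', hC', H'⟩ := hv
  refine ⟨2 ^ (p - 1) * (C + C'), ENNReal.mul_ne_top
    (ENNReal.rpow_ne_top_of_nonneg (by linarith) (by simp)) (by simp [hC, hC']),
    fun i r hr x₀ T hT => ?_⟩
  calc ∫⁻ x in Metric.ball x₀ r, (u i x + v i x) ^ p
      ≤ ∫⁻ x in Metric.ball x₀ r, 2 ^ (p - 1) * (u i x ^ p + v i x ^ p) :=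
        lintegral_mono fun x => ENNReal.rpow_add_le_mul_rpow_add_rpow _ _ hp
    _ = 2 ^ (p - 1) * ((∫⁻ x in Metric.ball x₀ r, u i x ^ p) +
          ∫⁻ x in Metric.ball x₀ r, v i x ^ p) := by
        rw [lintegral_const_mul' _ _ (ENNReal.rpow_ne_top_of_nonneg (by linarith) (by simp)),
          lintegral_add_left ((hm i).pow_const p)]
    _ ≤ 2 ^ (p - 1) * (C * T + C' * T) :=
        mul_le_mul_right (add_le_add (H i r hr x₀ T hT) (H' i r hr x₀ T hT)) _
    _ = _ := by ring

lemma ballControl_zero (hp : 1 ≤ p) : BallControl p Ω Θ fun _ _ => 0 :=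
  ⟨0, by simp, fun i r hr x₀ T hT => by simp [ENNReal.zero_rpow_of_pos (zero_lt_one.trans_le hp)]⟩

lemma BallControl.list_sum {κ : Type*} (hp : 1 ≤ p) (s : List κ) (w : κ → ι → Space m → ℝ≥0∞)
    (hw : ∀ q ∈ s, BallControl p Ω Θ (w q)) (hm : ∀ q ∈ s, ∀ i, Measurable (w q i)) :
    BallControl p Ω Θ fun i x => (s.map fun q => w q i x).sum := by
  induction s with
  | nil => simpa using ballControl_zero hp
  | cons q s ih =>
    simp only [List.map_cons, List.sum_cons]
    exact (hw q (by simp)).add hp (ih (fun q' hq' => hw q' (by simp [hq']))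
      fun q' hq' => hm q' (by simp [hq'])) (hm q (by simp))

lemma setLIntegral_rpow_eq_inter (hp : 0 < p) {U : Set (Space m)} (hU : MeasurableSet U)
    {g : Space m → ℝ≥0∞} (hg : ∀ x ∉ U, g x = 0) (s : Set (Space m)) :
    ∫⁻ x in s, g x ^ p = ∫⁻ x in s ∩ U, g x ^ p := by
  rw [inter_comm, ← setLIntegral_indicator hU]
  congr 1
  funext x
  by_cases hx : x ∈ U
  · rw [indicator_of_mem hx]
  · rw [indicator_of_notMem hx, hg x hx, ENNReal.zero_rpow_of_pos hp]

lemma ballControl_self (hp : 1 ≤ p) (hΩ : MeasurableSet Ω) (hΘ : ∀ i, ∀ x ∉ Ω, Θ i x = 0) :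
    BallControl p Ω Θ Θ := by
  obtain ⟨N, hN⟩ := exists_setLIntegral_ball_le (volume : Measure (Space m)) 1
  refine ⟨N, by simp, fun i r hr x₀ T hT => ?_⟩
  rw [setLIntegral_rpow_eq_inter (by linarith) hΩ (hΘ i)]
  simpa using hN Ω (fun x => Θ i x ^ p) r hr x₀ T hT

/-- The choice `T = ∫_Ω Θᵖ`, valid for all centres at once, turns the quantitative control into
local integrability. -/
lemma BallControl.lintegral_lt_top (h : BallControl p Ω Θ u) {i : ι}
    (hi : ∫⁻ x in Ω, Θ i x ^ p < ∞) (x₀ : Space m) {r : ℝ} (hr : 0 < r) :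
    ∫⁻ x in Metric.ball x₀ r, u i x ^ p < ∞ := by
  obtain ⟨C, hC, H⟩ := h
  exact (H i r hr x₀ _ fun y _ => lintegral_mono_set inter_subset_right).trans_lt
    (ENNReal.mul_lt_top hC.lt_top hi)

lemma memLp_restrict_iff {V : Type*} [NormedAddCommGroup V] (hp : 0 < p) {g : Space m → V}
    (hg : AEStronglyMeasurable g) (s : Set (Space m)) :
    MemLp g (ENNReal.ofReal p) (volume.restrict s) ↔ ∫⁻ x in s, ‖g x‖ₑ ^ p < ∞ := by
  have h := eLpNorm_lt_top_iff_lintegral_rpow_enorm_lt_top (f := g) (μ := volume.restrict s)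
    (p := ENNReal.ofReal p) (by simpa using hp) (by simp)
  rw [ENNReal.toReal_ofReal hp.le] at h
  rw [MemLp, ← h]
  simp [hg.restrict]

lemma memLpLoc_of_lintegral_ball {𝕜 : Type*} [RCLike 𝕜] (hp : 0 < p) {g : Space m → 𝕜}
    (hg : AEStronglyMeasurable g) (h : ∀ r, 0 < r → ∫⁻ x in Metric.ball 0 r, ‖g x‖ₑ ^ p < ∞) :
    MemLpLoc p univ g := by
  intro K _ hK
  obtain ⟨r, hr, hKr⟩ := hK.isBounded.subset_ball_lt 0 0
  exact (memLp_restrict_iff hp hg K).2 ((lintegral_mono_set hKr).trans_lt (h r hr))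

lemma locallyIntegrable_of_lintegral_ball {V : Type*} [NormedAddCommGroup V] (hp : 1 ≤ p)
    {g : Space m → V} (hg : AEStronglyMeasurable g)
    (h : ∀ r, 0 < r → ∫⁻ x in Metric.ball 0 r, ‖g x‖ₑ ^ p < ∞) : LocallyIntegrable g := by
  intro x
  have hr : 0 < ‖x‖ + 1 := by positivity
  refine ⟨Metric.ball 0 (‖x‖ + 1), Metric.isOpen_ball.mem_nhds (by simp), ?_⟩
  have : IsFiniteMeasure (volume.restrict (Metric.ball (0 : Space m) (‖x‖ + 1))) :=
    ⟨by simpa using measure_ball_lt_top⟩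
  exact ((memLp_restrict_iff (by linarith) hg _).2 (h _ hr)).integrable (by simpa using hp)

end Control

/-! ### Uniqueness and representatives of weak derivatives. -/

section Family

variable {m l : ℕ} {𝕜 : Type*} [RCLike 𝕜] {Ω : Set (Space m)} {α : Fin (m + 1) → ℕ}

lemma IsWeakDeriv.ae_eq (hΩ : IsOpen Ω) {f g g' : Space m → 𝕜} (h : IsWeakDeriv Ω α f g)
    (h' : IsWeakDeriv Ω α f g') : g =ᵐ[volume.restrict Ω] g' := by
  have hsub := hΩ.ae_eq_zero_of_integral_contDiff_smul_eq_zero (μ := volume)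
    (h.2.1.sub h'.2.1) fun η hη hηs hηΩ => ?_
  · rw [Filter.EventuallyEq, ae_restrict_iff' hΩ.measurableSet]
    filter_upwards [hsub] with x hx hxΩ using sub_eq_zero.1 (hx hxΩ)
  · have hint : ∀ {w : Space m → 𝕜}, LocallyIntegrableOn w Ω →
        IntegrableOn (fun x => η x • w x) Ω := by
      intro w hw
      have hw' : IntegrableOn (fun x => η x • w x) (tsupport η) :=
        (hw.integrableOn_compact_subset hηΩ hηs).continuousOn_smul hη.continuous.continuousOn hηs
      exact ((integrableOn_iff_integrable_of_support_subset
        ((Function.support_smul_subset_left η w).trans (subset_tsupport η))).1 hw').integrableOn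
    have hset : ∫ x, η x • (g - g') x = ∫ x in Ω, η x • (g - g') x := by
      rw [setIntegral_eq_integral_of_forall_compl_eq_zero]
      intro x hx
      rw [image_eq_zero_of_notMem_tsupport fun hx' => hx (hηΩ hx'), zero_smul]
    rw [hset]
    simp only [Pi.sub_apply, smul_sub]
    rw [integral_sub (hint h.2.1) (hint h'.2.1), sub_eq_zero]
    have h1 := h.2.2 η hη hηs hηΩ
    rw [h'.2.2 η hη hηs hηΩ] at h1
    exact (smul_right_injective 𝕜 (by simp : ((-1 : ℝ) ^ order α) ≠ 0) h1).symm

lemma IsWeakDeriv.congr {f f' g g' : Space m → 𝕜} (h : IsWeakDeriv Ω α f g)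
    (hf : f' =ᵐ[volume.restrict Ω] f) (hg : g' =ᵐ[volume.restrict Ω] g)
    (hf' : LocallyIntegrable f') (hg' : LocallyIntegrable g') : IsWeakDeriv Ω α f' g' := by
  refine ⟨hf'.locallyIntegrableOn Ω, hg'.locallyIntegrableOn Ω, fun η hη hηs hηΩ => ?_⟩
  have h1 : ∫ x in Ω, multiDeriv α η x • f' x = ∫ x in Ω, multiDeriv α η x • f x :=
    integral_congr_ae (hf.mono fun x hx => by simp only [hx])
  have h2 : ∫ x in Ω, η x • g' x = ∫ x in Ω, η x • g x :=
    integral_congr_ae (hg.mono fun x hx => by simp only [hx])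
  rw [h1, h2, h.2.2 η hη hηs hηΩ]

lemma isWeakDeriv_weakDeriv {f : Space m → 𝕜} (h : ∃ g, IsWeakDeriv Ω α f g) :
    IsWeakDeriv Ω α f (weakDeriv Ω α f) := by
  rw [weakDeriv, dif_pos h]
  exact h.choose_spec

lemma isWeakDeriv_zero {f : Space m → 𝕜} (hf : LocallyIntegrableOn f Ω) :
    IsWeakDeriv Ω 0 f f := by
  refine ⟨hf, hf, fun η hη _ _ => ?_⟩
  have h := listDeriv_eq_multiDeriv hη []
  simp only [listDeriv_nil, List.count_nil] at h
  have h0 : multiDeriv (0 : Fin (m + 1) → ℕ) η = η := h.symm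
  simp [h0, order]

/-- A function in a Sobolev space and its weak derivatives have Borel representatives that vanish
off the domain. -/
lemma MemSobolev.exists_family {p : ℝ} (hp : 1 ≤ p) (hΩ : IsOpen Ω) {f : Space m → 𝕜}
    (hf : MemSobolev l p Ω f) : ∃ F : List (Fin (m + 1)) → Space m → 𝕜, IsSobolevFamily l Ω F ∧
      (∀ L, ∫⁻ x in Ω, ‖F L x‖ₑ ^ p < ∞) ∧ F [] =ᵐ[volume.restrict Ω] f ∧
      ∀ L, L.length ≤ l → F L =ᵐ[volume.restrict Ω] weakDeriv Ω (fun i => L.count i) f := by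
  have hp0 : 0 < p := by linarith
  have hmeas := hΩ.measurableSet
  have hweak : ∀ α, order α ≤ l → IsWeakDeriv Ω α f (weakDeriv Ω α f) ∧
      MemLp (weakDeriv Ω α f) (ENNReal.ofReal p) (volume.restrict Ω) := by
    intro α hα
    obtain ⟨g, hg, hgp⟩ := hf.2 α hα
    have hw := isWeakDeriv_weakDeriv ⟨g, hg⟩
    exact ⟨hw, hgp.ae_eq (hg.ae_eq hΩ hw)⟩
  have hord : ∀ L : List (Fin (m + 1)), order (fun i => L.count i) = L.length := order_count
  have hrep : ∀ L : List (Fin (m + 1)), ∃ G : Space m → 𝕜, StronglyMeasurable G ∧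
      (∀ x ∉ Ω, G x = 0) ∧ MemLp G (ENNReal.ofReal p) ∧
      (L.length ≤ l → G =ᵐ[volume.restrict Ω] weakDeriv Ω (fun i => L.count i) f) := by
    intro L
    by_cases hL : L.length ≤ l
    · have hw := (hweak (fun i => L.count i) ((hord L).trans_le hL)).2
      have hae : Ω.indicator (hw.1.mk _) =ᵐ[volume.restrict Ω]
          weakDeriv Ω (fun i => L.count i) f :=
        (indicator_ae_eq_restrict hmeas).trans hw.1.ae_eq_mk.symm
      refine ⟨Ω.indicator (hw.1.mk _), hw.1.stronglyMeasurable_mk.indicator hmeas,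
        fun x hx => indicator_of_notMem hx _, ?_, fun _ => hae⟩
      rw [memLp_indicator_iff_restrict hmeas]
      exact hw.ae_eq hw.1.ae_eq_mk
    -- For lists longer than `l` the zero function keeps the measurability and integrability
    -- conditions free of a length restriction.
    · exact ⟨fun _ => 0, stronglyMeasurable_const, fun _ _ => rfl, MemLp.zero',
        fun h => absurd h hL⟩
  choose F hFm hF0 hFp hFw using hrep
  have hloc : ∀ L, LocallyIntegrable (F L) := fun L =>
    (hFp L).locallyIntegrable (by simpa using hp)
  have hnil : F [] =ᵐ[volume.restrict Ω] f := by
    refine (hFw [] (Nat.zero_le l)).trans ?_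
    -- The derivative of order zero picked by `weakDeriv` is not `f` itself; by uniqueness it agrees
    -- with `f` almost everywhere.
    have h0 := (hweak 0 (by simp [order])).1
    exact h0.ae_eq hΩ (isWeakDeriv_zero h0.1)
  refine ⟨F, ⟨hFm, hF0, hloc, fun L hL => ?_⟩, fun L => ?_, hnil, hFw⟩
  · exact (hweak _ ((hord L).trans_le hL)).1.congr hnil (hFw L hL) (hloc []) (hloc L)
  · exact (memLp_restrict_iff hp0 (hFm L).aestronglyMeasurable Ω).1 ((hFp L).restrict Ω)

end Family

/-! ### Estimates for the extension -/

section Estimates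

variable {m l : ℕ} {γ : EuclideanSpace ℝ (Fin m) → ℝ} {M p : ℝ} {ψ : ℤ → Space m → ℝ}
  {ω : Space m → ℝ} {𝕜 : Type*} [RCLike 𝕜]

/-- Sobolev families, as an index type. -/
abbrev Family (𝕜 : Type*) [RCLike 𝕜] (l : ℕ) (Ω : Set (Space m)) : Type _ :=
  {f : List (Fin (m + 1)) → Space m → 𝕜 // IsSobolevFamily l Ω f}

lemma measurable_tsum_norm_mollified (hM : 0 ≤ M) (hψ : IsPartition γ ψ) (hω : IsKernel l ω)
    {F : Space m → 𝕜} (hF : LocallyIntegrable F) :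
    Measurable fun x => ∑' k, ψ k x • ‖mollified (16 * (M + 1)) ω F k x‖ :=
  Measurable.tsum fun k => ((hψ.smooth k).continuous.smul
    (contDiff_mollified hM hω hF k).continuous.norm).measurable

lemma ballControl_of_layer_nil (hM : 0 ≤ M) (hγ : ∀ x y, |γ x - γ y| ≤ M * ‖x - y‖)
    (hω : IsKernel l ω) (hp : 1 ≤ p) (L : List (Fin (m + 1)))
    {u : Family 𝕜 l (subgraph γ) → Space m → ℝ≥0∞} (hu0 : ∀ f, ∀ x ∉ exterior γ, u f x = 0)
    (hu : ∀ f j, ∀ x ∈ layer γ j, u f x ≤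
      ∫⁻ ζ, ‖f.1 L (x - (2 : ℝ) ^ (-j) • ζ)‖ₑ ∂(totalDilationMeasure (16 * (M + 1)) ω)) :
    BallControl p (subgraph γ) (fun f : Family 𝕜 l (subgraph γ) => fun x => ‖f.1 L x‖ₑ) u := by
  obtain ⟨C, hC, H⟩ := exists_lintegral_layerSum_nil_le (m := m) hM hγ hω hp
  refine ⟨C, hC, fun f r hr x₀ T hT => ?_⟩
  rw [setLIntegral_rpow_eq_inter (by linarith) isOpen_exterior.measurableSet (hu0 f)]
  exact H _ (f.2.stronglyMeasurable L).measurable.enorm (u f) (hu f) r hr x₀ T hT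

lemma ballControl_tsum_norm_mollified (hM : 0 ≤ M) (hγ : ∀ x y, |γ x - γ y| ≤ M * ‖x - y‖)
    (hψ : IsPartition γ ψ) (hω : IsKernel l ω) (hp : 1 ≤ p) (L : List (Fin (m + 1))) :
    BallControl p (subgraph γ) (fun f : Family 𝕜 l (subgraph γ) => fun x => ‖f.1 L x‖ₑ)
      fun f x => ‖∑' k, ψ k x • ‖mollified (16 * (M + 1)) ω (f.1 L) k x‖‖ₑ := by
  refine ballControl_of_layer_nil hM hγ hω hp L (fun f x hx => ?_) fun f j x hx =>
    tsum_mul_enorm_mollified_le hψ hω (f.2.stronglyMeasurable L) hx _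
  have h : ∀ k, ψ k x = 0 := fun k => hψ.listDeriv_eq_zero_of_notMem hx k []
  simp [h]

lemma ballControl_add_layerSum_nil (hM : 0 ≤ M) (hγ : ∀ x y, |γ x - γ y| ≤ M * ‖x - y‖)
    (hψ : IsPartition γ ψ) (hω : IsKernel l ω) (hp : 1 ≤ p) (L : List (Fin (m + 1))) :
    BallControl p (subgraph γ) (fun f : Family 𝕜 l (subgraph γ) => fun x => ‖f.1 L x‖ₑ)
      fun f x => ‖f.1 L x + layerSum M ψ ω [] (f.1 L) x‖ₑ := by
  have h1 : BallControl p (subgraph γ)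
      (fun f : Family 𝕜 l (subgraph γ) => fun x => ‖f.1 L x‖ₑ)
      fun f x => ‖layerSum M ψ ω [] (f.1 L) x‖ₑ := by
    refine ballControl_of_layer_nil hM hγ hω hp L (fun f x hx => ?_) fun f j x hx =>
      enorm_layerSum_nil_le hψ hω (f.2.stronglyMeasurable L) hx
    simp [layerSum_eq_zero hψ hx]
  have h2 := ballControl_self (Θ := fun f : Family 𝕜 l (subgraph γ) => fun x => ‖f.1 L x‖ₑ) hp
    (isOpen_subgraph hM hγ).measurableSet fun f x hx => by simp [f.2.eq_zero L x hx]
  exact (h2.add hp h1 fun f => (f.2.stronglyMeasurable L).measurable.enorm).mono (by linarith)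
    (fun f x => enorm_add_le _ _) fun _ _ => le_rfl

lemma ballControl_bracketSum (hM : 0 ≤ M) (hγ : ∀ x y, |γ x - γ y| ≤ M * ‖x - y‖)
    (hψ : IsPartition γ ψ) (hω : IsKernel l ω) (hp : 1 ≤ p) {a b : List (Fin (m + 1))}
    (ha : a ≠ []) (hab : a.length + b.length = l) :
    BallControl p (subgraph γ) (fun f : Family 𝕜 l (subgraph γ) => topNorm l f.1)
      fun f x => ‖bracketSum γ M ψ ω a (f.1 b) x‖ₑ := by
  obtain ⟨C, hC, H⟩ := exists_lintegral_bracket_le (m := m) hM hγ hω hp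
  obtain ⟨K, hK, HK⟩ := exists_enorm_bracketSum_le (𝕜 := 𝕜) hM hγ hψ hω ha hab
  have hKp : K ^ p ≠ ∞ := ENNReal.rpow_ne_top_of_nonneg (by linarith) hK
  refine ⟨C * K ^ p, ENNReal.mul_ne_top hC hKp, fun f r hr x₀ T hT => ?_⟩
  rw [setLIntegral_rpow_eq_inter (by linarith) isOpen_exterior.measurableSet
    (g := fun x => ‖bracketSum γ M ψ ω a (f.1 b) x‖ₑ) fun x hx => by
    rw [bracketSum_of_notMem (γ := γ) (M := M) (ψ := ψ) (ω := ω) hx a (f.1 b), enorm_zero],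
    mul_assoc]
  refine H _ (f.2.measurable_topNorm.const_mul K) _ (HK f.1 f.2) r hr x₀ _ fun y hy => ?_
  simp only [ENNReal.mul_rpow_of_nonneg _ _ (by linarith : 0 ≤ p)]
  rw [lintegral_const_mul' _ _ hKp]
  exact mul_le_mul_right (hT y hy) _

lemma enorm_list_sum_le {κ : Type*} (s : List κ) (g : κ → 𝕜) :
    ‖(s.map g).sum‖ₑ ≤ (s.map fun q => ‖g q‖ₑ).sum := by
  induction s with
  | nil => simp
  | cons q s ih =>
    simp only [List.map_cons, List.sum_cons]
    exact (enorm_add_le _ _).trans (add_le_add le_rfl ih)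

/-- In every proper splitting the two lengths add up to `l`, so each term is controlled by
derivatives of order `l` alone. -/
lemma ballControl_extDeriv (hM : 0 ≤ M) (hγ : ∀ x y, |γ x - γ y| ≤ M * ‖x - y‖)
    (hψ : IsPartition γ ψ) (hω : IsKernel l ω) (hp : 1 ≤ p) {L : List (Fin (m + 1))}
    (hL : L.length = l) :
    BallControl p (subgraph γ) (fun f : Family 𝕜 l (subgraph γ) => topNorm l f.1)
      fun f x => ‖extDeriv M ψ ω f.1 L x‖ₑ := by
  have h1 := (ballControl_add_layerSum_nil (𝕜 := 𝕜) hM hγ hψ hω hp L).mono (by linarith)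
    (fun _ _ => le_rfl) fun f x => enorm_le_topNorm f.1 x hL
  have h2 := BallControl.list_sum hp (properSplits L)
    (fun q => fun (f : Family 𝕜 l (subgraph γ)) x => ‖bracketSum γ M ψ ω q.1 (f.1 q.2) x‖ₑ)
    (fun q hq => ballControl_bracketSum hM hγ hψ hω hp (ne_nil_of_mem_properSplits hq)
      ((length_add_length_of_mem_properSplits hq).trans hL))
    fun q _ f => (measurable_bracketSum hM hγ hψ hω (f.2.locallyIntegrable q.2) q.1).enorm
  refine (h1.add hp h2 fun f => ?_).mono (by linarith) (fun f x => ?_) fun _ _ => le_rfl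
  · exact ((f.2.stronglyMeasurable L).measurable.add
      (measurable_layerSum hM hψ hω (f.2.locallyIntegrable L) [])).enorm
  · refine (enorm_add_le _ _).trans (add_le_add le_rfl ((enorm_list_sum_le _ _).trans ?_))
    refine List.sum_le_sum fun q hq => ?_
    rw [enorm_le_iff_norm_le, Real.norm_eq_abs]
    exact (norm_layerSum_le_bracketSum hM hγ hψ (ne_nil_of_mem_properSplits hq) _ x).trans
      (le_abs_self _)

lemma measurable_extDeriv (hM : 0 ≤ M) (hψ : IsPartition γ ψ) (hω : IsKernel l ω)
    (f : Family 𝕜 l (subgraph γ)) (L : List (Fin (m + 1))) :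
    Measurable (extDeriv M ψ ω f.1 L) := by
  have hs : ∀ s : List (List (Fin (m + 1)) × List (Fin (m + 1))),
      Measurable fun x => (s.map fun q => layerSum M ψ ω q.1 (f.1 q.2) x).sum := by
    intro s
    induction s with
    | nil => simp
    | cons q s ih =>
      simp only [List.map_cons, List.sum_cons]
      exact (measurable_layerSum hM hψ hω (f.2.locallyIntegrable q.2) q.1).add ih
  exact ((f.2.stronglyMeasurable L).measurable.add
    (measurable_layerSum hM hψ hω (f.2.locallyIntegrable L) [])).add (hs _)

lemma topNorm_rpow_le (hp : 1 ≤ p) (f : List (Fin (m + 1)) → Space m → 𝕜) (x : Space m) :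
    topNorm l f x ^ p ≤ (Fintype.card (Fin l → Fin (m + 1)) : ℝ≥0∞) ^ (p - 1) *
      ∑ w : Fin l → Fin (m + 1), ‖f (List.ofFn w) x‖ₑ ^ p := by
  exact ENNReal.rpow_sum_le_const_mul_sum_rpow _ _ hp

lemma setLIntegral_topNorm_rpow_le (hp : 1 ≤ p) {Ω : Set (Space m)} (f : Family 𝕜 l Ω)
    (s : Set (Space m)) :
    ∫⁻ x in s, topNorm l f.1 x ^ p ≤ (Fintype.card (Fin l → Fin (m + 1)) : ℝ≥0∞) ^ (p - 1) *
      ∑ w : Fin l → Fin (m + 1), ∫⁻ x in s, ‖f.1 (List.ofFn w) x‖ₑ ^ p := by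
  refine (lintegral_mono fun x => topNorm_rpow_le hp f.1 x).trans_eq ?_
  rw [lintegral_const_mul' _ _ (ENNReal.rpow_ne_top_of_nonneg (by linarith) (by simp)),
    lintegral_finsetSum]
  exact fun w _ => (f.2.stronglyMeasurable _).measurable.enorm.pow_const p

lemma lintegral_topNorm_lt_top (hp : 1 ≤ p) {Ω : Set (Space m)} (f : Family 𝕜 l Ω)
    (hf : ∀ L, ∫⁻ x in Ω, ‖f.1 L x‖ₑ ^ p < ∞) : ∫⁻ x in Ω, topNorm l f.1 x ^ p < ∞ :=
  (setLIntegral_topNorm_rpow_le hp f Ω).trans_lt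
    (ENNReal.mul_lt_top (ENNReal.rpow_lt_top_of_nonneg (by linarith) (by simp))
      (ENNReal.sum_lt_top.2 fun w _ => hf _))

/-- Global integrability over Ω enters the ball estimates and supplies the locally integrable
majorants needed for the passage to the limit. -/
lemma isWeakDeriv_ext (hM : 0 ≤ M) (hγ : ∀ x y, |γ x - γ y| ≤ M * ‖x - y‖)
    (hψ : IsPartition γ ψ) (hω : IsKernel l ω) (hp : 1 ≤ p) (f : Family 𝕜 l (subgraph γ))
    (hf : ∀ L, ∫⁻ x in subgraph γ, ‖f.1 L x‖ₑ ^ p < ∞) {α : Fin (m + 1) → ℕ}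
    (hα : order α = l) :
    IsWeakDeriv univ α (fun x => f.1 [] x + layerSum M ψ ω [] (f.1 []) x)
      (extDeriv M ψ ω f.1 (multiList α)) := by
  have hlen : (multiList α).length = l := (length_multiList α).trans hα
  have htop := lintegral_topNorm_lt_top hp f hf
  have hlocE : LocallyIntegrable (extDeriv M ψ ω f.1 (multiList α)) :=
    locallyIntegrable_of_lintegral_ball hp
      (measurable_extDeriv hM hψ hω f _).aestronglyMeasurable fun r hr =>
      (ballControl_extDeriv (𝕜 := 𝕜) hM hγ hψ hω hp hlen).lintegral_lt_top (i := f) htop 0 hr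
  have hlocT : LocallyIntegrable fun x => f.1 [] x + layerSum M ψ ω [] (f.1 []) x :=
    locallyIntegrable_of_lintegral_ball hp ((f.2.stronglyMeasurable []).measurable.add
      (measurable_layerSum hM hψ hω (f.2.locallyIntegrable []) [])).aestronglyMeasurable
      fun r hr => (ballControl_add_layerSum_nil (𝕜 := 𝕜) hM hγ hψ hω hp []).lintegral_lt_top
        (i := f) (hf []) 0 hr
  refine ⟨hlocT.locallyIntegrableOn _, hlocE.locallyIntegrableOn _, fun η hη hηs _ => ?_⟩
  rw [Measure.restrict_univ, multiDeriv_eq_listDeriv, ← length_multiList]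
  refine integral_listDeriv_smul_ext hM hγ hψ hω f.2 hlen.le (fun L => ?_) (fun q hq => ?_) hη hηs
  · exact locallyIntegrable_of_lintegral_ball hp
      (measurable_tsum_norm_mollified hM hψ hω (f.2.locallyIntegrable L)).aestronglyMeasurable
      fun r hr => (ballControl_tsum_norm_mollified (𝕜 := 𝕜) hM hγ hψ hω hp L).lintegral_lt_top
        (i := f) (hf L) 0 hr
  · exact locallyIntegrable_of_lintegral_ball hp
      (measurable_bracketSum hM hγ hψ hω (f.2.locallyIntegrable q.2) q.1).aestronglyMeasurable
      fun r hr => (ballControl_bracketSum (𝕜 := 𝕜) hM hγ hψ hω hp (ne_nil_of_mem_properSplits hq)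
        ((length_add_length_of_mem_properSplits hq).trans hlen)).lintegral_lt_top
        (i := f) htop 0 hr

/-- On the exterior equality holds at every point: whenever `ψ_k x ≠ 0`, the average sees only
points of Ω and ignores null sets. -/
lemma burenkovExt_congr_ae (hM : 0 ≤ M) (hγ : ∀ x y, |γ x - γ y| ≤ M * ‖x - y‖)
    {f F : Space m → 𝕜} (hψ : IsPartition γ ψ) (hω : IsKernel l ω)
    (h : F =ᵐ[volume.restrict (subgraph γ)] f) :
    burenkovExt γ M ψ ω f =ᵐ[volume] burenkovExt γ M ψ ω F := by
  have hΩ := (isOpen_subgraph hM hγ).measurableSet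
  have h' := (ae_restrict_iff' hΩ).1 h
  filter_upwards [h'] with x hx
  unfold burenkovExt
  split_ifs with h1 h2
  · exact (hx h1).symm
  · refine tsum_congr fun k => ?_
    by_cases hk : ψ k x = 0
    · rw [hk, zero_smul, zero_smul]
    · obtain ⟨j, hj⟩ := exists_mem_layer hM hγ h2
      have hkj := (abs_le.1 (hψ.abs_sub_le_one hj (subset_tsupport _ hk))).2
      rw [mollified_eq_moll, mollified_eq_moll]
      congr 1
      exact (moll_congr_ae (by positivity) (by positivity) hΩ h fun z hz =>
        sub_smul_stretch_mem_subgraph hM hγ hj.2.2 hkj (hω.support_subset hz)).symm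
  · rfl

end Estimates

/-! ### From ball integrals to Morrey norms. -/

section Morrey

variable {m l : ℕ} {𝕜 : Type*} [RCLike 𝕜] {p : ℝ} {φ : ℝ → ℝ} {δ : ℝ≥0∞} {Ω : Set (Space m)}

lemma setLIntegral_le_morreyNorm (hp : 0 < p) (hφ : ∀ r, 0 < r → 0 < φ r) (f : Space m → 𝕜)
    {y : Space m} (hy : y ∈ Ω) {r : ℝ} (hr : 0 < r) (hrδ : ENNReal.ofReal r < δ) :
    ∫⁻ x in Metric.ball y r ∩ Ω, ‖f x‖ₑ ^ p ≤
      ENNReal.ofReal (φ r) * morreyNorm φ δ p Ω f ^ p := by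
  have h : ((ENNReal.ofReal (φ r))⁻¹ * ∫⁻ x in Metric.ball y r ∩ Ω, ‖f x‖ₑ ^ p) ^ (1 / p) ≤
      morreyNorm φ δ p Ω f :=
    le_iSup₂_of_le y hy (le_iSup₂_of_le r ⟨hr, hrδ⟩ le_rfl)
  rw [one_div, ENNReal.rpow_inv_le_iff hp] at h
  exact (ENNReal.inv_mul_le_iff (by simpa using hφ r hr) (by simp)).1 h

lemma morreyNorm_univ_le (hp : 0 < p) (hφ : ∀ r, 0 < r → 0 < φ r) {g : Space m → 𝕜}
    {C S : ℝ≥0∞} (h : ∀ r, 0 < r → ENNReal.ofReal r < δ → ∀ x₀,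
      ∫⁻ x in Metric.ball x₀ r, ‖g x‖ₑ ^ p ≤ C * (ENNReal.ofReal (φ r) * S ^ p)) :
    morreyNorm φ δ p univ g ≤ C ^ (1 / p) * S := by
  refine iSup₂_le fun x _ => iSup₂_le fun r hr => ?_
  have hS : C ^ (1 / p) * S = (C * S ^ p) ^ (1 / p) := by
    rw [ENNReal.mul_rpow_of_nonneg _ _ (by positivity), ← ENNReal.rpow_mul,
      mul_one_div_cancel hp.ne', ENNReal.rpow_one]
  rw [hS, inter_univ]
  refine ENNReal.rpow_le_rpow ?_ (by positivity)
  refine (ENNReal.inv_mul_le_iff (by simpa using hφ r hr.1) (by simp)).2 ?_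
  refine (h r hr.1 hr.2 x).trans_eq ?_
  ring

lemma morreyNorm_congr_ae {f g : Space m → 𝕜} (h : f =ᵐ[volume.restrict Ω] g) :
    morreyNorm φ δ p Ω f = morreyNorm φ δ p Ω g := by
  unfold morreyNorm
  refine iSup_congr fun x => iSup_congr fun _ => iSup_congr fun r => iSup_congr fun _ => ?_
  congr 2
  refine lintegral_congr_ae ?_
  filter_upwards [ae_mono (Measure.restrict_mono inter_subset_right le_rfl) h] with y hy
  rw [hy]

lemma MemLpLoc.congr_ae {f g : Space m → 𝕜} (hg : MemLpLoc p univ g) (h : f =ᵐ[volume] g) :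
    MemLpLoc p univ f :=
  fun K hK hKc => (hg K hK hKc).ae_eq (ae_restrict_of_ae h.symm)

lemma order_count_ofFn (w : Fin l → Fin (m + 1)) : order (fun i => (List.ofFn w).count i) = l := by
  rw [order_count, List.length_ofFn]

/-- The power `p - 1` of the number of words comes from convexity, its first power from bounding
each word by the whole sum; several words may represent the same multi-index. -/
lemma topNorm_le_morreyNorm (hp : 1 ≤ p) (hφ : ∀ r, 0 < r → 0 < φ r)
    (F : Family 𝕜 l Ω) {f : Space m → 𝕜}
    (hF : ∀ L : List (Fin (m + 1)), L.length ≤ l →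
      F.1 L =ᵐ[volume.restrict Ω] weakDeriv Ω (fun i => L.count i) f)
    {y : Space m} (hy : y ∈ Ω) {r : ℝ} (hr : 0 < r) (hrδ : ENNReal.ofReal r < δ) :
    ∫⁻ x in Metric.ball y r ∩ Ω, topNorm l F.1 x ^ p ≤
      ((Fintype.card (Fin l → Fin (m + 1)) : ℝ≥0∞) ^ (p - 1) *
        Fintype.card (Fin l → Fin (m + 1))) * (ENNReal.ofReal (φ r) *
      (∑ β ∈ Finset.piAntidiag Finset.univ l, morreyNorm φ δ p Ω (weakDeriv Ω β f)) ^ p) := by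
  rw [mul_assoc]
  refine (setLIntegral_topNorm_rpow_le hp F _).trans (mul_le_mul_right ?_ _)
  rw [← nsmul_eq_mul]
  refine Finset.sum_le_card_nsmul _ _ _ fun w _ => ?_
  refine (setLIntegral_le_morreyNorm (by linarith) hφ (F.1 (List.ofFn w)) hy hr hrδ).trans
    (mul_le_mul_right (ENNReal.rpow_le_rpow ?_ (by linarith)) _)
  rw [morreyNorm_congr_ae (hF _ (by simp))]
  refine Finset.single_le_sum (f := fun β => morreyNorm φ δ p Ω (weakDeriv Ω β f))
    (fun _ _ => zero_le) ?_
  have h := order_count_ofFn w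
  simpa [order, Finset.mem_piAntidiag] using h

end Morrey

/-! ### The two Morrey estimates for the extension. -/

section Main

variable {m l : ℕ} {γ : EuclideanSpace ℝ (Fin m) → ℝ} {M p : ℝ} {ψ : ℤ → Space m → ℝ}
  {ω : Space m → ℝ} {𝕜 : Type*} [RCLike 𝕜] {φ : ℝ → ℝ}

lemma le_ofReal_toReal_add_one {C : ℝ≥0∞} (hC : C ≠ ∞) : C ≤ ENNReal.ofReal (C.toReal + 1) := by
  rw [ENNReal.le_ofReal_iff_toReal_le hC (by positivity)]
  linarith

theorem exists_morreyNorm_ext_le (hM : 0 ≤ M) (hγ : ∀ x y, |γ x - γ y| ≤ M * ‖x - y‖)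
    (hψ : IsPartition γ ψ) (hω : IsKernel l ω) (hp : 1 ≤ p) (hφ : ∀ r, 0 < r → 0 < φ r) :
    ∃ c : ℝ, 0 < c ∧ ∀ (δ : ℝ≥0∞) (f : Space m → 𝕜), MemSobolev l p (subgraph γ) f →
      MemLpLoc p univ (burenkovExt γ M ψ ω f) ∧
      morreyNorm φ δ p univ (burenkovExt γ M ψ ω f) ≤
        ENNReal.ofReal c * morreyNorm φ δ p (subgraph γ) f := by
  have hp0 : 0 < p := by linarith
  have hctl := ballControl_add_layerSum_nil (𝕜 := 𝕜) hM hγ hψ hω hp []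
  obtain ⟨C, hC, H⟩ := id hctl
  have hCp : C ^ (1 / p) ≠ ∞ := ENNReal.rpow_ne_top_of_nonneg (by positivity) hC
  refine ⟨(C ^ (1 / p)).toReal + 1, by positivity, fun δ f hf => ?_⟩
  obtain ⟨F, hF, hFp, hFf, -⟩ := hf.exists_family hp (isOpen_subgraph hM hγ)
  have hae : burenkovExt γ M ψ ω f =ᵐ[volume]
      fun x => F [] x + layerSum M ψ ω [] (F []) x :=
    (burenkovExt_congr_ae hM hγ hψ hω hFf).trans
      (Filter.Eventually.of_forall (burenkovExt_eq_add hψ (hF.eq_zero [])))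
  refine ⟨MemLpLoc.congr_ae (memLpLoc_of_lintegral_ball hp0 ((hF.stronglyMeasurable
    []).measurable.add (measurable_layerSum hM hψ hω (hF.locallyIntegrable [])
    [])).aestronglyMeasurable fun r hr =>
    hctl.lintegral_lt_top (i := ⟨F, hF⟩) (hFp []) 0 hr) hae, ?_⟩
  rw [morreyNorm_congr_ae (ae_restrict_of_ae hae), ← morreyNorm_congr_ae hFf]
  refine (morreyNorm_univ_le (C := C) hp0 hφ fun r hr hrδ x₀ => ?_).trans
    (mul_le_mul_left (le_ofReal_toReal_add_one hCp) _)
  -- Here `T = φ(r)‖f‖ᵖ`, with the same radius on both sides; hence the constant does not depend on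
  -- `δ`.
  exact H ⟨F, hF⟩ r hr x₀ _ fun y hy => setLIntegral_le_morreyNorm hp0 hφ (F []) hy hr hrδ

theorem exists_morreyNorm_weakDeriv_ext_le (hM : 0 ≤ M)
    (hγ : ∀ x y, |γ x - γ y| ≤ M * ‖x - y‖) (hψ : IsPartition γ ψ) (hω : IsKernel l ω)
    (hp : 1 ≤ p) (hφ : ∀ r, 0 < r → 0 < φ r) :
    ∃ c : ℝ, 0 < c ∧ ∀ (δ : ℝ≥0∞) (f : Space m → 𝕜), MemSobolev l p (subgraph γ) f →
      ∀ α : Fin (m + 1) → ℕ, order α = l →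
        (∃ g, IsWeakDeriv univ α (burenkovExt γ M ψ ω f) g) ∧
        MemLpLoc p univ (weakDeriv univ α (burenkovExt γ M ψ ω f)) ∧
        morreyNorm φ δ p univ (weakDeriv univ α (burenkovExt γ M ψ ω f)) ≤
          ENNReal.ofReal c * ∑ β ∈ Finset.piAntidiag Finset.univ l,
            morreyNorm φ δ p (subgraph γ) (weakDeriv (subgraph γ) β f) := by
  have hp0 : 0 < p := by linarith
  have hctl : ∀ α : Fin (m + 1) → ℕ, order α = l →
      BallControl p (subgraph γ) (fun f : Family 𝕜 l (subgraph γ) => topNorm l f.1)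
        fun f x => ‖extDeriv M ψ ω f.1 (multiList α) x‖ₑ := fun α hα =>
    ballControl_extDeriv hM hγ hψ hω hp ((length_multiList α).trans hα)
  have hctl' := id hctl
  choose! C hC H using hctl'
  set D : ℝ≥0∞ := (Fintype.card (Fin l → Fin (m + 1)) : ℝ≥0∞) ^ (p - 1) *
    Fintype.card (Fin l → Fin (m + 1)) with hD
  have hDtop : D ≠ ∞ := ENNReal.mul_ne_top
    (ENNReal.rpow_ne_top_of_nonneg (by linarith) (by simp)) (by simp)
  -- Each `α` has its own constant; the sum over the finitely many multi-indices of order `l` serves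
  -- for all.
  set A : ℝ≥0∞ := ∑ α ∈ Finset.piAntidiag Finset.univ l, C α with hA
  have hmem : ∀ α : Fin (m + 1) → ℕ, α ∈ Finset.piAntidiag Finset.univ l ↔ order α = l := by
    intro α
    simp [order, Finset.mem_piAntidiag]
  have hAtop : A ≠ ∞ := ENNReal.sum_ne_top.2 fun α hα => hC α ((hmem α).1 hα)
  have hADp : (A * D) ^ (1 / p) ≠ ∞ :=
    ENNReal.rpow_ne_top_of_nonneg (by positivity) (ENNReal.mul_ne_top hAtop hDtop)
  refine ⟨((A * D) ^ (1 / p)).toReal + 1, by positivity, fun δ f hf α hα => ?_⟩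
  obtain ⟨F, hF, hFp, hFf, hFw⟩ := hf.exists_family hp (isOpen_subgraph hM hγ)
  have hae : burenkovExt γ M ψ ω f =ᵐ[volume]
      fun x => F [] x + layerSum M ψ ω [] (F []) x :=
    (burenkovExt_congr_ae hM hγ hψ hω hFf).trans
      (Filter.Eventually.of_forall (burenkovExt_eq_add hψ (hF.eq_zero [])))
  have hwd := isWeakDeriv_ext hM hγ hψ hω hp ⟨F, hF⟩ hFp hα
  have hwd' : IsWeakDeriv univ α (burenkovExt γ M ψ ω f) (extDeriv M ψ ω F (multiList α)) :=
    hwd.congr (ae_restrict_of_ae hae) Filter.EventuallyEq.rfl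
      ((locallyIntegrableOn_univ.1 hwd.1).congr hae.symm) (locallyIntegrableOn_univ.1 hwd.2.1)
  have hweq : weakDeriv univ α (burenkovExt γ M ψ ω f) =ᵐ[volume]
      extDeriv M ψ ω F (multiList α) := by
    simpa using (isWeakDeriv_weakDeriv ⟨_, hwd'⟩).ae_eq isOpen_univ hwd'
  refine ⟨⟨_, hwd'⟩, MemLpLoc.congr_ae (memLpLoc_of_lintegral_ball hp0
    (measurable_extDeriv hM hψ hω ⟨F, hF⟩ _).aestronglyMeasurable fun r hr =>
    (hctl α hα).lintegral_lt_top (i := ⟨F, hF⟩)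
      (lintegral_topNorm_lt_top hp ⟨F, hF⟩ hFp) 0 hr) hweq, ?_⟩
  rw [morreyNorm_congr_ae (ae_restrict_of_ae hweq)]
  refine (morreyNorm_univ_le (C := A * D) hp0 hφ fun r hr hrδ x₀ => ?_).trans
    (mul_le_mul_left (le_ofReal_toReal_add_one hADp) _)
  rw [mul_assoc]
  refine (H α hα ⟨F, hF⟩ r hr x₀ _ fun y hy =>
    topNorm_le_morreyNorm hp hφ ⟨F, hF⟩ hFw hy hr hrδ).trans
    (mul_le_mul_left ?_ _)
  exact Finset.single_le_sum (f := C) (fun _ _ => zero_le) ((hmem α).2 hα)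

end Main

end BurenkovMorrey

end

theorem corollary2p5 {𝕜 : Type*} [RCLike 𝕜] (m l : ℕ) (p : ℝ) (hp : 1 ≤ p)
    (φ : ℝ → ℝ) (hφ : ∀ r, 0 < r → 0 < φ r)
    (M : ℝ) (hM : 0 < M) (γ : EuclideanSpace ℝ (Fin m) → ℝ)
    (hγ : ∀ x y, |γ x - γ y| ≤ M * ‖x - y‖)
    (ψ : ℤ → Space m → ℝ) (hψ : IsPartition γ ψ)
    (ω : Space m → ℝ) (hω : IsKernel l ω) :
    (∃ c : ℝ, 0 < c ∧ ∀ δ : ℝ≥0∞, 0 < δ → ∀ f : Space m → 𝕜, MemSobolev l p (subgraph γ) f →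
      MemLpLoc p Set.univ (burenkovExt γ M ψ ω f) ∧
      morreyNorm φ δ p Set.univ (burenkovExt γ M ψ ω f) ≤
        ENNReal.ofReal c * morreyNorm φ δ p (subgraph γ) f) ∧
    (∀ D : ℝ, 0 < D → ∃ c : ℝ, 0 < c ∧ ∀ δ : ℝ≥0∞, 0 < δ → ∀ f : Space m → 𝕜,
      MemSobolev l p (subgraph γ) f →
      essSupport (subgraph γ) f ⊆ {x | x ∈ subgraph γ ∧ |rho γ x| < D} →
      ∀ α : Fin (m + 1) → ℕ, order α = l →
        (∃ g, IsWeakDeriv Set.univ α (burenkovExt γ M ψ ω f) g) ∧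
        MemLpLoc p Set.univ (weakDeriv Set.univ α (burenkovExt γ M ψ ω f)) ∧
        morreyNorm φ δ p Set.univ (weakDeriv Set.univ α (burenkovExt γ M ψ ω f)) ≤
          ENNReal.ofReal c * ∑ β ∈ Finset.piAntidiag Finset.univ l,
            morreyNorm φ δ p (subgraph γ) (weakDeriv (subgraph γ) β f)) := by
  obtain ⟨c, hc, h⟩ := exists_morreyNorm_ext_le (𝕜 := 𝕜) hM.le hγ hψ hω hp hφ
  obtain ⟨c', hc', h'⟩ := exists_morreyNorm_weakDeriv_ext_le (𝕜 := 𝕜) hM.le hγ hψ hω hp hφ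
  exact ⟨⟨c, hc, fun δ _ f hf => h δ f hf⟩,
    fun _ _ => ⟨c', hc', fun δ _ f hf _ α hα => h' δ f hf α hα⟩⟩
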